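/- Let $M$ be a smooth 4-manifold. Locally, in a (pseudo-)orthonormal frame of a metric $g$ with the associated spin frame, primed indices refer to the self-dual side: a self-dual 2-form is $\omega_{ab}=\chi_{A'B'}\epsilon_{AB}$ with $\chi_{A'B'}$ symmetric, $\tilde\Psi_{A'B'C'D'}$ is the self-dual Weyl spinor, and $\nabla$ is the Levi-Civita connection and the connection it induces on spinors. All fields are smooth. A nowhere vanishing primed spinor field $\alpha_{A'}$ on an open set $U\subseteq M$ is shear-free if $\alpha^{A'}\alpha^{B'}\nabla_{AA'}\alpha_{B'}=0$; the charged twistor equation for $\alpha$ is $$\nabla_{A(A'}\alpha_{B')}=\mathcal A_{A(A'}\alpha_{B')}\qquad(\ast)$$ for a complex-valued 1-form $\mathcal A_a$ on $U$. (i) Let $(M,g)$ be an oriented Riemannian 4-manifold that is hyper-Kähler with anti-self-dual Riemann tensor, i.e. $R_{ab}=0$ and $\tilde\Psi_{A'B'C'D'}=0$, and conformally Kähler with the same orientation, i.e. there are an integrable complex structure $J$ compatible with $g$, whose fundamental 2-form $\kappa_{ab}=g_{bc}J^c{}_a$ is self-dual, and a nowhere zero function $\Omega$ such that $\Omega^2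 g$ is Kähler with respect to $J$. Let $K_{A'B'}$ be the associated Killing spinor, $\kappa_{ab}=\Omega K_{A'B'}\epsilon_{AB}$, and let $K_{A'B'}=\alpha_{(A'}\beta_{B')}$ on an open set $U$. Then there is exactly one 1-form $\mathcal A$ on $U$ with $(\ast)$; it is smooth; it is imaginary-valued, so that $\nabla-\mathcal A$ is a $U(1)$ connection, if $\beta_{A'}=\mathrm i\,\alpha^\dagger_{A'}$, where $\dagger$ is Euclidean spinor conjugation; and it is anti-self-dual: $$\nabla_{A(A'}\mathcal A^{A}{}_{B')}=0,\qquad\text{equivalently}\qquad *\,\mathrm d\mathcal A=-\mathrm d\mathcal A .$$ (ii) More generally, let $g$ be a pseudo-Riemannian metric of any signature on $M$, and let $\alpha_{A'}$ be a nowhere vanishing shear-free primed spinor field on an open set $U$. Then there is exactly one 1-form $\mathcal A$ on $U$ with $(\ast)$, it is smooth, and if $\tilde\Psi_{A'B'C'D'}\alpha^{D'}=0$ on $U$, then $\nabla_{A(A'}\mathcal A^{A}{}_{B')}=0$ on $U$. If moreover $g$ is Riemannian, the condition $\tilde\Psi_{A'B'C'D'}\alpha^{D'}=0$ forces $\tilde\Psi_{A'B'C'D'}=0$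 on $U$, and $*\,\mathrm d\mathcal A=-\mathrm d\mathcal A$ there. -/

import Mathlib

open scoped Manifold ContDiff
open Bundle

noncomputable section

namespace SpinGeometry

/-- The model space `ℝ⁴`. -/
abbrev E4 : Type := EuclideanSpace ℝ (Fin 4)

section Manifold

variable (M : Type*) [TopologicalSpace M] [ChartedSpace E4 M]

/-- (Not necessarily smooth) vector fields on `M`. -/
abbrev VField : Type _ := (x : M) → TangentSpace (𝓡 4) x

/-- Fields of bilinear forms `g_{ab}` on `M`. -/
abbrev BilinField : Type _ :=
  (x : M) → TangentSpace (𝓡 4) x →L[ℝ] TangentSpace (𝓡 4) x →L[ℝ] ℝ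

/-- Fields of endomorphisms `J^a_b` of the tangent spaces of `M`. -/
abbrev EndField : Type _ :=
  (x : M) → TangentSpace (𝓡 4) x →L[ℝ] TangentSpace (𝓡 4) x

/-- Complex-valued 1-forms on `M`. -/
abbrev CForm : Type _ := (x : M) → TangentSpace (𝓡 4) x →L[ℝ] ℂ

/-- Smooth Riemannian metrics on `M`. -/
abbrev Metric [IsManifold (𝓡 4) ∞ M] : Type _ :=
  ContMDiffRiemannianMetric (𝓡 4) ∞ E4 (fun x : M => TangentSpace (𝓡 4) x)

variable {M}

/-- The vector field `X` is smooth on `U`. -/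
def SmoothFieldOn [IsManifold (𝓡 4) ∞ M] (X : VField M) (U : Set M) : Prop :=
  ContMDiffOn (𝓡 4) (𝓡 4).tangent ∞ (fun x => (⟨x, X x⟩ : TangentBundle (𝓡 4) M)) U

/-- The vector field `X` is smooth at `x`. -/
def SmoothFieldAt [IsManifold (𝓡 4) ∞ M] (X : VField M) (x : M) : Prop :=
  ContMDiffAt (𝓡 4) (𝓡 4).tangent ∞ (fun y => (⟨y, X y⟩ : TangentBundle (𝓡 4) M)) x

/-- The derivative `X f` of a real function along a vector field. -/
def dirR (X : VField M) (f : M → ℝ) (x : M) : ℝ := mfderiv (𝓡 4) 𝓘(ℝ, ℝ) f x (X x)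

/-- The derivative `X f` of a complex function along a real vector field. -/
def dirC (X : VField M) (f : M → ℂ) (x : M) : ℂ := mfderiv (𝓡 4) 𝓘(ℝ, ℂ) f x (X x)

/-- The Lie bracket of vector fields. -/
def bracket (X Y : VField M) : VField M := VectorField.mlieBracket (𝓡 4) X Y

/-! ### Pseudo-Riemannian metrics, orientations, frames -/

/-- `g` is a smooth pseudo-Riemannian metric, of any signature. -/
structure IsPseudoRiemannian [IsManifold (𝓡 4) ∞ M] (g : BilinField M) : Prop where
  symm : ∀ x v w, g x v w = g x w v
  nondegenerate : ∀ x v, (∀ w, g x v w = 0) → v = 0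
  smooth : ContMDiff (𝓡 4) ((𝓡 4).prod 𝓘(ℝ, E4 →L[ℝ] E4 →L[ℝ] ℝ)) ∞
    (fun x => TotalSpace.mk' (E4 →L[ℝ] E4 →L[ℝ] ℝ)
      (E := fun x : M => TangentSpace (𝓡 4) x →L[ℝ] TangentSpace (𝓡 4) x →L[ℝ] ℝ) x (g x))

variable (M) in
/-- An orientation of `M`: an orientation of every tangent space which, near every point, is the
one of a smooth local frame. -/
structure Orient [IsManifold (𝓡 4) ∞ M] where
  toFun : ∀ x : M, Orientation ℝ (TangentSpace (𝓡 4) x) (Fin 4)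
  locally_frame : ∀ x₀ : M, ∃ U : Set M, IsOpen U ∧ x₀ ∈ U ∧ ∃ X : Fin 4 → VField M,
    (∀ i, SmoothFieldOn (X i) U) ∧ ∀ x ∈ U, ∃ b : Module.Basis (Fin 4) ℝ (TangentSpace (𝓡 4) x),
      (∀ i, b i = X i x) ∧ b.orientation = toFun x

/-- `e` is a smooth pseudo-orthonormal frame of `g` on `U`, with signs `g(e_i, e_i) = η_i = ±1`. -/
structure IsFrame [IsManifold (𝓡 4) ∞ M] (g : BilinField M) (η : Fin 4 → ℝ) (U : Set M)
    (e : Fin 4 → VField M) : Prop where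
  sign : ∀ i, η i = 1 ∨ η i = -1
  smooth : ∀ i, SmoothFieldOn (e i) U
  orthonormal : ∀ x ∈ U, ∀ i j, g x (e i x) (e j x) = if i = j then η i else 0

/-- The signs of an orthonormal frame of a Riemannian metric. -/
def euclid : Fin 4 → ℝ := fun _ => 1

/-- `e` is a smooth, positively oriented, orthonormal frame of the Riemannian metric `g` on `U`. -/
structure IsOrientedFrame [IsManifold (𝓡 4) ∞ M] (g : BilinField M) (o : Orient M) (U : Set M)
    (e : Fin 4 → VField M) : Prop extends IsFrame g euclid U e where
  oriented : ∀ x ∈ U, ∃ b : Module.Basis (Fin 4) ℝ (TangentSpace (𝓡 4) x),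
    (∀ i, b i = e i x) ∧ b.orientation = o.toFun x

/-! ### The Levi-Civita connection and its curvature in a (pseudo-)orthonormal frame -/

/-- `γ_{ijk} = g(∇_{e_i} e_j, e_k)` for the Levi-Civita connection, by the Koszul formula
(the functions `g(e_i, e_j)` being constant). Thus `∇_{e_i} e_j = ∑_k η_k γ_{ijk} e_k`. -/
def conn (g : BilinField M) (e : Fin 4 → VField M) (i j k : Fin 4) (x : M) : ℝ :=
  (1 / 2) * (g x (bracket (e i) (e j) x) (e k x) - g x (bracket (e j) (e k) x) (e i x)
    + g x (bracket (e k) (e i) x) (e j x))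

/-- `R_{ijkl} = g(∇_{e_i} ∇_{e_j} e_k - ∇_{e_j} ∇_{e_i} e_k - ∇_{[e_i, e_j]} e_k, e_l)`. -/
def riem (g : BilinField M) (η : Fin 4 → ℝ) (e : Fin 4 → VField M) (i j k l : Fin 4) (x : M) : ℝ :=
  dirR (e i) (conn g e j k l) x - dirR (e j) (conn g e i k l) x
    + ∑ m, η m * (conn g e j k m x * conn g e i m l x - conn g e i k m x * conn g e j m l x)
    - ∑ m, η m * g x (bracket (e i) (e j) x) (e m x) * conn g e m k l x

/-- The Ricci tensor `R_{jk}`, the trace of `X ↦ R(X, e_j) e_k`. -/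
def ric (g : BilinField M) (η : Fin 4 → ℝ) (e : Fin 4 → VField M) (j k : Fin 4) (x : M) : ℝ :=
  ∑ i, η i * riem g η e i j k i x

/-- `(∇_{e_i} 𝒜)(e_j)` for a 1-form `𝒜`. -/
def nablaForm (g : BilinField M) (η : Fin 4 → ℝ) (e : Fin 4 → VField M) (𝒜 : CForm M)
    (i j : Fin 4) (x : M) : ℂ :=
  dirC (e i) (fun y => 𝒜 y (e j y)) x - ∑ k, (η k * conn g e i j k x : ℝ) * 𝒜 x (e k x)

/-- `(d𝒜)(e_i, e_j)`. -/
def curv (e : Fin 4 → VField M) (𝒜 : CForm M) (x : M) (i j : Fin 4) : ℂ :=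
  dirC (e i) (fun y => 𝒜 y (e j y)) x - dirC (e j) (fun y => 𝒜 y (e i y)) x
    - 𝒜 x (bracket (e i) (e j) x)

/-- The Levi-Civita symbol `ε_{ijkl}`, with `ε_{0123} = 1`. -/
def leviCivita (i j k l : Fin 4) : ℤ :=
  Matrix.det (Matrix.of fun a b : Fin 4 => if (![i, j, k, l] : Fin 4 → Fin 4) a = b then 1 else 0)

/-- The Hodge star on 2-forms in an oriented orthonormal frame: `(*φ)_{ij} = ½ ε_{ijkl} φ_{kl}`. -/
def hodge (φ : Fin 4 → Fin 4 → ℂ) (i j : Fin 4) : ℂ :=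
  (1 / 2) * ∑ k, ∑ l, (leviCivita i j k l : ℂ) * φ k l

/-! ### Spinors

A frame `e` with signs `η_i` gives the complex orthonormal frame `E_i = s_i e_i`, `s_i² = η_i`, and
the complex null tetrad `e_{AA'} = ∑_i σ^i_{AA'} e_i`, which satisfies
`g(e_{AA'}, e_{BB'}) = ε_{AB} ε_{A'B'}`. The local spinor bundles are the ones trivialised by the
associated spin frames, so that a primed spinor field `α_{A'}` is a pair of complex functions.
Indices are raised by `α^{A'} = ε^{A'B'} α_{B'}`. -/

/-- `ε_{AB}` and `ε^{AB}` (and their primed versions), with `ε_{01} = ε^{01} = 1`. -/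
def eps : Matrix (Fin 2) (Fin 2) ℂ := !![0, 1; -1, 0]

/-- `(1, i τ₁, i τ₂, i τ₃)` for the Pauli matrices `τ`. -/
def quat : Fin 4 → Matrix (Fin 2) (Fin 2) ℂ :=
  ![!![1, 0; 0, 1], !![0, Complex.I; Complex.I, 0], !![0, 1; -1, 0], !![Complex.I, 0; 0, -Complex.I]]

/-- The soldering symbols `σ^i_{AA'}`. -/
def solder (η : Fin 4 → ℝ) (i : Fin 4) (A A' : Fin 2) : ℂ :=
  (if η i = 1 then 1 else Complex.I) * ((Real.sqrt 2 : ℝ) : ℂ)⁻¹ * quat i A A'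

/-- The spinor components `T_{AA'BB'}` of a tensor with frame components `T_{ij}`. -/
def toSpinor₂ (η : Fin 4 → ℝ) (T : Fin 4 → Fin 4 → ℂ) (A A' B B' : Fin 2) : ℂ :=
  ∑ i, ∑ j, solder η i A A' * solder η j B B' * T i j

/-- The primed part `½ ε^{AB} T_{AA'BB'}` of a tensor; if `T` is a 2-form, then
`T_{ab} = χ_{A'B'} ε_{AB} + φ_{AB} ε_{A'B'}` with `χ` given by this expression. -/
def primedPart (η : Fin 4 → ℝ) (T : Fin 4 → Fin 4 → ℂ) (A' B' : Fin 2) : ℂ :=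
  (1 / 2) * ∑ A, ∑ B, eps A B * toSpinor₂ η T A A' B B'

/-- Primed spinor fields `α_{A'}`, by components in the spin frame. -/
abbrev SpinorField (M : Type*) : Type _ := Fin 2 → M → ℂ

/-- `α^{A'} = ε^{A'B'} α_{B'}`. -/
def raise (α : SpinorField M) (A' : Fin 2) (x : M) : ℂ := ∑ B', eps A' B' * α B' x

/-- The Euclidean conjugate `α†`; it satisfies `α_{A'} α†^{A'} = |α_{0'}|² + |α_{1'}|²`. -/
def dagger (α : SpinorField M) : SpinorField M :=
  ![fun x => -(starRingEnd ℂ) (α 1 x), fun x => (starRingEnd ℂ) (α 0 x)]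

/-- The primed spin connection: `∇_{e_i} α_{A'}`, for the connection on primed spinors that
the Levi-Civita connection induces. -/
def nablaSpinor (g : BilinField M) (η : Fin 4 → ℝ) (e : Fin 4 → VField M) (α : SpinorField M)
    (i : Fin 4) (A' : Fin 2) (x : M) : ℂ :=
  dirC (e i) (α A') x
    - ∑ B', ∑ C', eps B' C' * primedPart η (fun j k => (conn g e i j k x : ℂ)) A' C' * α B' x

/-- `∇_{AA'} α_{B'}`. -/
def nablaS (g : BilinField M) (η : Fin 4 → ℝ) (e : Fin 4 → VField M) (α : SpinorField M)
    (A A' B' : Fin 2) (x : M) : ℂ :=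
  ∑ i, solder η i A A' * nablaSpinor g η e α i B' x

/-- `𝒜_{AA'}`. -/
def formS (η : Fin 4 → ℝ) (e : Fin 4 → VField M) (𝒜 : CForm M) (A A' : Fin 2) (x : M) : ℂ :=
  ∑ i, solder η i A A' * 𝒜 x (e i x)

/-- The curvature spinor `X̃_{A'B'C'D'} = ¼ ε^{AB} ε^{CD} R_{AA'BB'CC'DD'}`. -/
def curvSpinor (g : BilinField M) (η : Fin 4 → ℝ) (e : Fin 4 → VField M) (x : M)
    (I : Fin 4 → Fin 2) : ℂ :=
  primedPart η (fun i j => primedPart η (fun k l => (riem g η e i j k l x : ℂ)) (I 2) (I 3))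
    (I 0) (I 1)

/-- The self-dual Weyl spinor `Ψ̃_{A'B'C'D'} = X̃_{(A'B'C'D')}`. -/
def weylSD (g : BilinField M) (η : Fin 4 → ℝ) (e : Fin 4 → VField M)
    (A' B' C' D' : Fin 2) (x : M) : ℂ :=
  (1 / 24) * ∑ p : Equiv.Perm (Fin 4), curvSpinor g η e x (![A', B', C', D'] ∘ p)

/-! ### Hyper-Kähler and conformally Kähler structures -/

/-- `(M, g)` is hyper-Kähler, oriented so that its Riemann tensor is anti-self-dual:
`R_{ab} = 0` and `Ψ̃_{A'B'C'D'} = 0`. -/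
def IsHyperkahler [IsManifold (𝓡 4) ∞ M] (g : BilinField M) (o : Orient M) : Prop :=
  ∀ (U : Set M) (e : Fin 4 → VField M), IsOpen U → IsOrientedFrame g o U e → ∀ x ∈ U,
    (∀ j k, ric g euclid e j k x = 0) ∧ ∀ A' B' C' D', weylSD g euclid e A' B' C' D' x = 0

/-- The fundamental form `κ(v, w) = h(J v, w)`, i.e. `κ_{ab} = h_{bc} J^c_a`. -/
def fundamental (h : BilinField M) (J : EndField M) (x : M) (v w : TangentSpace (𝓡 4) x) : ℝ :=
  h x (J x v) w

/-- `(h, J)` is a Kähler structure on `M`: `J` is an integrable almost complex structure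
(vanishing Nijenhuis tensor), compatible with `h`, and the fundamental form is closed. -/
structure IsKahler [IsManifold (𝓡 4) ∞ M] (h : BilinField M) (J : EndField M) : Prop where
  smooth : ContMDiff (𝓡 4) ((𝓡 4).prod 𝓘(ℝ, E4 →L[ℝ] E4)) ∞
    (fun x => TotalSpace.mk' (E4 →L[ℝ] E4)
      (E := fun x : M => TangentSpace (𝓡 4) x →L[ℝ] TangentSpace (𝓡 4) x) x (J x))
  sq : ∀ x v, J x (J x v) = -v
  compatible : ∀ x v w, h x (J x v) (J x w) = h x v w
  integrable : ∀ (x : M) (X Y : VField M), SmoothFieldAt X x → SmoothFieldAt Y x →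
    bracket (fun y => J y (X y)) (fun y => J y (Y y)) x - J x (bracket (fun y => J y (X y)) Y x)
      - J x (bracket X (fun y => J y (Y y)) x) - bracket X Y x = 0
  closed : ∀ (x : M) (X Y Z : VField M), SmoothFieldAt X x → SmoothFieldAt Y x →
    SmoothFieldAt Z x →
    dirR X (fun y => fundamental h J y (Y y) (Z y)) x
      - dirR Y (fun y => fundamental h J y (X y) (Z y)) x
      + dirR Z (fun y => fundamental h J y (X y) (Y y)) x
      - fundamental h J x (bracket X Y x) (Z x) + fundamental h J x (bracket X Z x) (Y x)
      - fundamental h J x (bracket Y Z x) (X x) = 0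

/-- `(M, g)` is conformally Kähler through `J` and `Ω`: the metric `Ω² g` is Kähler with `J`. -/
structure IsConformallyKahler [IsManifold (𝓡 4) ∞ M] (g : BilinField M) (J : EndField M)
    (Ω : M → ℝ) : Prop where
  smooth : ContMDiff (𝓡 4) 𝓘(ℝ, ℝ) ∞ Ω
  ne_zero : ∀ x, Ω x ≠ 0
  kahler : IsKahler (fun x => (Ω x ^ 2) • g x) J

/-- The components `κ(e_i, e_j)` of the fundamental form of `(g, J)`. -/
def kappa (g : BilinField M) (J : EndField M) (e : Fin 4 → VField M) (x : M) (i j : Fin 4) : ℂ :=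
  (fundamental g J x (e i x) (e j x) : ℝ)

/-- `J` has the self-dual orientation: `*κ = κ` for its fundamental form. -/
def IsSelfDual [IsManifold (𝓡 4) ∞ M] (g : BilinField M) (o : Orient M) (J : EndField M) : Prop :=
  ∀ (U : Set M) (e : Fin 4 → VField M), IsOpen U → IsOrientedFrame g o U e → ∀ x ∈ U,
    hodge (kappa g J e x) = kappa g J e x

/-- The Killing spinor of the conformal Kähler structure `(J, Ω)` with self-dual `κ`: the
symmetric spinor `K_{A'B'}` with `κ_{ab} = Ω K_{A'B'} ε_{AB}`
(equivalently `Ω² κ_{ab} = Ω³ K_{A'B'} ε_{AB}`). -/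
def killingSpinor (g : BilinField M) (J : EndField M) (Ω : M → ℝ) (e : Fin 4 → VField M)
    (A' B' : Fin 2) (x : M) : ℂ :=
  ((Ω x)⁻¹ : ℝ) * primedPart euclid (kappa g J e x) A' B'

/-! ### Charged twistors -/

/-- The components of `α` are smooth on `U`. -/
def SmoothSpinorOn (α : SpinorField M) (U : Set M) : Prop :=
  ∀ A', ContMDiffOn (𝓡 4) 𝓘(ℝ, ℂ) ∞ (α A') U

/-- The shear-free equation `α^{A'} α^{B'} ∇_{AA'} α_{B'} = 0` on `U`. -/
def IsShearFree (g : BilinField M) (η : Fin 4 → ℝ) (U : Set M) (e : Fin 4 → VField M)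
    (α : SpinorField M) : Prop :=
  ∀ x ∈ U, ∀ A, ∑ A', ∑ B', raise α A' x * raise α B' x * nablaS g η e α A A' B' x = 0

/-- The charged twistor equation `∇_{A(A'} α_{B')} = 𝒜_{A(A'} α_{B')}` on `U`. -/
def IsChargedTwistor (g : BilinField M) (η : Fin 4 → ℝ) (U : Set M) (e : Fin 4 → VField M)
    (α : SpinorField M) (𝒜 : CForm M) : Prop :=
  ∀ x ∈ U, ∀ A A' B', (1 / 2) * (nablaS g η e α A A' B' x + nablaS g η e α A B' A' x)
    = (1 / 2) * (formS η e 𝒜 A A' x * α B' x + formS η e 𝒜 A B' x * α A' x)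

/-- The 1-form `𝒜` is smooth on `U`, satisfies the charged twistor equation of `α` there, and is
the only 1-form on `U` that does: it is the connection defined by the charged twistor equation. -/
def IsTwistorConnection (g : BilinField M) (η : Fin 4 → ℝ) (U : Set M) (e : Fin 4 → VField M)
    (α : SpinorField M) (𝒜 : CForm M) : Prop :=
  (∀ i, ContMDiffOn (𝓡 4) 𝓘(ℝ, ℂ) ∞ (fun x => 𝒜 x (e i x)) U) ∧
  IsChargedTwistor g η U e α 𝒜 ∧
  ∀ ℬ : CForm M, IsChargedTwistor g η U e α ℬ → ∀ x ∈ U, ℬ x = 𝒜 x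

/-- The anti-self-duality equation `∇_{A(A'} 𝒜^A_{B')} = 0` on `U`. -/
def IsASD (g : BilinField M) (η : Fin 4 → ℝ) (U : Set M) (e : Fin 4 → VField M)
    (𝒜 : CForm M) : Prop :=
  ∀ x ∈ U, ∀ A' B', (1 / 2) * ∑ A, ∑ B, eps A B *
    (toSpinor₂ η (fun i j => nablaForm g η e 𝒜 i j x) A A' B B'
      + toSpinor₂ η (fun i j => nablaForm g η e 𝒜 i j x) A B' B A') = 0

end Manifold

end SpinGeometry

end

open SpinGeometry

/-! Existence and uniqueness of `𝒜` are linear algebra at each point. Symmetric spinors in two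
dimensions are binary forms, and the symmetrised product is the product of polynomials. So a
symmetric `s_{A'B'}` has the form `c_{(A'} α_{B')}` exactly when `α^{A'} α^{B'} s_{A'B'} = 0`, and
then `c` is unique. For `s = ∇_{A(A'} α_{B')}` this condition is shear-freeness. An explicit formula
for `c`, with `|α|²` as its only denominator, shows that `𝒜` is smooth (`charge_spec`,
`exists_twistorConnection`).

For the curvature, let `P = (∇ - 𝒜) α`. The charged twistor equation says `P_{AA'B'} = ε_{A'B'} π_A`
for some `π`. The commutator of charged derivatives produces the curvature (`ricci_identity`). In
the self-dual part of that identity, symmetrised over its three primed indices, the derivative side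
dies because `ε` is parallel and skew (`charged_twistor_curvature`). What remains relates
`Ψ̃_{A'B'C'D'} α^{D'}` to `F_{(A'B'} α_{C')}`, where `F` is the primed part of `d𝒜`; the scalar
curvature is removed by the symmetrisation. If `Ψ̃` annihilates `α`, then `F_{(A'B'} α_{C')} = 0`,
and again `F = 0` because polynomials have no zero divisors (`curvature_eq_zero_of_weyl`). In
Riemannian signature `Ψ̃` is real for the quaternionic conjugation, so it also annihilates `α†`; as
`α` and `α†` form a basis, `Ψ̃ = 0` (`weylSD_eq_zero`).

In the conformally Kähler case, integrability of `J` and closedness of `Ω² κ` express `∇κ` through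
`κ` and `d log Ω` (`nabla_of_conformallyKahler`). Hence `K = Ω⁻¹ κ` satisfies `∇_{A(A'} K_{B'C')} =
0`. Contracting with `α` three times leaves the shear of `α` times `α^{A'} β_{A'}`, which is nonzero
because `κ` is nondegenerate. So `α` is shear-free and the general case applies. The same equation
gives `β` the charge `-𝒜`. For `β = i α†`, conjugation gives `β` the charge `conj 𝒜`, so `𝒜` is
imaginary.

The curvature identities are polynomial. They are checked over a commutative ring with four
derivations, in a complex rescaling of the frame whose null tetrad has integer coefficients, and
then applied to the ring of functions smooth on `U`. -/

noncomputable section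

namespace SpinGeometry

/-! ### Curvature identities over a commutative ring with derivations. -/

section FrameAlgebra

variable {R : Type*} [CommRing R]

/-- The signs `(1, -1, 1, -1)` of a neutral frame, normalised so that the null tetrad of the frame
has integer coefficients. -/
def theta (i : Fin 4) : R := ![2, -2, 2, -2] i

/-- The soldering symbols of a neutral frame. -/
def rho (i : Fin 4) : Matrix (Fin 2) (Fin 2) R :=
  ![!![1, 0; 0, 1], !![0, 1; 1, 0], !![0, 1; -1, 0], !![1, 0; 0, -1]] i

/-- The primed (self-dual) part of a 2-form in a neutral frame. -/
def sdPart (T : Fin 4 → Fin 4 → R) : Matrix (Fin 2) (Fin 2) R :=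
  !![T 0 1 - T 0 2 - T 1 3 + T 2 3, -T 0 3 - T 1 2; -T 0 3 - T 1 2,
    -T 0 1 - T 0 2 - T 1 3 - T 2 3]

/-- The curvature of a connection `γ` in a neutral frame `D`. -/
def frameRiem (D : Fin 4 → Derivation ℤ R R) (γ : Fin 4 → Fin 4 → Fin 4 → R)
    (i j k l : Fin 4) : R :=
  D i (γ j k l) - D j (γ i k l)
    + ∑ m, theta m * (γ j k m * γ i m l - γ i k m * γ j m l)
    - ∑ m, theta m * (γ i j m - γ j i m) * γ m k l

/-- The exterior derivative of a 1-form `a` in a neutral frame `D` with torsion-free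
connection `γ`. -/
def frameCurv (D : Fin 4 → Derivation ℤ R R) (γ : Fin 4 → Fin 4 → Fin 4 → R) (a : Fin 4 → R)
    (i j : Fin 4) : R :=
  D i (a j) - D j (a i) - ∑ m, theta m * (γ i j m - γ j i m) * a m

/-- The covariant derivative `∇_i α_{A'}` of a spinor in a neutral frame. -/
def frameNabla (D : Fin 4 → Derivation ℤ R R) (γ : Fin 4 → Fin 4 → Fin 4 → R) (α : Fin 2 → R)
    (i : Fin 4) : Fin 2 → R :=
  ![D i (α 0) - sdPart (γ i) 0 1 * α 0 + sdPart (γ i) 0 0 * α 1,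
    D i (α 1) - sdPart (γ i) 1 1 * α 0 + sdPart (γ i) 0 1 * α 1]

variable {D : Fin 4 → Derivation ℤ R R} {γ : Fin 4 → Fin 4 → Fin 4 → R}

/-- Projection of the orthogonal Lie algebra onto its self-dual summand is a Lie algebra
homomorphism. So the self-dual part of the curvature is the curvature of the spin connection, with
its matrix commutator in place of the `γγ` terms. -/
lemma sdPart_frameRiem (hγ : ∀ i j k, γ i k j = -γ i j k) (hγ' : ∀ i j, γ i j j = 0)
    (i j : Fin 4) (A B : Fin 2) :
    sdPart (frameRiem D γ i j) A B =
      D i (sdPart (γ j) A B) - D j (sdPart (γ i) A B)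
      - (∑ C, ∑ E, (!![0, 1; -1, 0] : Matrix (Fin 2) (Fin 2) R) C E *
          (sdPart (γ i) A E * sdPart (γ j) C B - sdPart (γ j) A E * sdPart (γ i) C B))
      - ∑ m, theta m * (γ i j m - γ j i m) * sdPart (γ m) A B := by
  have h10 : ∀ i, γ i 1 0 = -γ i 0 1 := fun i => hγ _ _ _
  have h20 : ∀ i, γ i 2 0 = -γ i 0 2 := fun i => hγ _ _ _
  have h21 : ∀ i, γ i 2 1 = -γ i 1 2 := fun i => hγ _ _ _
  have h31 : ∀ i, γ i 3 1 = -γ i 1 3 := fun i => hγ _ _ _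
  have h32 : ∀ i, γ i 3 2 = -γ i 2 3 := fun i => hγ _ _ _
  fin_cases A <;> fin_cases B <;>
  simp [sdPart, frameRiem, Fin.sum_univ_four, theta, h10, h20, h21, h31, h32, hγ'] <;> ring


/-- The Ricci identity for the charged derivative `P = (∇ - a) α` of a spinor. -/
lemma ricci_identity (hγ : ∀ i j k, γ i k j = -γ i j k) (hγ' : ∀ i j, γ i j j = 0)
    (hD : ∀ i j f, D i (D j f) - D j (D i f) = ∑ m, theta m * (γ i j m - γ j i m) * D m f)
    {α : Fin 2 → R} {a : Fin 4 → R} {P : Fin 4 → Fin 2 → R}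
    (hP : ∀ i A, P i A = frameNabla D γ α i A - a i * α A) (i j : Fin 4) (A : Fin 2) :
    frameNabla D γ (P j) i A - frameNabla D γ (P i) j A - a i * P j A + a j * P i A
      - ∑ m, theta m * (γ i j m - γ j i m) * P m A =
    -(sdPart (frameRiem D γ i j) A 1 * α 0 - sdPart (frameRiem D γ i j) A 0 * α 1
      + frameCurv D γ a i j * α A) := by
  -- Second derivatives of `α` enter only through this commutator; everything else cancels as a
  -- polynomial in first derivatives.
  have h := hD i j (α A)
  simp only [sdPart_frameRiem hγ hγ']
  have hs : ∀ i, sdPart (γ i) 1 0 = sdPart (γ i) 0 1 := fun i => by simp [sdPart]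
  -- The spin connection is kept opaque: only its symmetry matters here, not its expression in `γ`.
  generalize hg : (fun i => sdPart (γ i)) = g at *
  have hg' : ∀ i, sdPart (γ i) = g i := fun i => by rw [← hg]
  simp only [hg', frameNabla] at *
  fin_cases A <;>
  simp [frameCurv, hP, hs, Fin.sum_univ_four, theta] at h ⊢ <;>
  linear_combination h

set_option maxHeartbeats 4000000 in
/-- A charged spinor derivative `P` whose symmetric part vanishes contributes nothing to the
symmetrised primed part of its curvature. -/
lemma charged_twistor_curvature (hγ : ∀ i j k, γ i k j = -γ i j k) (hγ' : ∀ i j, γ i j j = 0)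
    (hD : ∀ i j f, D i (D j f) - D j (D i f) = ∑ m, theta m * (γ i j m - γ j i m) * D m f)
    {α : Fin 2 → R} {a : Fin 4 → R} {P : Fin 4 → Fin 2 → R}
    (hP : ∀ i A, P i A = frameNabla D γ α i A - a i * α A)
    (h1 : P 1 0 = -P 0 1) (h2 : P 1 1 = -P 0 0) (h3 : P 2 0 = -P 0 1) (h4 : P 2 1 = P 0 0)
    (h5 : P 3 0 = -P 0 0) (h6 : P 3 1 = P 0 1) (A B C : Fin 2) :
    let Y (A B C E : Fin 2) : R := sdPart (fun i j => sdPart (frameRiem D γ i j) C E) A B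
    let Z (A B C : Fin 2) : R := Y A B C 1 * α 0 - Y A B C 0 * α 1
      + sdPart (frameCurv D γ a) A B * α C
    Z A B C + Z B C A + Z C A B = 0 := by
  have h10 : ∀ i, γ i 1 0 = -γ i 0 1 := fun i => hγ _ _ _
  have h20 : ∀ i, γ i 2 0 = -γ i 0 2 := fun i => hγ _ _ _
  have h30 : ∀ i, γ i 3 0 = -γ i 0 3 := fun i => hγ _ _ _
  have h21 : ∀ i, γ i 2 1 = -γ i 1 2 := fun i => hγ _ _ _
  have h31 : ∀ i, γ i 3 1 = -γ i 1 3 := fun i => hγ _ _ _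
  have h32 : ∀ i, γ i 3 2 = -γ i 2 3 := fun i => hγ _ _ _
  have key : ∀ A B C, sdPart (fun i j => frameNabla D γ (P j) i C - frameNabla D γ (P i) j C
      - a i * P j C + a j * P i C - ∑ m, theta m * (γ i j m - γ j i m) * P m C) A B =
      -(sdPart (fun i j => sdPart (frameRiem D γ i j) C 1) A B * α 0 -
        sdPart (fun i j => sdPart (frameRiem D γ i j) C 0) A B * α 1 +
        sdPart (frameCurv D γ a) A B * α C) := by
    intro A B C
    simp only [ricci_identity hγ hγ' hD hP]
    fin_cases A <;> fin_cases B <;> simp [sdPart] <;> ring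
  simp only []
  have k1 := key A B C
  have k2 := key B C A
  have k3 := key C A B
  -- The relations `h1` to `h6` say that `P_{AA'B'}` is `ε_{A'B'}` times an unprimed spinor with
  -- components `P 0 0`, `P 0 1` up to sign and order. As `ε` is parallel, the self-dual part of the
  -- charged exterior derivative of `P` is a sum of terms containing a primed `ε`, and the cyclic
  -- sum kills it.
  suffices h : sdPart (fun i j => frameNabla D γ (P j) i C - frameNabla D γ (P i) j C
      - a i * P j C + a j * P i C - ∑ m, theta m * (γ i j m - γ j i m) * P m C) A B +
      sdPart (fun i j => frameNabla D γ (P j) i A - frameNabla D γ (P i) j A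
      - a i * P j A + a j * P i A - ∑ m, theta m * (γ i j m - γ j i m) * P m A) B C +
      sdPart (fun i j => frameNabla D γ (P j) i B - frameNabla D γ (P i) j B
      - a i * P j B + a j * P i B - ∑ m, theta m * (γ i j m - γ j i m) * P m B) C A = 0 by
    linear_combination -h + k1 + k2 + k3
  clear key k1 k2 k3 hP hD
  fin_cases A <;> fin_cases B <;> fin_cases C <;>
  simp [frameNabla, sdPart, Fin.sum_univ_four, theta, h1, h2, h3, h4, h5, h6, h10, h20, h30, h21,
    h31, h32, hγ'] <;> ring

/-- The first Bianchi identity. -/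
lemma frameRiem_bianchi
    (hJ : ∀ i j k l, D i (γ j k l - γ k j l) + D j (γ k i l - γ i k l) + D k (γ i j l - γ j i l)
      + ∑ m, theta m * ((γ j k m - γ k j m) * (γ i m l - γ m i l)
        + (γ k i m - γ i k m) * (γ j m l - γ m j l)
        + (γ i j m - γ j i m) * (γ k m l - γ m k l)) = 0) (i j k l : Fin 4) :
    frameRiem D γ i j k l + frameRiem D γ j k i l + frameRiem D γ k i j l = 0 := by
  have h := hJ i j k l
  simp only [frameRiem, Fin.sum_univ_four, map_sub] at h ⊢
  linear_combination h

/-- The pair symmetry of the Riemann tensor. -/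
lemma frameRiem_pair (hγ : ∀ i j k, γ i k j = -γ i j k)
    (hJ : ∀ i j k l, D i (γ j k l - γ k j l) + D j (γ k i l - γ i k l) + D k (γ i j l - γ j i l)
      + ∑ m, theta m * ((γ j k m - γ k j m) * (γ i m l - γ m i l)
        + (γ k i m - γ i k m) * (γ j m l - γ m j l)
        + (γ i j m - γ j i m) * (γ k m l - γ m k l)) = 0) (i j k l : Fin 4) :
    2 * frameRiem D γ i j k l = 2 * frameRiem D γ k l i j := by
  have a1 : ∀ i j k l, frameRiem D γ j i k l = -frameRiem D γ i j k l := fun i j k l => by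
    simp only [frameRiem, Fin.sum_univ_four]; ring
  have a2 : ∀ i j k l, frameRiem D γ i j l k = -frameRiem D γ i j k l := fun i j k l => by
    simp only [frameRiem, Fin.sum_univ_four, hγ _ k l, map_neg]
    simp only [hγ _ k]
    simp only [hγ _ _ l]
    ring
  have b := frameRiem_bianchi hJ
  -- The octahedron argument: a signed sum of the four Bianchi identities on `i, j, k, l` leaves the
  -- two sides. The factor 2 stays, since 2 need not be a unit of `R`.
  have b1 := b i j k l
  have b2 := b j k l i
  have b3 := b k l i j
  have b4 := b l i j k
  rw [a2 j k i l, a2 k l i j, a1 j l k i] at b2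
  rw [a1 i l k j, a2 i l j k, a1 k i l j, a2 k i j l] at b3
  rw [a1 i l j k, a2 i j k l, a2 j l k i] at b4
  linear_combination b1 - b4 - b3 + b2

/-- The pair symmetry of the self-dual part of the Riemann tensor. -/
lemma sdPart_frameRiem_pair (hγ : ∀ i j k, γ i k j = -γ i j k)
    (hJ : ∀ i j k l, D i (γ j k l - γ k j l) + D j (γ k i l - γ i k l) + D k (γ i j l - γ j i l)
      + ∑ m, theta m * ((γ j k m - γ k j m) * (γ i m l - γ m i l)
        + (γ k i m - γ i k m) * (γ j m l - γ m j l)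
        + (γ i j m - γ j i m) * (γ k m l - γ m k l)) = 0) (A B C E : Fin 2) :
    2 * sdPart (fun i j => sdPart (frameRiem D γ i j) C E) A B =
      2 * sdPart (fun i j => sdPart (frameRiem D γ i j) A B) C E := by
  have h := frameRiem_pair hγ hJ
  generalize frameRiem D γ = r at h
  have e : ∀ (T : Fin 4 → Fin 4 → R) A B, 2 * sdPart T A B = sdPart (fun i j => 2 * T i j) A B := by
    intro T A B
    fin_cases A <;> fin_cases B <;> simp [sdPart] <;> ring
  simp only [e]
  rw [show (fun i j => sdPart (fun k l => 2 * r i j k l) C E) =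
    fun i j => sdPart (fun k l => 2 * r k l i j) C E by simp only [h]]
  fin_cases A <;> fin_cases B <;> fin_cases C <;> fin_cases E <;> simp [sdPart] <;> ring

end FrameAlgebra

/-! ### Symmetrised spinors and the Weyl spinor. -/

/-- Lists the 24 permutations explicitly, so that the symmetrisation in `weylSD` can be handled by
linear algebra. -/
lemma sum_perm_four {A : Type*} (f : (Fin 4 → A) → ℂ) (a b c d : A) :
    ∑ p : Equiv.Perm (Fin 4), f (![a, b, c, d] ∘ p) =
    ((f ![a, b, c, d] + f ![a, b, d, c]) + (f ![a, c, b, d] + f ![a, c, d, b]) + (f ![a, d, c,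
      b] + f ![a, d, b, c])) + ((f ![b, a, c, d] + f ![b, a, d, c]) + (f ![b, c, a, d] + f ![b,
      c, d, a]) + (f ![b, d, c, a] + f ![b, d, a, c])) + ((f ![c, b, a, d] + f ![c, b, d, a]) +
      (f ![c, a, b, d] + f ![c, a, d, b]) + (f ![c, d, a, b] + f ![c, d, b, a])) + ((f ![d, b,
      c, a] + f ![d, b, a, c]) + (f ![d, c, b, a] + f ![d, c, a, b]) + (f ![d, a, c, b] + f ![d,
      a, b, c])) := by
  have h : ∀ p : Equiv.Perm (Fin 4), ![a, b, c, d] ∘ p = ![![a, b, c, d] (p 0), ![a, b, c, d] (p 1),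
      ![a, b, c, d] (p 2), ![a, b, c, d] (p 3)] := by
    intro p; ext i; fin_cases i <;> rfl
  simp only [h]
  have h1 : ∀ {n} (F : Equiv.Perm (Fin n.succ) → ℂ),
      ∑ p, F p = ∑ i, ∑ q : Equiv.Perm (Fin n), F (Equiv.Perm.decomposeFin.symm (i, q)) := by
    intro n F
    rw [← Fintype.sum_prod_type']
    exact (Fintype.sum_equiv Equiv.Perm.decomposeFin.symm _ _ (fun _ => rfl)).symm
  simp only [h1, Fin.sum_univ_four, Fin.sum_univ_three, Fin.sum_univ_two, Finset.univ_unique,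
    Finset.sum_singleton]
  rfl

/-- The totally symmetric part of a tensor with the symmetries of the curvature spinor. -/
lemma symmetrise_curvature {Y : (Fin 4 → Fin 2) → ℂ}
    (h1 : ∀ A B C E, Y ![A, B, C, E] = Y ![B, A, C, E])
    (h2 : ∀ A B C E, Y ![A, B, C, E] = Y ![A, B, E, C])
    (h3 : ∀ A B C E, Y ![A, B, C, E] = Y ![C, E, A, B]) (A B C E : Fin 2) :
    (1 / 24) * ∑ p : Equiv.Perm (Fin 4), Y (![A, B, C, E] ∘ p) =
      (1 / 3) * (Y ![A, B, C, E] + Y ![B, C, A, E] + Y ![C, A, B, E]) := by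
  -- The symmetries of `Y` generate a group of order 8. The 24 permutations thus form three classes,
  -- one for each splitting of the four indices into two pairs.
  have e1 : ∀ a b c d, Y ![a, b, c, d] + Y ![a, b, d, c] + Y ![b, a, c, d] + Y ![b, a, d, c]
      + Y ![c, d, a, b] + Y ![c, d, b, a] + Y ![d, c, a, b] + Y ![d, c, b, a]
      = 8 * Y ![a, b, c, d] := by
    intro a b c d
    rw [h3 c d a b, h3 c d b a, h3 d c a b, h3 d c b a, h2 b a d c, h1 b a c d, h2 a b d c]
    ring
  rw [sum_perm_four]
  linear_combination (1 / 24) * (e1 A B C E + e1 B C A E + e1 C A B E)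

/-- A quadratic form times a nonzero linear form in two variables vanishes only if the quadratic
form does. -/
lemma eq_zero_of_symmetric_mul {F : Matrix (Fin 2) (Fin 2) ℂ} {α : Fin 2 → ℂ}
    (hF : F 1 0 = F 0 1) (hα : ∃ A, α A ≠ 0)
    (h : ∀ A B C, F A B * α C + F B C * α A + F C A * α B = 0) (A B : Fin 2) : F A B = 0 := by
  have a1 := h 0 0 0
  have a2 := h 0 0 1
  have a3 := h 0 1 1
  have a4 := h 1 1 1
  rw [hF] at a2 a3
  suffices F 0 0 = 0 ∧ F 0 1 = 0 ∧ F 1 1 = 0 by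
    obtain ⟨b1, b2, b3⟩ := this
    fin_cases A <;> fin_cases B <;> simp [b1, b2, b3, hF]
  by_cases h0 : α 0 = 0
  · have h1 : α 1 ≠ 0 := by
      obtain ⟨A, hA⟩ := hα
      fin_cases A
      · exact absurd h0 hA
      · exact hA
    simp only [h0, mul_zero, add_zero] at a2 a3 a4
    have c1 : F 0 0 = 0 := by simpa [h1] using a2
    have c2 : F 0 1 = 0 := by
      have : 2 * F 0 1 * α 1 = 0 := by linear_combination a3
      simpa [h1] using this
    have c3 : F 1 1 = 0 := by
      have : 3 * F 1 1 * α 1 = 0 := by linear_combination a4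
      simpa [h1] using this
    exact ⟨c1, c2, c3⟩
  · have c1 : F 0 0 = 0 := by
      have : 3 * F 0 0 * α 0 = 0 := by linear_combination a1
      simpa [h0] using this
    have c2 : F 0 1 = 0 := by
      have : 2 * F 0 1 * α 0 = 0 := by linear_combination a2 - α 1 * c1
      simpa [h0] using this
    have c3 : F 1 1 = 0 := by
      have : F 1 1 * α 0 = 0 := by linear_combination a3 - 2 * α 1 * c2
      simpa [h0] using this
    exact ⟨c1, c2, c3⟩

/-- If the Weyl spinor annihilates the charged twistor `α`, its charge has anti-self-dual
curvature. -/
lemma curvature_eq_zero_of_weyl {Y : (Fin 4 → Fin 2) → ℂ} {F : Matrix (Fin 2) (Fin 2) ℂ}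
    {α : Fin 2 → ℂ}
    (h1 : ∀ A B C E, Y ![A, B, C, E] = Y ![B, A, C, E])
    (h2 : ∀ A B C E, Y ![A, B, C, E] = Y ![A, B, E, C])
    (h3 : ∀ A B C E, Y ![A, B, C, E] = Y ![C, E, A, B])
    (hF : F 1 0 = F 0 1) (hα : ∃ A, α A ≠ 0)
    (hZ : ∀ A B C, (Y ![A, B, C, 1] * α 0 - Y ![A, B, C, 0] * α 1 + F A B * α C)
      + (Y ![B, C, A, 1] * α 0 - Y ![B, C, A, 0] * α 1 + F B C * α A)
      + (Y ![C, A, B, 1] * α 0 - Y ![C, A, B, 0] * α 1 + F C A * α B) = 0)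
    (hW : ∀ A B C, ((1 / 24) * ∑ p : Equiv.Perm (Fin 4), Y (![A, B, C, 0] ∘ p)) * α 1
      - ((1 / 24) * ∑ p : Equiv.Perm (Fin 4), Y (![A, B, C, 1] ∘ p)) * α 0 = 0) (A B : Fin 2) :
    F A B = 0 := by
  refine eq_zero_of_symmetric_mul hF hα (fun A B C => ?_) A B
  have w := hW A B C
  rw [symmetrise_curvature h1 h2 h3, symmetrise_curvature h1 h2 h3] at w
  -- The cyclic sum of `Y` over its first three indices is three times the Weyl spinor, so its
  -- contraction with `α` drops out of `hZ`.
  linear_combination hZ A B C + 3 * w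

/-! ### Calculus of vector fields and functions on the manifold. -/

section Fields

variable {M : Type*} [TopologicalSpace M] [ChartedSpace E4 M] [IsManifold (𝓡 4) ∞ M]
  {U : Set M} {X Y Z : VField M} {f h : M → ℝ} {x : M}

lemma SmoothFieldOn.at (hX : SmoothFieldOn X U) (hU : IsOpen U) (hx : x ∈ U) :
    SmoothFieldAt X x :=
  ContMDiffOn.contMDiffAt hX (hU.mem_nhds hx)

lemma SmoothFieldAt.mdifferentiableAt (hX : SmoothFieldAt X x) :
    MDifferentiableAt (𝓡 4) (𝓡 4).tangent (fun y => (⟨y, X y⟩ : TangentBundle (𝓡 4) M)) x :=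
  ContMDiffAt.mdifferentiableAt hX (by simp)

lemma SmoothFieldOn.add (hX : SmoothFieldOn X U) (hY : SmoothFieldOn Y U) :
    SmoothFieldOn (X + Y) U :=
  ContMDiffOn.add_section hX hY

lemma SmoothFieldOn.smul (hf : ContMDiffOn (𝓡 4) 𝓘(ℝ, ℝ) ∞ f U) (hX : SmoothFieldOn X U) :
    SmoothFieldOn (f • X) U :=
  ContMDiffOn.smul_section hf hX

lemma SmoothFieldOn.bracket (hU : IsOpen U) (hX : SmoothFieldOn X U) (hY : SmoothFieldOn Y U) :
    SmoothFieldOn (bracket X Y) U := by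
  have : IsManifold (𝓡 4) (((⊤ : ℕ∞) : ℕ∞ω) + 1) M := by simpa using ‹IsManifold (𝓡 4) ∞ M›
  have : IsManifold (𝓡 4) (minSmoothness ℝ 2) M := by
    simpa using IsManifold.of_le (I := 𝓡 4) (M := M) (m := 2) (n := ∞) ENat.LEInfty.out
  intro x hx
  exact (ContMDiffAt.mlieBracket_vectorField (m := ⊤) (n := ⊤) (hX.at hU hx) (hY.at hU hx)
    (by simp)).contMDiffWithinAt

lemma bracket_smul_right (hf : MDifferentiableAt (𝓡 4) 𝓘(ℝ, ℝ) f x) (hY : SmoothFieldAt Y x) :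
    bracket X (f • Y) x = dirR X f x • Y x + f x • bracket X Y x :=
  VectorField.mlieBracket_smul_right hf hY.mdifferentiableAt

omit [IsManifold (𝓡 4) ∞ M] in
lemma bracket_swap (X Y : VField M) (x : M) : bracket X Y x = -bracket Y X x :=
  VectorField.mlieBracket_swap_apply

lemma bracket_add_right (hY : SmoothFieldAt Y x) (hZ : SmoothFieldAt Z x) :
    bracket X (Y + Z) x = bracket X Y x + bracket X Z x :=
  VectorField.mlieBracket_add_right hY.mdifferentiableAt hZ.mdifferentiableAt

lemma bracket_jacobi (hX : SmoothFieldAt X x) (hY : SmoothFieldAt Y x) (hZ : SmoothFieldAt Z x) :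
    bracket X (bracket Y Z) x = bracket (bracket X Y) Z x + bracket Y (bracket X Z) x := by
  have : IsManifold (𝓡 4) (minSmoothness ℝ 3) M := by
    simpa using IsManifold.of_le (I := 𝓡 4) (M := M) (m := 3) (n := ∞) ENat.LEInfty.out
  have h2 : minSmoothness ℝ 2 ≤ ∞ := by simpa using (ENat.LEInfty.out : (2 : ℕ∞ω) ≤ ∞)
  exact VectorField.leibniz_identity_mlieBracket_apply (hX.of_le h2) (hY.of_le h2) (hZ.of_le h2)

lemma smooth_bilin {g : BilinField M} (hg : IsPseudoRiemannian g) (hX : SmoothFieldOn X U)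
    (hY : SmoothFieldOn Y U) : ContMDiffOn (𝓡 4) 𝓘(ℝ, ℝ) ∞ (fun x => g x (X x) (Y x)) U := by
  intro x hx
  have := ContMDiffWithinAt.clm_bundle_apply₂ (F₃ := ℝ) (E₃ := Bundle.Trivial M ℝ)
    (b := fun x : M => x) (ψ := g) (hg.smooth.contMDiffAt.contMDiffWithinAt) (hX x hx) (hY x hx)
  simp only [contMDiffWithinAt_totalSpace] at this
  exact this.2

omit [IsManifold (𝓡 4) ∞ M] in
lemma dirR_const (X : VField M) (c : ℝ) (x : M) : dirR X (fun _ => c) x = 0 := by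
  change mvfderiv (𝓡 4) (fun _ : M => c) x (X x) = 0
  rw [mvfderiv_const]
  rfl

omit [IsManifold (𝓡 4) ∞ M] in
lemma dirR_congr {f h : M → ℝ} (hU : IsOpen U) (hx : x ∈ U) (hf : ∀ y ∈ U, f y = h y) :
    dirR X f x = dirR X h x := by
  have : f =ᶠ[nhds x] h := Filter.eventuallyEq_of_mem (hU.mem_nhds hx) hf
  simp only [dirR, this.mfderiv_eq]
  rfl

omit [IsManifold (𝓡 4) ∞ M] in
lemma dirC_congr {f h : M → ℂ} (hU : IsOpen U) (hx : x ∈ U) (hf : ∀ y ∈ U, f y = h y) :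
    dirC X f x = dirC X h x := by
  have : f =ᶠ[nhds x] h := Filter.eventuallyEq_of_mem (hU.mem_nhds hx) hf
  simp only [dirC, this.mfderiv_eq]
  rfl

omit [IsManifold (𝓡 4) ∞ M] in
lemma dirC_const (X : VField M) (c : ℂ) (x : M) : dirC X (fun _ => c) x = 0 := by
  change mvfderiv (𝓡 4) (fun _ : M => c) x (X x) = 0
  rw [mvfderiv_const]
  rfl

omit [IsManifold (𝓡 4) ∞ M] in
lemma dirR_mul (hf : MDifferentiableAt (𝓡 4) 𝓘(ℝ, ℝ) f x)
    (hh : MDifferentiableAt (𝓡 4) 𝓘(ℝ, ℝ) h x) :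
    dirR X (fun y => f y * h y) x = f x * dirR X h x + h x * dirR X f x := by
  change mvfderiv (𝓡 4) (f * h) x (X x) = _
  rw [mvfderiv_mul hf hh]
  rfl

omit [IsManifold (𝓡 4) ∞ M] in
lemma dirC_add {f h : M → ℂ} (hf : MDifferentiableAt (𝓡 4) 𝓘(ℝ, ℂ) f x)
    (hh : MDifferentiableAt (𝓡 4) 𝓘(ℝ, ℂ) h x) :
    dirC X (fun y => f y + h y) x = dirC X f x + dirC X h x := by
  change mvfderiv (𝓡 4) (f + h) x (X x) = _
  rw [mvfderiv_add hf hh]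
  rfl

omit [IsManifold (𝓡 4) ∞ M] in
lemma dirC_mul {f h : M → ℂ} (hf : MDifferentiableAt (𝓡 4) 𝓘(ℝ, ℂ) f x)
    (hh : MDifferentiableAt (𝓡 4) 𝓘(ℝ, ℂ) h x) :
    dirC X (fun y => f y * h y) x = f x * dirC X h x + h x * dirC X f x := by
  have h1 : HasMFDerivAt (𝓡 4) 𝓘(ℝ, ℂ) (f * h) x _ := hf.hasMFDerivAt.mul hh.hasMFDerivAt
  change mfderiv (𝓡 4) 𝓘(ℝ, ℂ) (f * h) x (X x) = _
  rw [h1.mfderiv]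
  rfl

omit [IsManifold (𝓡 4) ∞ M] in
lemma dirC_comp_clm {F : Type*} [NormedAddCommGroup F] [NormedSpace ℝ F] (L : F →L[ℝ] ℂ)
    {f : M → F} (hf : MDifferentiableAt (𝓡 4) 𝓘(ℝ, F) f x) :
    dirC X (fun y => L (f y)) x = L (mfderiv (𝓡 4) 𝓘(ℝ, F) f x (X x)) := by
  have h1 := (L.hasMFDerivAt (x := f x)).comp x hf.hasMFDerivAt
  change mfderiv (𝓡 4) 𝓘(ℝ, ℂ) (L ∘ f) x (X x) = _
  rw [h1.mfderiv]
  rfl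

omit [IsManifold (𝓡 4) ∞ M] in
lemma dirC_ofReal (hf : MDifferentiableAt (𝓡 4) 𝓘(ℝ, ℝ) f x) :
    dirC X (fun y => (f y : ℂ)) x = (dirR X f x : ℂ) :=
  dirC_comp_clm Complex.ofRealCLM hf

omit [IsManifold (𝓡 4) ∞ M] in
lemma dirC_conj {f : M → ℂ} (hf : MDifferentiableAt (𝓡 4) 𝓘(ℝ, ℂ) f x) :
    dirC X (fun y => (starRingEnd ℂ) (f y)) x = (starRingEnd ℂ) (dirC X f x) :=
  dirC_comp_clm (Complex.conjCLE : ℂ →L[ℝ] ℂ) hf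

omit [IsManifold (𝓡 4) ∞ M] in
lemma dirC_eq_re_im {f : M → ℂ} (hf : MDifferentiableAt (𝓡 4) 𝓘(ℝ, ℂ) f x) :
    dirC X f x = (dirR X (fun y => (f y).re) x : ℂ)
      + (dirR X (fun y => (f y).im) x : ℂ) * Complex.I := by
  have h1 : HasMFDerivAt (𝓡 4) 𝓘(ℝ, ℝ) (Complex.reCLM ∘ f) x _ :=
    (Complex.reCLM.hasMFDerivAt (x := f x)).comp x hf.hasMFDerivAt
  have h2 : HasMFDerivAt (𝓡 4) 𝓘(ℝ, ℝ) (Complex.imCLM ∘ f) x _ :=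
    (Complex.imCLM.hasMFDerivAt (x := f x)).comp x hf.hasMFDerivAt
  have e1 : dirR X (fun y => (f y).re) x = (dirC X f x).re := by
    change mfderiv (𝓡 4) 𝓘(ℝ, ℝ) (Complex.reCLM ∘ f) x (X x) = _
    rw [h1.mfderiv]; rfl
  have e2 : dirR X (fun y => (f y).im) x = (dirC X f x).im := by
    change mfderiv (𝓡 4) 𝓘(ℝ, ℝ) (Complex.imCLM ∘ f) x (X x) = _
    rw [h2.mfderiv]; rfl
  rw [e1, e2, Complex.re_add_im]

/-- The derivative along a Lie bracket is the commutator of the derivatives: this follows from the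
Jacobi identity for a third, nonvanishing vector field. -/
lemma dirR_bracket (hU : IsOpen U) (hX : SmoothFieldOn X U) (hY : SmoothFieldOn Y U)
    (hZ : SmoothFieldOn Z U) (hZ0 : Z x ≠ 0) (hf : ContMDiffOn (𝓡 4) 𝓘(ℝ, ℝ) ∞ f U)
    (hXf : ContMDiffOn (𝓡 4) 𝓘(ℝ, ℝ) ∞ (dirR X f) U)
    (hYf : ContMDiffOn (𝓡 4) 𝓘(ℝ, ℝ) ∞ (dirR Y f) U) (hx : x ∈ U) :
    dirR (bracket X Y) f x = dirR X (dirR Y f) x - dirR Y (dirR X f) x := by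
  have hf' : ∀ y ∈ U, MDifferentiableAt (𝓡 4) 𝓘(ℝ, ℝ) f y := fun y hy =>
    (hf.contMDiffAt (hU.mem_nhds hy)).mdifferentiableAt (by simp)
  have key : ∀ {X Y : VField M}, SmoothFieldOn X U → SmoothFieldOn Y U →
      ContMDiffOn (𝓡 4) 𝓘(ℝ, ℝ) ∞ (dirR Y f) U →
      bracket X (bracket Y (f • Z)) x = dirR X (dirR Y f) x • Z x + dirR Y f x • bracket X Z x
        + dirR X f x • bracket Y Z x + f x • bracket X (bracket Y Z) x := by
    intro X Y hX hY hYf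
    have e : bracket Y (f • Z) =ᶠ[nhds x] dirR Y f • Z + f • bracket Y Z :=
      Filter.eventuallyEq_of_mem (hU.mem_nhds hx) fun y hy =>
        bracket_smul_right (hf' y hy) (hZ.at hU hy)
    have hYZ := hY.bracket hU hZ
    have e2 : bracket X (bracket Y (f • Z)) x = bracket X (dirR Y f • Z + f • bracket Y Z) x :=
      Filter.EventuallyEq.mlieBracket_vectorField_eq (Filter.EventuallyEq.refl _ _) e
    rw [e2, bracket_add_right ((hZ.smul hYf).at hU hx) ((hYZ.smul hf).at hU hx),
      bracket_smul_right ((hYf.contMDiffAt (hU.mem_nhds hx)).mdifferentiableAt (by simp))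
        (hZ.at hU hx), bracket_smul_right (hf' x hx) (hYZ.at hU hx)]
    abel
  have j1 := bracket_jacobi (hX.at hU hx) (hY.at hU hx) ((hZ.smul hf).at hU hx)
  have j2 := bracket_jacobi (hX.at hU hx) (hY.at hU hx) (hZ.at hU hx)
  rw [key hX hY hYf, key hY hX hXf, bracket_smul_right (hf' x hx) (hZ.at hU hx), j2] at j1
  -- The Jacobi identity for `X, Y, f Z`, reduced by the one for `X, Y, Z`, leaves only a multiple
  -- of `Z`.
  have j3 : (dirR (bracket X Y) f x - (dirR X (dirR Y f) x - dirR Y (dirR X f) x)) • Z x = 0 := by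
    linear_combination (norm := module) -j1
  exact sub_eq_zero.1 ((smul_eq_zero.1 j3).resolve_right hZ0)

end Fields

/-! ### Pseudo-orthonormal frames and their structure functions. -/

section Frame

variable {M : Type*} [TopologicalSpace M] [ChartedSpace E4 M] [IsManifold (𝓡 4) ∞ M]
  {U : Set M} {g : BilinField M} {η : Fin 4 → ℝ} {e : Fin 4 → VField M} {x : M}

lemma IsFrame.sign_mul_self (he : IsFrame g η U e) (i : Fin 4) : η i * η i = 1 := by
  rcases he.sign i with h | h <;> simp [h]

lemma IsFrame.ne_zero (he : IsFrame g η U e) (hx : x ∈ U) (i : Fin 4) : e i x ≠ 0 := by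
  intro h
  have h1 := he.orthonormal x hx i i
  have h2 := he.sign_mul_self i
  rw [h] at h1
  simp only [map_zero, if_true] at h1
  rw [← h1] at h2
  simp at h2

/-- Four orthonormal vectors are independent, hence a basis. The difference of the two sides is
orthogonal to each of them, so nondegeneracy kills it. -/
lemma IsFrame.expand (hg : IsPseudoRiemannian g) (he : IsFrame g η U e) (hx : x ∈ U)
    (v : TangentSpace (𝓡 4) x) : v = ∑ m, (η m * g x v (e m x)) • e m x := by
  have hli : LinearIndependent ℝ (fun i => e i x) := by
    rw [Fintype.linearIndependent_iff]
    intro c hc i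
    have h1 : g x (∑ j, c j • e j x) (e i x) = 0 := by rw [hc]; simp
    simp only [map_sum, map_smul, sum_apply, smul_apply,
      he.orthonormal x hx, smul_eq_mul, mul_ite, mul_zero, Finset.sum_ite_eq', Finset.mem_univ,
      if_true] at h1
    have h2 := he.sign_mul_self i
    linear_combination η i * h1 - c i * h2
  have hfr : Fintype.card (Fin 4) = Module.finrank ℝ (TangentSpace (𝓡 4) x) := by
    change _ = Module.finrank ℝ E4
    simp
  have : FiniteDimensional ℝ (TangentSpace (𝓡 4) x) := inferInstanceAs (FiniteDimensional ℝ E4)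
  let b := basisOfLinearIndependentOfCardEqFinrank hli hfr
  have hb : ∀ i, b i = e i x := fun i => by simp [b]
  rw [← sub_eq_zero]
  apply hg.nondegenerate
  intro w
  have hk : ∀ k, g x (v - ∑ m, (η m * g x v (e m x)) • e m x) (e k x) = 0 := by
    intro k
    simp only [map_sub, map_sum, map_smul, sum_apply,
      smul_apply, sub_apply,
      he.orthonormal x hx, smul_eq_mul, mul_ite, mul_zero, Finset.sum_ite_eq', Finset.mem_univ,
      if_true]
    linear_combination -g x v (e k x) * he.sign_mul_self k
  have hw := b.sum_repr w
  rw [← hw]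
  simp only [map_sum, map_smul, hb, hk, smul_zero, Finset.sum_const_zero]

lemma IsFrame.smooth_bracket (hU : IsOpen U) (he : IsFrame g η U e) (i j : Fin 4) :
    SmoothFieldOn (bracket (e i) (e j)) U :=
  (he.smooth i).bracket hU (he.smooth j)

lemma IsFrame.smooth_conn (hg : IsPseudoRiemannian g) (hU : IsOpen U) (he : IsFrame g η U e)
    (i j k : Fin 4) : ContMDiffOn (𝓡 4) 𝓘(ℝ, ℝ) ∞ (conn g e i j k) U := by
  have h : ∀ i j k, ContMDiffOn (𝓡 4) 𝓘(ℝ, ℝ) ∞ (fun x => g x (bracket (e i) (e j) x) (e k x)) U :=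
    fun i j k => smooth_bilin hg (he.smooth_bracket hU i j) (he.smooth k)
  exact contMDiffOn_const.mul (((h i j k).sub (h j k i)).add (h k i j))

/-- Smoothness of `e_i f` is read off from brackets: `[e_i, f e_0] - f [e_i, e_0] = (e_i f) e_0`,
and pairing with `e_0` recovers `e_i f` up to the sign `η 0`. -/
lemma IsFrame.smooth_dirR (hg : IsPseudoRiemannian g) (hU : IsOpen U) (he : IsFrame g η U e)
    {f : M → ℝ} (hf : ContMDiffOn (𝓡 4) 𝓘(ℝ, ℝ) ∞ f U) (i : Fin 4) :
    ContMDiffOn (𝓡 4) 𝓘(ℝ, ℝ) ∞ (dirR (e i) f) U := by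
  have h1 := smooth_bilin hg ((he.smooth i).bracket hU ((he.smooth 0).smul hf)) (he.smooth 0)
  have h2 := smooth_bilin hg ((he.smooth_bracket hU i 0).smul hf) (he.smooth 0)
  refine (contMDiffOn_const (c := η 0) |>.mul (h1.sub h2)).congr fun x hx => ?_
  simp only [Pi.mul_apply, Pi.smul_apply']
  rw [bracket_smul_right ((hf.contMDiffAt (hU.mem_nhds hx)).mdifferentiableAt (by simp))
    ((he.smooth 0).at hU hx)]
  have h3 := he.orthonormal x hx 0 0
  have h4 := he.sign_mul_self 0
  simp only [if_true] at h3
  simp only [map_add, map_smul, add_apply, smul_apply,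
    smul_eq_mul, h3]
  linear_combination -dirR (e i) f x * h4

omit [IsManifold (𝓡 4) ∞ M] in
lemma contMDiffOn_mul {f h : M → ℂ} (hf : ContMDiffOn (𝓡 4) 𝓘(ℝ, ℂ) ∞ f U)
    (hh : ContMDiffOn (𝓡 4) 𝓘(ℝ, ℂ) ∞ h U) :
    ContMDiffOn (𝓡 4) 𝓘(ℝ, ℂ) ∞ (fun x => f x * h x) U :=
  (contDiff_mul (𝕜 := ℝ) (𝔸 := ℂ)).contMDiff.comp_contMDiffOn (hf.prodMk_space hh)

lemma IsFrame.smooth_dirC (hg : IsPseudoRiemannian g) (hU : IsOpen U) (he : IsFrame g η U e)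
    {f : M → ℂ} (hf : ContMDiffOn (𝓡 4) 𝓘(ℝ, ℂ) ∞ f U) (i : Fin 4) :
    ContMDiffOn (𝓡 4) 𝓘(ℝ, ℂ) ∞ (dirC (e i) f) U := by
  have hr := he.smooth_dirR hg hU (Complex.reCLM.contMDiff.comp_contMDiffOn hf) i
  have hi := he.smooth_dirR hg hU (Complex.imCLM.contMDiff.comp_contMDiffOn hf) i
  refine ((Complex.ofRealCLM.contMDiff.comp_contMDiffOn hr).add
    (contMDiffOn_mul (Complex.ofRealCLM.contMDiff.comp_contMDiffOn hi) contMDiffOn_const)).congr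
    fun x hx => dirC_eq_re_im ((hf.contMDiffAt (hU.mem_nhds hx)).mdifferentiableAt (by simp))

omit [IsManifold (𝓡 4) ∞ M] in
lemma conn_antisymm (g : BilinField M) (e : Fin 4 → VField M) (i j k : Fin 4) (x : M) :
    conn g e i k j x = -conn g e i j k x := by
  simp only [conn]
  rw [bracket_swap (e i) (e k), bracket_swap (e k) (e j), bracket_swap (e j) (e i)]
  simp only [map_neg, neg_apply]
  ring

omit [IsManifold (𝓡 4) ∞ M] in
lemma conn_torsion (g : BilinField M) (e : Fin 4 → VField M) (i j k : Fin 4) (x : M) :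
    conn g e i j k x - conn g e j i k x = g x (bracket (e i) (e j) x) (e k x) := by
  simp only [conn]
  rw [bracket_swap (e j) (e i), bracket_swap (e i) (e k), bracket_swap (e k) (e j)]
  simp only [map_neg, neg_apply]
  ring

lemma IsFrame.bracket_expand (hg : IsPseudoRiemannian g) (he : IsFrame g η U e) (hx : x ∈ U)
    (i j : Fin 4) : bracket (e i) (e j) x =
      ∑ m, (η m * (conn g e i j m x - conn g e j i m x)) • e m x := by
  simp only [conn_torsion]
  exact he.expand hg hx _

lemma IsFrame.dirR_comm (hg : IsPseudoRiemannian g) (hU : IsOpen U) (he : IsFrame g η U e)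
    (hx : x ∈ U) {f : M → ℝ} (hf : ContMDiffOn (𝓡 4) 𝓘(ℝ, ℝ) ∞ f U) (i j : Fin 4) :
    dirR (e i) (dirR (e j) f) x - dirR (e j) (dirR (e i) f) x =
      ∑ m, η m * (conn g e i j m x - conn g e j i m x) * dirR (e m) f x := by
  rw [← dirR_bracket hU (he.smooth i) (he.smooth j) (he.smooth 0) (he.ne_zero hx 0) hf
    (he.smooth_dirR hg hU hf i) (he.smooth_dirR hg hU hf j) hx]
  have h : ∀ X : VField M, dirR X f x = mvfderiv (𝓡 4) f x (X x) := fun _ => rfl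
  simp only [h, he.bracket_expand hg hx, map_sum, map_smul, smul_eq_mul]

lemma IsFrame.dirC_comm (hg : IsPseudoRiemannian g) (hU : IsOpen U) (he : IsFrame g η U e)
    (hx : x ∈ U) {f : M → ℂ} (hf : ContMDiffOn (𝓡 4) 𝓘(ℝ, ℂ) ∞ f U) (i j : Fin 4) :
    dirC (e i) (dirC (e j) f) x - dirC (e j) (dirC (e i) f) x =
      ∑ m, (η m * (conn g e i j m x - conn g e j i m x) : ℝ) * dirC (e m) f x := by
  have hr : ContMDiffOn (𝓡 4) 𝓘(ℝ, ℝ) ∞ (fun y => (f y).re) U :=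
    Complex.reCLM.contMDiff.comp_contMDiffOn hf
  have hi : ContMDiffOn (𝓡 4) 𝓘(ℝ, ℝ) ∞ (fun y => (f y).im) U :=
    Complex.imCLM.contMDiff.comp_contMDiffOn hf
  have hd : ∀ i, ∀ y ∈ U, dirC (e i) f y = (dirR (e i) (fun y => (f y).re) y : ℂ)
      + (dirR (e i) (fun y => (f y).im) y : ℂ) * Complex.I := fun i y hy =>
    dirC_eq_re_im ((hf.contMDiffAt (hU.mem_nhds hy)).mdifferentiableAt (by simp))
  have h2 : ∀ i j, dirC (e i) (dirC (e j) f) x =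
      (dirR (e i) (dirR (e j) (fun y => (f y).re)) x : ℂ)
      + (dirR (e i) (dirR (e j) (fun y => (f y).im)) x : ℂ) * Complex.I := by
    intro i j
    rw [dirC_eq_re_im (((he.smooth_dirC hg hU hf j).contMDiffAt
      (hU.mem_nhds hx)).mdifferentiableAt (by simp)),
      dirR_congr (f := fun y => (dirC (e j) f y).re) (h := dirR (e j) (fun y => (f y).re)) hU hx
        fun y hy => by rw [hd j y hy]; simp,
      dirR_congr (f := fun y => (dirC (e j) f y).im) (h := dirR (e j) (fun y => (f y).im)) hU hx
        fun y hy => by rw [hd j y hy]; simp]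
  have k1 := congrArg (fun r : ℝ => (r : ℂ)) (he.dirR_comm hg hU hx hr i j)
  have k2 := congrArg (fun r : ℝ => (r : ℂ)) (he.dirR_comm hg hU hx hi i j)
  simp only [Fin.sum_univ_four] at k1 k2
  push_cast at k1 k2
  rw [h2, h2]
  simp only [hd _ x hx, Fin.sum_univ_four]
  push_cast
  linear_combination k1 + Complex.I * k2

/-- The Jacobi identity for the structure functions of a frame. -/
lemma IsFrame.jacobi (hg : IsPseudoRiemannian g) (hU : IsOpen U) (he : IsFrame g η U e)
    (hx : x ∈ U) (i j k l : Fin 4) :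
    let c (i j k : Fin 4) (y : M) : ℝ := conn g e i j k y - conn g e j i k y
    dirR (e i) (c j k l) x + dirR (e j) (c k i l) x + dirR (e k) (c i j l) x
      + ∑ m, η m * (c j k m x * c i m l x + c k i m x * c j m l x + c i j m x * c k m l x) = 0 := by
  intro c
  have hc : ∀ i j k, ContMDiffOn (𝓡 4) 𝓘(ℝ, ℝ) ∞ (c i j k) U := fun i j k =>
    (he.smooth_conn hg hU i j k).sub (he.smooth_conn hg hU j i k)
  -- The inner bracket is expanded in the frame near `x`, so the outer bracket also differentiates
  -- the structure functions. The identity is then the `e_l` component of the Jacobi identity for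
  -- three frame fields.
  have key : ∀ i j k, g x (bracket (e i) (bracket (e j) (e k)) x) (e l x) =
      dirR (e i) (c j k l) x + ∑ m, η m * (c j k m x * c i m l x) := by
    intro i j k
    have hs : ∀ m, SmoothFieldAt ((fun y => η m * c j k m y) • e m) x := fun m =>
      ((he.smooth m).smul (contMDiffOn_const.mul (hc j k m))).at hU hx
    have hs' : ∀ m, SmoothFieldOn ((fun y => η m * c j k m y) • e m) U := fun m =>
      ((he.smooth m).smul (contMDiffOn_const.mul (hc j k m)))
    have h1 : bracket (e j) (e k) =ᶠ[nhds x]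
        (((fun y => η 0 * c j k 0 y) • e 0 + (fun y => η 1 * c j k 1 y) • e 1) +
          (fun y => η 2 * c j k 2 y) • e 2) + (fun y => η 3 * c j k 3 y) • e 3 :=
      Filter.eventuallyEq_of_mem (hU.mem_nhds hx) fun y hy => by
        rw [he.bracket_expand hg hy, Fin.sum_univ_four]
        rfl
    have h2 : bracket (e i) (bracket (e j) (e k)) x = bracket (e i) _ x :=
      Filter.EventuallyEq.mlieBracket_vectorField_eq (Filter.EventuallyEq.refl _ _) h1
    have hd : ∀ m, MDifferentiableAt (𝓡 4) 𝓘(ℝ, ℝ) (c j k m) x := fun m =>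
      ((hc j k m).contMDiffAt (hU.mem_nhds hx)).mdifferentiableAt (by simp)
    have h3 : ∀ m, bracket (e i) ((fun y => η m * c j k m y) • e m) x =
        (η m * dirR (e i) (c j k m) x) • e m x + (η m * c j k m x) • bracket (e i) (e m) x := by
      intro m
      rw [bracket_smul_right (f := fun y => η m * c j k m y) (mdifferentiableAt_const.mul (hd m))
        ((he.smooth m).at hU hx),
        dirR_mul mdifferentiableAt_const (hd m), dirR_const, mul_zero, add_zero]
    rw [h2, bracket_add_right ((((hs' 0).add (hs' 1)).add (hs' 2)).at hU hx) (hs 3),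
      bracket_add_right (((hs' 0).add (hs' 1)).at hU hx) (hs 2),
      bracket_add_right (hs 0) (hs 1), h3, h3, h3, h3]
    have h4 : ∀ m, g x (bracket (e i) (e m) x) (e l x) = c i m l x := fun m =>
      (conn_torsion g e i m l x).symm
    have h5 := he.sign_mul_self l
    simp only [map_add, map_smul, add_apply, smul_apply,
      smul_eq_mul, h4, he.orthonormal x hx, Fin.sum_univ_four]
    fin_cases l <;> simp at h5 ⊢ <;> linear_combination dirR (e i) (c j k _) x * h5
  have hj := bracket_jacobi ((he.smooth i).at hU hx) ((he.smooth j).at hU hx)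
    ((he.smooth k).at hU hx)
  have e1 : bracket (bracket (e i) (e j)) (e k) x = -bracket (e k) (bracket (e i) (e j)) x :=
    bracket_swap _ _ _
  have e2 : bracket (e j) (bracket (e i) (e k)) x = -bracket (e j) (bracket (e k) (e i)) x := by
    -- The sign sits inside an outer bracket, so it is pulled out by the Leibniz rule for the
    -- constant function `-1`.
    have : bracket (e i) (e k) = (fun _ : M => (-1 : ℝ)) • bracket (e k) (e i) := by
      ext y : 1
      rw [bracket_swap (e i)]
      simp
    rw [this, bracket_smul_right mdifferentiableAt_const ((he.smooth_bracket hU k i).at hU hx),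
      dirR_const]
    simp
  rw [e1, e2] at hj
  have hj2 := congrArg (fun v => g x v (e l x)) hj
  simp only [map_add, map_neg, add_apply, neg_apply,
    key] at hj2
  simp only [Fin.sum_univ_four] at hj2 ⊢
  linear_combination hj2

end Frame

/-! ### Rescaling to the neutral frame. -/

section Scale

variable {η : Fin 4 → ℝ}

/-- The factors that turn a pseudo-orthonormal frame into a neutral one. -/
def scale (η : Fin 4 → ℝ) (i : Fin 4) : ℂ :=
  (if η i = 1 then 1 else Complex.I) * ((Real.sqrt 2 : ℝ) : ℂ)⁻¹ *
    ![1, Complex.I, 1, Complex.I] i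

/-- Signature, `√2` and the factors `i` all go into `scale`, leaving the matrices `rho`, which have
integer entries and do not depend on the signature. -/
lemma solder_eq (η : Fin 4 → ℝ) (i : Fin 4) (A A' : Fin 2) :
    solder η i A A' = scale η i * rho i A A' := by
  fin_cases i <;> fin_cases A <;> fin_cases A' <;> simp [solder, scale, rho, quat]

lemma sqrt_two_inv_sq : (((Real.sqrt 2 : ℝ) : ℂ)⁻¹) ^ 2 = 1 / 2 := by
  rw [inv_pow, ← Complex.ofReal_pow, Real.sq_sqrt (by norm_num)]
  norm_num

lemma scale_ne_zero (η : Fin 4 → ℝ) (i : Fin 4) : scale η i ≠ 0 := by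
  have h : ((Real.sqrt 2 : ℝ) : ℂ)⁻¹ ≠ 0 := by
    intro h
    have := sqrt_two_inv_sq
    rw [h] at this
    norm_num at this
  unfold scale
  refine mul_ne_zero (mul_ne_zero ?_ h) ?_
  · split_ifs <;> simp
  · fin_cases i <;> simp

/-- `theta` is the diagonal of the inverse metric in the frame `scale η i • e i`. This relation
turns every contraction with `η` into one with `theta`. -/
lemma theta_mul_scale_sq (hη : ∀ i, η i = 1 ∨ η i = -1) (i : Fin 4) :
    theta i * (scale η i * scale η i) = (η i : ℂ) := by
  have h2 := sqrt_two_inv_sq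
  have hI := Complex.I_mul_I
  have h1 : (-1 : ℝ) ≠ 1 := by norm_num
  generalize ((Real.sqrt 2 : ℝ) : ℂ)⁻¹ = s at h2
  have key : ∀ i, (scale η i * scale η i) = η i * (1 / 2) * (![1, Complex.I, 1, Complex.I] i) ^ 2 := by
    intro i
    rcases hη i with h | h
    · simp only [scale, h, if_true]
      push_cast
      linear_combination (![1, Complex.I, 1, Complex.I] i) ^ 2 * sqrt_two_inv_sq
    · simp only [scale, h, h1, if_false]
      push_cast
      linear_combination Complex.I ^ 2 * (![1, Complex.I, 1, Complex.I] i) ^ 2 * sqrt_two_inv_sq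
        + (1 / 2) * (![1, Complex.I, 1, Complex.I] i) ^ 2 * hI
  rw [key]
  fin_cases i <;> simp [theta] <;> ring

/-- Antisymmetry is needed because `sdPart` reads only six components of `T`. -/
lemma primedPart_eq_sdPart (η : Fin 4 → ℝ) {T : Fin 4 → Fin 4 → ℂ} (hT : ∀ i j, T j i = -T i j)
    (A B : Fin 2) :
    primedPart η T A B = sdPart (fun i j => scale η i * scale η j * T i j) A B := by
  have h0 : ∀ i, T i i = 0 := fun i => by
    have h := hT i i
    linear_combination (1 / 2) * h
  have h10 := hT 0 1
  have h20 := hT 0 2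
  have h30 := hT 0 3
  have h21 := hT 1 2
  have h31 := hT 1 3
  have h32 := hT 2 3
  fin_cases A <;> fin_cases B <;>
  simp [primedPart, toSpinor₂, solder_eq, sdPart, rho, Fin.sum_univ_four, Fin.sum_univ_two, eps,
    h0, h10, h20, h30, h21, h31, h32] <;> ring

lemma primedPart_symm (η : Fin 4 → ℝ) {T : Fin 4 → Fin 4 → ℂ} (hT : ∀ i j, T j i = -T i j)
    (A B : Fin 2) : primedPart η T A B = primedPart η T B A := by
  rw [primedPart_eq_sdPart η hT, primedPart_eq_sdPart η hT]
  fin_cases A <;> fin_cases B <;> simp [sdPart]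

/-- The symmetrised primed part of a tensor is the primed part of its antisymmetrisation. -/
lemma primedPart_antisymm (η : Fin 4 → ℝ) (T : Fin 4 → Fin 4 → ℂ) (A' B' : Fin 2) :
    (1 / 2) * ∑ A, ∑ B, eps A B * (toSpinor₂ η T A A' B B' + toSpinor₂ η T A B' B A') =
      primedPart η (fun i j => T i j - T j i) A' B' := by
  have h : ∀ A B A' B', toSpinor₂ η (fun i j => T i j - T j i) A A' B B' =
      toSpinor₂ η T A A' B B' - toSpinor₂ η T B B' A A' := by
    intro A B A' B'
    simp only [toSpinor₂, mul_sub, Finset.sum_sub_distrib]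
    congr 1
    rw [Finset.sum_comm]
    refine Finset.sum_congr rfl fun i _ => Finset.sum_congr rfl fun j _ => by ring
  simp only [primedPart, h, Fin.sum_univ_two, eps]
  simp
  ring

end Scale

/-! ### The ring of smooth functions, on which the frame acts by derivations. -/

section SmoothRing

/-- Derivations over the integers. -/
abbrev IntDerivation (R : Type*) [CommRing R] : Type _ := Derivation ℤ R R

variable {M : Type*} [TopologicalSpace M] [ChartedSpace E4 M]
  {U : Set M} {g : BilinField M} {η : Fin 4 → ℝ} {e : Fin 4 → VField M} {x : M}

/-- The ring of complex functions that are smooth on `U`. -/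
def smoothRing (U : Set M) : Subalgebra ℂ (M → ℂ) where
  carrier := {f | ContMDiffOn (𝓡 4) 𝓘(ℝ, ℂ) ∞ f U}
  mul_mem' hf hh := contMDiffOn_mul hf hh
  add_mem' hf hh := ContMDiffOn.add hf hh
  algebraMap_mem' c := contMDiffOn_const (c := c)

open Classical in
/-- A function that is smooth on `U`, extended by zero. -/
def smoothElt {f : M → ℂ} (hf : ContMDiffOn (𝓡 4) 𝓘(ℝ, ℂ) ∞ f U) : smoothRing U :=
  ⟨U.indicator f, hf.congr fun _ hx => Set.indicator_of_mem hx f⟩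

lemma smoothElt_of_mem {f : M → ℂ} (hf : ContMDiffOn (𝓡 4) 𝓘(ℝ, ℂ) ∞ f U) (hx : x ∈ U) :
    (smoothElt hf : M → ℂ) x = f x := Set.indicator_of_mem hx f

lemma smoothElt_of_notMem {f : M → ℂ} (hf : ContMDiffOn (𝓡 4) 𝓘(ℝ, ℂ) ∞ f U) (hx : x ∉ U) :
    (smoothElt hf : M → ℂ) x = 0 := Set.indicator_of_notMem hx f

lemma smoothRing.mdifferentiableAt (hU : IsOpen U) (f : smoothRing U) (hx : x ∈ U) :
    MDifferentiableAt (𝓡 4) 𝓘(ℝ, ℂ) (f : M → ℂ) x :=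
  (ContMDiffOn.contMDiffAt f.2 (hU.mem_nhds hx)).mdifferentiableAt (by simp)

/-- Elements of the ring are arbitrary off `U`, so identities have to be checked there as well.
Extending derivatives and coefficients by zero makes them hold trivially. -/
lemma smoothRing.ext {f h : smoothRing U} (h1 : ∀ x ∈ U, (f : M → ℂ) x = (h : M → ℂ) x)
    (h2 : ∀ x ∉ U, (f : M → ℂ) x = (h : M → ℂ) x) : f = h := by
  ext x
  by_cases hx : x ∈ U
  exacts [h1 x hx, h2 x hx]

@[simp] lemma smoothRing.theta_apply (i : Fin 4) (x : M) :
    ((theta i : smoothRing U) : M → ℂ) x = theta i := by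
  fin_cases i <;> simp [theta] <;> rfl

lemma smoothRing.sdPart_apply (T : Fin 4 → Fin 4 → smoothRing U) (A B : Fin 2) (x : M) :
    ((sdPart T A B : smoothRing U) : M → ℂ) x = sdPart (fun i j => (T i j : M → ℂ) x) A B := by
  fin_cases A <;> fin_cases B <;> simp [sdPart]

variable [IsManifold (𝓡 4) ∞ M]

/-- The derivative `c e_i f`, extended by zero from `U`. -/
def frameDerivFun (hg : IsPseudoRiemannian g) (hU : IsOpen U) (he : IsFrame g η U e) (c : ℂ)
    (i : Fin 4) (f : smoothRing U) : smoothRing U :=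
  smoothElt (contMDiffOn_mul (contMDiffOn_const (c := c)) (he.smooth_dirC hg hU f.2 i))

lemma frameDerivFun_of_mem (hg : IsPseudoRiemannian g) (hU : IsOpen U) (he : IsFrame g η U e)
    (c : ℂ) (i : Fin 4) (f : smoothRing U) (hx : x ∈ U) :
    (frameDerivFun hg hU he c i f : M → ℂ) x = c * dirC (e i) f x :=
  smoothElt_of_mem (contMDiffOn_mul (contMDiffOn_const (c := c)) (he.smooth_dirC hg hU f.2 i)) hx

lemma frameDerivFun_of_notMem (hg : IsPseudoRiemannian g) (hU : IsOpen U)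
    (he : IsFrame g η U e) (c : ℂ) (i : Fin 4) (f : smoothRing U) (hx : x ∉ U) :
    (frameDerivFun hg hU he c i f : M → ℂ) x = 0 :=
  smoothElt_of_notMem (contMDiffOn_mul (contMDiffOn_const (c := c)) (he.smooth_dirC hg hU f.2 i)) hx

/-- The derivation `c e_i` of the ring of smooth functions, for a frame `e`. -/
def frameDeriv (hg : IsPseudoRiemannian g) (hU : IsOpen U) (he : IsFrame g η U e) (c : ℂ)
    (i : Fin 4) : IntDerivation (smoothRing U) :=
  Derivation.mk' (AddMonoidHom.toIntLinearMap
    { toFun := frameDerivFun hg hU he c i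
      map_zero' := by
        refine smoothRing.ext (fun x hx => ?_)
          (fun x hx => by rw [frameDerivFun_of_notMem _ _ _ _ _ _ hx]; rfl)
        rw [frameDerivFun_of_mem _ _ _ _ _ _ hx]
        change c * dirC (e i) (fun _ => 0) x = 0
        rw [dirC_const, mul_zero]
      map_add' := fun f h => by
        refine smoothRing.ext (fun x hx => ?_) (fun x hx => ?_)
        · push_cast
          rw [Pi.add_apply]
          simp only [frameDerivFun_of_mem _ _ _ _ _ _ hx]
          rw [← mul_add, ← dirC_add (smoothRing.mdifferentiableAt hU f hx) (smoothRing.mdifferentiableAt hU h hx)]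
          rfl
        · push_cast
          rw [Pi.add_apply]
          simp only [frameDerivFun_of_notMem _ _ _ _ _ _ hx, add_zero] })
    (fun f h => by
      change frameDerivFun hg hU he c i (f * h) = f * frameDerivFun hg hU he c i h
        + h * frameDerivFun hg hU he c i f
      refine smoothRing.ext (fun x hx => ?_) (fun x hx => ?_)
      · push_cast
        rw [Pi.add_apply, Pi.mul_apply, Pi.mul_apply]
        simp only [frameDerivFun_of_mem _ _ _ _ _ _ hx]
        have := dirC_mul (X := e i) (smoothRing.mdifferentiableAt hU f hx) (smoothRing.mdifferentiableAt hU h hx)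
        change c * dirC (e i) (fun y => (f : M → ℂ) y * (h : M → ℂ) y) x = _
        rw [this]
        ring
      · push_cast
        rw [Pi.add_apply, Pi.mul_apply, Pi.mul_apply]
        simp only [frameDerivFun_of_notMem _ _ _ _ _ _ hx, mul_zero, add_zero])

lemma frameDeriv_of_mem (hg : IsPseudoRiemannian g) (hU : IsOpen U) (he : IsFrame g η U e) (c : ℂ)
    (i : Fin 4) (f : smoothRing U) (hx : x ∈ U) :
    (frameDeriv hg hU he c i f : M → ℂ) x = c * dirC (e i) f x :=
  frameDerivFun_of_mem hg hU he c i f hx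

lemma frameDeriv_of_notMem (hg : IsPseudoRiemannian g) (hU : IsOpen U) (he : IsFrame g η U e)
    (c : ℂ) (i : Fin 4) (f : smoothRing U) (hx : x ∉ U) :
    (frameDeriv hg hU he c i f : M → ℂ) x = 0 :=
  frameDerivFun_of_notMem hg hU he c i f hx

lemma frameDeriv_smoothElt (hg : IsPseudoRiemannian g) (hU : IsOpen U) (he : IsFrame g η U e)
    (c : ℂ) (i : Fin 4) {f : M → ℂ} (hf : ContMDiffOn (𝓡 4) 𝓘(ℝ, ℂ) ∞ f U) (hx : x ∈ U) :
    (frameDeriv hg hU he c i (smoothElt hf) : M → ℂ) x = c * dirC (e i) f x := by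
  rw [frameDeriv_of_mem hg hU he c i _ hx, dirC_congr hU hx fun y hy => smoothElt_of_mem hf hy]

lemma IsFrame.smooth_conn_ofReal (hg : IsPseudoRiemannian g) (hU : IsOpen U)
    (he : IsFrame g η U e) (i j k : Fin 4) :
    ContMDiffOn (𝓡 4) 𝓘(ℝ, ℂ) ∞ (fun x => (conn g e i j k x : ℂ)) U :=
  Complex.ofRealCLM.contMDiff.comp_contMDiffOn (he.smooth_conn hg hU i j k)

/-- The connection coefficients of the neutral frame. -/
def neutralConn (hg : IsPseudoRiemannian g) (hU : IsOpen U) (he : IsFrame g η U e)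
    (i j k : Fin 4) : smoothRing U :=
  smoothElt (contMDiffOn_mul (contMDiffOn_const (c := scale η i * scale η j * scale η k))
    (he.smooth_conn_ofReal hg hU i j k))

/-- The neutral frame, as derivations. -/
def neutralDeriv (hg : IsPseudoRiemannian g) (hU : IsOpen U) (he : IsFrame g η U e)
    (i : Fin 4) : IntDerivation (smoothRing U) :=
  frameDeriv hg hU he (scale η i) i

lemma neutralConn_of_mem (hg : IsPseudoRiemannian g) (hU : IsOpen U) (he : IsFrame g η U e)
    (i j k : Fin 4) (hx : x ∈ U) : (neutralConn hg hU he i j k : M → ℂ) x =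
      scale η i * scale η j * scale η k * conn g e i j k x :=
  smoothElt_of_mem _ hx

lemma neutralConn_antisymm (hg : IsPseudoRiemannian g) (hU : IsOpen U) (he : IsFrame g η U e)
    (i j k : Fin 4) : neutralConn hg hU he i k j = -neutralConn hg hU he i j k := by
  refine smoothRing.ext (fun x hx => ?_) (fun x hx => ?_)
  · change _ = -(neutralConn hg hU he i j k : M → ℂ) x
    rw [neutralConn_of_mem _ _ _ _ _ _ hx, neutralConn_of_mem _ _ _ _ _ _ hx, conn_antisymm]
    push_cast
    ring
  · change _ = -(neutralConn hg hU he i j k : M → ℂ) x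
    simp only [neutralConn, smoothElt_of_notMem _ hx, neg_zero]

lemma neutralConn_self (hg : IsPseudoRiemannian g) (hU : IsOpen U) (he : IsFrame g η U e)
    (i j : Fin 4) : neutralConn hg hU he i j j = 0 := by
  ext x
  have h := congrArg (fun f : smoothRing U => (f : M → ℂ) x) (neutralConn_antisymm hg hU he i j j)
  change _ = -(neutralConn hg hU he i j j : M → ℂ) x at h
  change _ = (0 : ℂ)
  linear_combination (1 / 2) * h

/-- Provides the hypothesis `hD` of the algebraic identities: torsion-freeness, tested on functions.
-/
lemma neutralDeriv_comm (hg : IsPseudoRiemannian g) (hU : IsOpen U) (he : IsFrame g η U e)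
    (i j : Fin 4) (f : smoothRing U) :
    let D := neutralDeriv hg hU he
    let γ := neutralConn hg hU he
    D i (D j f) - D j (D i f) = ∑ m, theta m * (γ i j m - γ j i m) * D m f := by
  intro D γ
  refine smoothRing.ext (fun x hx => ?_) (fun x hx => ?_)
  · have h := he.dirC_comm hg hU hx f.2 i j
    have hD : ∀ i j, (D i (D j f) : M → ℂ) x
        = scale η i * scale η j * dirC (e i) (dirC (e j) f) x := by
      intro i j
      rw [show D i (D j f) = frameDeriv hg hU he (scale η i) i (smoothElt
        (contMDiffOn_mul (contMDiffOn_const (c := scale η j)) (he.smooth_dirC hg hU f.2 j)))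
        from rfl, frameDeriv_smoothElt hg hU he _ _ _ hx, dirC_mul mdifferentiableAt_const
        (((he.smooth_dirC hg hU f.2 j).contMDiffAt (hU.mem_nhds hx)).mdifferentiableAt (by simp)),
        dirC_const]
      ring
    have hD1 : ∀ i, (D i f : M → ℂ) x = scale η i * dirC (e i) f x := fun i =>
      frameDeriv_of_mem hg hU he _ _ _ hx
    have hγ : ∀ i j k, (γ i j k : M → ℂ) x = scale η i * scale η j * scale η k * conn g e i j k x :=
      fun i j k => neutralConn_of_mem hg hU he i j k hx
    have hs := theta_mul_scale_sq he.sign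
    simp only [Fin.sum_univ_four] at h ⊢
    push_cast at h ⊢
    simp only [Pi.add_apply, Pi.mul_apply, Pi.sub_apply, hD, hD1, hγ, smoothRing.theta_apply]
    linear_combination scale η i * scale η j * h
      - scale η i * scale η j * (conn g e i j 0 x - conn g e j i 0 x) * dirC (e 0) f x * hs 0
      - scale η i * scale η j * (conn g e i j 1 x - conn g e j i 1 x) * dirC (e 1) f x * hs 1
      - scale η i * scale η j * (conn g e i j 2 x - conn g e j i 2 x) * dirC (e 2) f x * hs 2
      - scale η i * scale η j * (conn g e i j 3 x - conn g e j i 3 x) * dirC (e 3) f x * hs 3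
  · have hD1 : ∀ i f, (D i f : M → ℂ) x = 0 := fun i f =>
      frameDeriv_of_notMem hg hU he _ _ _ hx
    simp only [Fin.sum_univ_four]
    push_cast
    simp only [Pi.add_apply, Pi.mul_apply, Pi.sub_apply, hD1]
    ring

lemma neutralDeriv_conn (hg : IsPseudoRiemannian g) (hU : IsOpen U) (he : IsFrame g η U e)
    (i j k l : Fin 4) (hx : x ∈ U) :
    (neutralDeriv hg hU he i (neutralConn hg hU he j k l) : M → ℂ) x =
      scale η i * scale η j * scale η k * scale η l * (dirR (e i) (conn g e j k l) x : ℂ) := by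
  have hd : MDifferentiableAt (𝓡 4) 𝓘(ℝ, ℝ) (conn g e j k l) x :=
    ((he.smooth_conn hg hU j k l).contMDiffAt (hU.mem_nhds hx)).mdifferentiableAt (by simp)
  have hd' := ((he.smooth_conn_ofReal hg hU j k l).contMDiffAt (hU.mem_nhds hx)).mdifferentiableAt
    (by simp)
  rw [neutralDeriv, neutralConn, frameDeriv_smoothElt hg hU he _ _ _ hx,
    dirC_mul mdifferentiableAt_const hd', dirC_const, dirC_ofReal hd]
  ring

/-- Provides the hypothesis `hJ` of the algebraic identities. Every term carries the weight of the
four free indices, and in the contracted terms `theta m` absorbs the extra square of `scale η m`. -/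
lemma neutralConn_jacobi (hg : IsPseudoRiemannian g) (hU : IsOpen U) (he : IsFrame g η U e)
    (i j k l : Fin 4) :
    let D := neutralDeriv hg hU he
    let γ := neutralConn hg hU he
    D i (γ j k l - γ k j l) + D j (γ k i l - γ i k l) + D k (γ i j l - γ j i l)
      + ∑ m, theta m * ((γ j k m - γ k j m) * (γ i m l - γ m i l)
        + (γ k i m - γ i k m) * (γ j m l - γ m j l)
        + (γ i j m - γ j i m) * (γ k m l - γ m k l)) = 0 := by
  intro D γ
  refine smoothRing.ext (fun x hx => ?_) (fun x hx => ?_)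
  · have h := congrArg (fun r : ℝ => (r : ℂ)) (he.jacobi hg hU hx i j k l)
    have hd : ∀ i j k, MDifferentiableAt (𝓡 4) 𝓘(ℝ, ℝ) (conn g e i j k) x := fun i j k =>
      ((he.smooth_conn hg hU i j k).contMDiffAt (hU.mem_nhds hx)).mdifferentiableAt (by simp)
    have hsub : ∀ i j k l, dirR (e i) (fun y => conn g e j k l y - conn g e k j l y) x =
        dirR (e i) (conn g e j k l) x - dirR (e i) (conn g e k j l) x := by
      intro i j k l
      change mvfderiv (𝓡 4) (conn g e j k l - conn g e k j l) x (e i x) = _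
      rw [mvfderiv_sub (hd j k l) (hd k j l)]
      rfl
    have hγ : ∀ i j k, (γ i j k : M → ℂ) x = scale η i * scale η j * scale η k * conn g e i j k x :=
      fun i j k => neutralConn_of_mem hg hU he i j k hx
    have hD : ∀ i j k l, (D i (γ j k l) : M → ℂ) x = scale η i * scale η j * scale η k * scale η l
        * (dirR (e i) (conn g e j k l) x : ℂ) := fun i j k l =>
      neutralDeriv_conn hg hU he i j k l hx
    have hs := theta_mul_scale_sq he.sign
    simp only [Fin.sum_univ_four, hsub] at h
    simp only [Fin.sum_univ_four, map_sub]
    push_cast at h ⊢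
    simp only [Pi.add_apply, Pi.mul_apply, Pi.sub_apply, Pi.zero_apply, hD, hγ,
      smoothRing.theta_apply]
    let s := scale η i * scale η j * scale η k * scale η l
    let q (m : Fin 4) : ℂ := (conn g e j k m x - conn g e k j m x) * (conn g e i m l x - conn g e m i l x)
        + (conn g e k i m x - conn g e i k m x) * (conn g e j m l x - conn g e m j l x)
        + (conn g e i j m x - conn g e j i m x) * (conn g e k m l x - conn g e m k l x)
    linear_combination s * h + s * q 0 * hs 0 + s * q 1 * hs 1 + s * q 2 * hs 2 + s * q 3 * hs 3
  · have hD1 : ∀ i f, (D i f : M → ℂ) x = 0 := fun i f =>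
      frameDeriv_of_notMem hg hU he _ _ _ hx
    have hγ : ∀ i j k, (γ i j k : M → ℂ) x = 0 := fun i j k => smoothElt_of_notMem _ hx
    simp only [Fin.sum_univ_four]
    push_cast
    simp only [Pi.add_apply, Pi.mul_apply, Pi.sub_apply, Pi.zero_apply, hD1, hγ]
    ring

end SmoothRing

/-! ### Solving the charged twistor equation at a point. -/

section Charge

/-- The charge `c_{A'}` with `n_{(A'B')} = c_{(A'} α_{B')}`, when it exists. -/
def charge (n : Fin 2 → Fin 2 → ℂ) (α : Fin 2 → ℂ) (A : Fin 2) : ℂ :=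
  let a := (starRingEnd ℂ) (α 0)
  let b := (starRingEnd ℂ) (α 1)
  let N := (α 0 * a + α 1 * b)⁻¹
  (((n A 0 + n 0 A) * a + (n A 1 + n 1 A) * b)
    - (n 0 0 * (a * a) + (n 0 1 + n 1 0) * (a * b) + n 1 1 * (b * b)) * (N * α A)) * N

lemma spinor_norm_ne_zero {α : Fin 2 → ℂ} (hα : ∃ A, α A ≠ 0) :
    α 0 * (starRingEnd ℂ) (α 0) + α 1 * (starRingEnd ℂ) (α 1) ≠ 0 := by
  rw [Complex.mul_conj, Complex.mul_conj, ← Complex.ofReal_add]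
  intro h
  have h' : Complex.normSq (α 0) + Complex.normSq (α 1) = 0 := by exact_mod_cast h
  have h0 := Complex.normSq_nonneg (α 0)
  have h1 := Complex.normSq_nonneg (α 1)
  obtain ⟨A, hA⟩ := hα
  apply hA
  fin_cases A
  · change α 0 = 0
    exact Complex.normSq_eq_zero.1 (by linarith)
  · change α 1 = 0
    exact Complex.normSq_eq_zero.1 (by linarith)

/-- The formula for `charge` is forced. Contracting `n_{AB} + n_{BA} = c_A α_B + c_B α_A` with the
conjugate components of `α` once gives `c_A |α|² + (c·ᾱ) α_A`; contracting twice gives `c·ᾱ` itself.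
The only obstruction to the converse is the component of `n` along `α^A α^B`, which is `hn`. The
norm is merely auxiliary, a denominator that is smooth and never zero, and has nothing to do with
the signature of the metric. -/
lemma charge_spec {n : Fin 2 → Fin 2 → ℂ} {α : Fin 2 → ℂ} (hα : ∃ A, α A ≠ 0)
    (hn : α 1 * α 1 * n 0 0 - α 0 * α 1 * (n 0 1 + n 1 0) + α 0 * α 0 * n 1 1 = 0)
    (A B : Fin 2) : n A B + n B A = charge n α A * α B + charge n α B * α A := by
  have hN := spinor_norm_ne_zero hα
  simp only [charge]
  generalize (starRingEnd ℂ) (α 0) = a at *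
  generalize (starRingEnd ℂ) (α 1) = b at *
  obtain ⟨D, hD⟩ : ∃ D, D = α 0 * a + α 1 * b := ⟨_, rfl⟩
  rw [← hD] at hN ⊢
  fin_cases A <;> fin_cases B <;> simp only [Fin.zero_eta, Fin.mk_one] <;> field_simp <;> rw [hD]
  · linear_combination b * b * hn
  · linear_combination -2 * a * b * hn
  · linear_combination -2 * a * b * hn
  · linear_combination a * a * hn

/-- A product of two linear forms vanishes only if one factor does. This is the uniqueness of the
charge. -/
lemma eq_zero_of_symmetric_mul_spinor {d α : Fin 2 → ℂ} (hα : ∃ A, α A ≠ 0)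
    (h : ∀ A B, d A * α B + d B * α A = 0) (A : Fin 2) : d A = 0 := by
  have h0 := h 0 0
  have h1 := h 0 1
  have h2 := h 1 1
  by_cases a0 : α 0 = 0
  · have a1 : α 1 ≠ 0 := by
      obtain ⟨B, hB⟩ := hα
      fin_cases B
      exacts [absurd a0 hB, hB]
    fin_cases A
    · have : d 0 * α 1 = 0 := by linear_combination h1 - d 1 * a0
      simpa [a1] using this
    · have : d 1 * α 1 = 0 := by linear_combination (1 / 2) * h2
      simpa [a1] using this
  · have d0 : d 0 = 0 := by
      have : d 0 * α 0 = 0 := by linear_combination (1 / 2) * h0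
      simpa [a0] using this
    fin_cases A
    · exact d0
    · have : d 1 * α 0 = 0 := by linear_combination h1 - α 1 * d0
      simpa [a0] using this

/-- The vector with given spinor components. -/
def ofSpinor (η : Fin 4 → ℝ) (c : Fin 2 → Fin 2 → ℂ) (i : Fin 4) : ℂ :=
  (1 / 2) * (scale η i)⁻¹ * (rho i 0 0 * c 0 0 + rho i 0 1 * c 0 1 + rho i 1 0 * c 1 0
    + rho i 1 1 * c 1 1)

/-- The four matrices `rho i` are orthogonal of squared length 2 for the entrywise product, which
explains the factor `1 / 2` in `ofSpinor`. -/
lemma sum_solder_ofSpinor (η : Fin 4 → ℝ) (c : Fin 2 → Fin 2 → ℂ) (A A' : Fin 2) :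
    ∑ i, solder η i A A' * ofSpinor η c i = c A A' := by
  have h : ∀ i, solder η i A A' * ofSpinor η c i = (1 / 2) * (rho i A A' *
      (rho i 0 0 * c 0 0 + rho i 0 1 * c 0 1 + rho i 1 0 * c 1 0 + rho i 1 1 * c 1 1)) := by
    intro i
    have := scale_ne_zero η i
    rw [solder_eq, ofSpinor]
    field_simp
  simp only [h, Fin.sum_univ_four]
  fin_cases A <;> fin_cases A' <;> simp [rho] <;> ring

lemma eq_zero_of_sum_solder {η : Fin 4 → ℝ} {a : Fin 4 → ℂ}
    (h : ∀ A A', ∑ i, solder η i A A' * a i = 0) (i : Fin 4) : a i = 0 := by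
  have h00 := h 0 0
  have h01 := h 0 1
  have h10 := h 1 0
  have h11 := h 1 1
  simp only [solder_eq, Fin.sum_univ_four] at h00 h01 h10 h11
  simp [rho] at h00 h01 h10 h11
  suffices scale η i * a i = 0 from (mul_eq_zero.1 this).resolve_left (scale_ne_zero η i)
  fin_cases i
  · change scale η 0 * a 0 = 0
    linear_combination (1 / 2) * (h00 + h11)
  · change scale η 1 * a 1 = 0
    linear_combination (1 / 2) * (h01 + h10)
  · change scale η 2 * a 2 = 0
    linear_combination (1 / 2) * (h01 - h10)
  · change scale η 3 * a 3 = 0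
    linear_combination (1 / 2) * (h00 - h11)

end Charge

/-! ### The connection 1-form of a shear-free spinor. -/

section Connection

variable {M : Type*} [TopologicalSpace M] [ChartedSpace E4 M]
  {U : Set M} {g : BilinField M} {η : Fin 4 → ℝ} {e : Fin 4 → VField M} {x : M}
  {α : SpinorField M} {𝒜 : CForm M}

lemma contMDiffOn_inv {f : M → ℂ} (hf : ContMDiffOn (𝓡 4) 𝓘(ℝ, ℂ) ∞ f U)
    (h0 : ∀ x ∈ U, f x ≠ 0) : ContMDiffOn (𝓡 4) 𝓘(ℝ, ℂ) ∞ (fun x => (f x)⁻¹) U := fun x hx =>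
  (contDiffAt_inv ℝ (h0 x hx)).contMDiffAt.comp_contMDiffWithinAt x (hf x hx)

lemma contMDiffOn_conj {f : M → ℂ} (hf : ContMDiffOn (𝓡 4) 𝓘(ℝ, ℂ) ∞ f U) :
    ContMDiffOn (𝓡 4) 𝓘(ℝ, ℂ) ∞ (fun x => (starRingEnd ℂ) (f x)) U :=
  (Complex.conjCLE : ℂ →L[ℝ] ℂ).contMDiff.comp_contMDiffOn hf

lemma contMDiffOn_charge {n : Fin 2 → Fin 2 → M → ℂ} (hα : SmoothSpinorOn α U)
    (hn : ∀ A B, ContMDiffOn (𝓡 4) 𝓘(ℝ, ℂ) ∞ (n A B) U) (h0 : ∀ x ∈ U, ∃ A', α A' x ≠ 0)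
    (A : Fin 2) : ContMDiffOn (𝓡 4) 𝓘(ℝ, ℂ) ∞
      (fun x => charge (fun A B => n A B x) (fun A => α A x) A) U := by
  have a := contMDiffOn_conj (hα 0)
  have b := contMDiffOn_conj (hα 1)
  have N := contMDiffOn_inv ((contMDiffOn_mul (hα 0) a).add (contMDiffOn_mul (hα 1) b))
    fun x hx => spinor_norm_ne_zero (h0 x hx)
  exact contMDiffOn_mul (((contMDiffOn_mul ((hn A 0).add (hn 0 A)) a).add
    (contMDiffOn_mul ((hn A 1).add (hn 1 A)) b)).sub
    (contMDiffOn_mul (((contMDiffOn_mul (hn 0 0) (contMDiffOn_mul a a)).add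
      (contMDiffOn_mul ((hn 0 1).add (hn 1 0)) (contMDiffOn_mul a b))).add
      (contMDiffOn_mul (hn 1 1) (contMDiffOn_mul b b))) (contMDiffOn_mul N (hα A)))) N

variable [IsManifold (𝓡 4) ∞ M]

/-- The components of a smooth spinor, as elements of the ring of smooth functions. -/
def spinorElt (hα : SmoothSpinorOn α U) (A : Fin 2) : smoothRing U := smoothElt (hα A)

/-- The covariant derivative of a smooth spinor along the neutral frame. -/
def neutralNabla (hg : IsPseudoRiemannian g) (hU : IsOpen U) (he : IsFrame g η U e)
    (hα : SmoothSpinorOn α U) (i : Fin 4) (A : Fin 2) : smoothRing U :=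
  frameNabla (neutralDeriv hg hU he) (neutralConn hg hU he) (spinorElt hα) i A

/-- Identifies the algebraic spinor derivative with the geometric one, up to the weight of the
direction `i`. -/
lemma neutralNabla_of_mem (hg : IsPseudoRiemannian g) (hU : IsOpen U) (he : IsFrame g η U e)
    (hα : SmoothSpinorOn α U) (i : Fin 4) (A : Fin 2) (hx : x ∈ U) :
    (neutralNabla hg hU he hα i A : M → ℂ) x = scale η i * nablaSpinor g η e α i A x := by
  have hγ : ∀ j k, (conn g e i k j x : ℂ) = -(conn g e i j k x : ℂ) := fun j k => by
    rw [conn_antisymm]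
    push_cast
    ring
  have hG : ∀ A B, ((sdPart (neutralConn hg hU he i) A B : smoothRing U) : M → ℂ) x =
      scale η i * primedPart η (fun j k => (conn g e i j k x : ℂ)) A B := by
    intro A B
    rw [smoothRing.sdPart_apply, primedPart_eq_sdPart η hγ]
    simp only [neutralConn_of_mem hg hU he _ _ _ hx]
    fin_cases A <;> fin_cases B <;> simp [sdPart] <;> ring
  have hD : ∀ A, (neutralDeriv hg hU he i (spinorElt hα A) : M → ℂ) x =
      scale η i * dirC (e i) (α A) x := fun A => frameDeriv_smoothElt hg hU he _ _ (hα A) hx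
  have hα' : ∀ A, (spinorElt hα A : M → ℂ) x = α A x := fun A => smoothElt_of_mem (hα A) hx
  have hs := primedPart_symm η hγ 0 1
  fin_cases A <;> simp [neutralNabla, frameNabla, nablaSpinor, hG, hD, hα', eps, hs] <;> ring

/-- The components `∇_{AA'} α_{B'}`, as elements of the ring of smooth functions. -/
lemma nablaS_of_mem (hg : IsPseudoRiemannian g) (hU : IsOpen U) (he : IsFrame g η U e)
    (hα : SmoothSpinorOn α U) (A A' B' : Fin 2) (hx : x ∈ U) :
    nablaS g η e α A A' B' x =
      ∑ i, rho i A A' * (neutralNabla hg hU he hα i B' : M → ℂ) x := by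
  simp only [nablaS, neutralNabla_of_mem hg hU he hα _ _ hx, solder_eq]
  exact Finset.sum_congr rfl fun i _ => by ring

lemma smooth_nablaS (hg : IsPseudoRiemannian g) (hU : IsOpen U) (he : IsFrame g η U e)
    (hα : SmoothSpinorOn α U) (A A' B' : Fin 2) :
    ContMDiffOn (𝓡 4) 𝓘(ℝ, ℂ) ∞ (nablaS g η e α A A' B') U := by
  have h : ∀ i, ContMDiffOn (𝓡 4) 𝓘(ℝ, ℂ) ∞
      (fun x => rho i A A' * (neutralNabla hg hU he hα i B' : M → ℂ) x) U := fun i =>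
    contMDiffOn_mul contMDiffOn_const (neutralNabla hg hU he hα i B').2
  refine ((((h 0).add (h 1)).add (h 2)).add (h 3)).congr fun x hx => ?_
  rw [nablaS_of_mem hg hU he hα _ _ _ hx, Fin.sum_univ_four]
  rfl

omit [IsManifold (𝓡 4) ∞ M] in
-- With `α^{0'} = α_{1'}` and `α^{1'} = -α_{0'}`, the shear takes the form of the hypothesis `hn` of
-- `charge_spec`.
lemma isShearFree_iff : IsShearFree g η U e α ↔ ∀ x ∈ U, ∀ A,
    α 1 x * α 1 x * nablaS g η e α A 0 0 x
      - α 0 x * α 1 x * (nablaS g η e α A 0 1 x + nablaS g η e α A 1 0 x)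
      + α 0 x * α 0 x * nablaS g η e α A 1 1 x = 0 := by
  refine forall₂_congr fun x _ => forall_congr' fun A => ?_
  simp only [raise, eps, Fin.sum_univ_two]
  simp
  constructor <;> intro h <;> linear_combination h

/-- The 1-form with given components in a frame. -/
def formOfFrame (g : BilinField M) (η : Fin 4 → ℝ) (e : Fin 4 → VField M) (a : Fin 4 → M → ℂ) :
    CForm M :=
  fun x => ∑ m, (η m • g x (e m x)).smulRight (a m x)

lemma formOfFrame_apply (he : IsFrame g η U e) (a : Fin 4 → M → ℂ) (hx : x ∈ U) (i : Fin 4) :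
    formOfFrame g η e a x (e i x) = a i x := by
  have h := he.sign_mul_self i
  have h' : ((η i : ℝ) : ℂ) * ((η i : ℝ) : ℂ) = 1 := by exact_mod_cast h
  simp only [formOfFrame, Fin.sum_univ_four]
  fin_cases i <;> simp [he.orthonormal x hx] <;> simp at h' <;> linear_combination a _ x * h'

lemma CForm.ext_frame (hg : IsPseudoRiemannian g) (he : IsFrame g η U e) (hx : x ∈ U)
    {𝒜 ℬ : CForm M} (h : ∀ i, 𝒜 x (e i x) = ℬ x (e i x)) : 𝒜 x = ℬ x := by
  ext v
  rw [he.expand hg hx v]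
  simp only [map_sum, map_smul, h]

/-- The charged twistor equation of a nowhere vanishing spinor has at most one solution. -/
lemma IsChargedTwistor.unique (hg : IsPseudoRiemannian g) (he : IsFrame g η U e)
    (h0 : ∀ x ∈ U, ∃ A', α A' x ≠ 0) {𝒜 ℬ : CForm M} (h1 : IsChargedTwistor g η U e α 𝒜)
    (h2 : IsChargedTwistor g η U e α ℬ) (hx : x ∈ U) : ℬ x = 𝒜 x := by
  refine CForm.ext_frame hg he hx fun i => sub_eq_zero.1 ?_
  refine eq_zero_of_sum_solder (η := η) (a := fun i => ℬ x (e i x) - 𝒜 x (e i x))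
    (fun A A' => ?_) i
  have hd : ∀ A', formS η e ℬ A A' x - formS η e 𝒜 A A' x = 0 :=
    eq_zero_of_symmetric_mul_spinor (h0 x hx) fun A' B' => by
      linear_combination 2 * h1 x hx A A' B' - 2 * h2 x hx A A' B'
  rw [← hd A', formS, formS, ← Finset.sum_sub_distrib]
  exact Finset.sum_congr rfl fun i _ => by ring

omit [IsManifold (𝓡 4) ∞ M] in
lemma contMDiffOn_ofSpinor {c : Fin 2 → Fin 2 → M → ℂ}
    (hc : ∀ A A', ContMDiffOn (𝓡 4) 𝓘(ℝ, ℂ) ∞ (c A A') U) (i : Fin 4) :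
    ContMDiffOn (𝓡 4) 𝓘(ℝ, ℂ) ∞ (fun x => ofSpinor η (fun A A' => c A A' x) i) U := by
  have h : ∀ (r : ℂ) A A', ContMDiffOn (𝓡 4) 𝓘(ℝ, ℂ) ∞ (fun x => r * c A A' x) U := fun r A A' =>
    contMDiffOn_mul contMDiffOn_const (hc A A')
  exact contMDiffOn_mul contMDiffOn_const ((((h _ 0 0).add (h _ 0 1)).add (h _ 1 0)).add (h _ 1 1))

/-- Reduces the construction of `𝒜` to finding smooth spinor components `c` of the charge, because a
1-form is determined by its values on the frame. -/
lemma isTwistorConnection_formOfFrame (hg : IsPseudoRiemannian g) (he : IsFrame g η U e)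
    (h0 : ∀ x ∈ U, ∃ A', α A' x ≠ 0) {c : Fin 2 → Fin 2 → M → ℂ}
    (hc : ∀ A A', ContMDiffOn (𝓡 4) 𝓘(ℝ, ℂ) ∞ (c A A') U)
    (hs : ∀ x ∈ U, ∀ A A' B', nablaS g η e α A A' B' x + nablaS g η e α A B' A' x =
      c A A' x * α B' x + c A B' x * α A' x) :
    IsTwistorConnection g η U e α
      (formOfFrame g η e fun i x => ofSpinor η (fun A A' => c A A' x) i) := by
  have htw : IsChargedTwistor g η U e α
      (formOfFrame g η e fun i x => ofSpinor η (fun A A' => c A A' x) i) := by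
    intro x hx A A' B'
    have hf : ∀ A', formS η e (formOfFrame g η e
        fun i x => ofSpinor η (fun A A' => c A A' x) i) A A' x = c A A' x := by
      intro A'
      rw [formS, ← sum_solder_ofSpinor η (fun A A' => c A A' x) A A']
      exact Finset.sum_congr rfl fun i _ => by rw [formOfFrame_apply he _ hx]
    rw [hf, hf, hs x hx]
  exact ⟨fun i => (contMDiffOn_ofSpinor hc i).congr fun x hx => formOfFrame_apply he _ hx i, htw,
    fun ℬ hℬ x hx => htw.unique hg he h0 hℬ hx⟩

/-- A nowhere vanishing shear-free spinor is a charged twistor for a unique 1-form. -/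
theorem exists_twistorConnection (hg : IsPseudoRiemannian g) (hU : IsOpen U)
    (he : IsFrame g η U e) (hα : SmoothSpinorOn α U) (h0 : ∀ x ∈ U, ∃ A', α A' x ≠ 0)
    (hs : IsShearFree g η U e α) : ∃ 𝒜 : CForm M, IsTwistorConnection g η U e α 𝒜 := by
  obtain ⟨c, hc, hcs⟩ : ∃ c : Fin 2 → Fin 2 → M → ℂ,
      (∀ A A', ContMDiffOn (𝓡 4) 𝓘(ℝ, ℂ) ∞ (c A A') U) ∧
      ∀ x ∈ U, ∀ A A' B', nablaS g η e α A A' B' x + nablaS g η e α A B' A' x =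
        c A A' x * α B' x + c A B' x * α A' x := by
    refine ⟨fun A A' x => charge (fun A' B' => nablaS g η e α A A' B' x) (fun A => α A x) A',
      fun A A' => ?_, fun x hx A A' B' => ?_⟩
    · exact contMDiffOn_charge (n := fun A' B' => nablaS g η e α A A' B') hα
        (fun A' B' => smooth_nablaS hg hU he hα A A' B') h0 A'
    · exact charge_spec (n := fun A' B' => nablaS g η e α A A' B' x) (α := fun A => α A x)
        (h0 x hx) (isShearFree_iff.1 hs x hx A) A' B'
  exact ⟨_, isTwistorConnection_formOfFrame hg he h0 hc hcs⟩

end Connection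

/-! ### Curvature of a charged twistor. -/

section Curvature

variable {M : Type*} [TopologicalSpace M] [ChartedSpace E4 M] [IsManifold (𝓡 4) ∞ M]
  {U : Set M} {g : BilinField M} {η : Fin 4 → ℝ} {e : Fin 4 → VField M} {x : M}
  {α : SpinorField M} {𝒜 : CForm M}

lemma neutralRiem_of_mem (hg : IsPseudoRiemannian g) (hU : IsOpen U) (he : IsFrame g η U e)
    (i j k l : Fin 4) (hx : x ∈ U) :
    ((frameRiem (neutralDeriv hg hU he) (neutralConn hg hU he) i j k l : smoothRing U) :
      M → ℂ) x =
      scale η i * scale η j * scale η k * scale η l * (riem g η e i j k l x : ℂ) := by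
  have hs := theta_mul_scale_sq he.sign
  simp only [frameRiem, riem, ← conn_torsion, Fin.sum_univ_four]
  push_cast
  simp only [Pi.add_apply, Pi.mul_apply, Pi.sub_apply, neutralDeriv_conn hg hU he _ _ _ _ hx,
    neutralConn_of_mem hg hU he _ _ _ hx, smoothRing.theta_apply]
  let s := scale η i * scale η j * scale η k * scale η l
  let q (m : Fin 4) : ℂ := conn g e j k m x * conn g e i m l x - conn g e i k m x * conn g e j m l x
    - (conn g e i j m x - conn g e j i m x) * conn g e m k l x
  linear_combination s * q 0 * hs 0 + s * q 1 * hs 1 + s * q 2 * hs 2 + s * q 3 * hs 3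

omit [IsManifold (𝓡 4) ∞ M] in
lemma riem_antisymm_left (g : BilinField M) (η : Fin 4 → ℝ) (e : Fin 4 → VField M)
    (i j k l : Fin 4) (x : M) : riem g η e j i k l x = -riem g η e i j k l x := by
  simp only [riem, ← conn_torsion, Fin.sum_univ_four]
  ring

lemma riem_antisymm_right (hg : IsPseudoRiemannian g) (hU : IsOpen U) (he : IsFrame g η U e)
    (i j k l : Fin 4) (hx : x ∈ U) : riem g η e i j l k x = -riem g η e i j k l x := by
  have hd : ∀ i j k l, dirR (e i) (conn g e j l k) x = -dirR (e i) (conn g e j k l) x := by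
    intro i j k l
    rw [dirR_congr (h := fun y => -1 * conn g e j k l y) hU hx fun y _ => by
      rw [conn_antisymm]; ring, dirR_mul mdifferentiableAt_const
      (((he.smooth_conn hg hU j k l).contMDiffAt (hU.mem_nhds hx)).mdifferentiableAt (by simp)),
      dirR_const]
    ring
  simp only [riem, Fin.sum_univ_four, hd _ _ k l, conn_antisymm g e _ k l]
  simp only [conn_antisymm g e _ k]
  simp only [conn_antisymm g e _ _ l]
  ring

/-- Allows the curvature spinor of the metric to be replaced by its counterpart over the ring, whose
symmetries are already known. -/
lemma curvSpinor_eq (hg : IsPseudoRiemannian g) (hU : IsOpen U) (he : IsFrame g η U e)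
    (A B C E : Fin 2) (hx : x ∈ U) : curvSpinor g η e x ![A, B, C, E] =
      ((sdPart (fun i j => sdPart (frameRiem (neutralDeriv hg hU he) (neutralConn hg hU he) i j)
        C E) A B : smoothRing U) : M → ℂ) x := by
  have h1 : ∀ i j k l, (riem g η e i j l k x : ℂ) = -(riem g η e i j k l x : ℂ) :=
    fun i j k l => by rw [riem_antisymm_right hg hU he i j k l hx]; push_cast; ring
  have h2 : ∀ i j, primedPart η (fun k l => (riem g η e j i k l x : ℂ)) C E =
      -primedPart η (fun k l => (riem g η e i j k l x : ℂ)) C E := by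
    intro i j
    rw [primedPart_eq_sdPart η (h1 j i), primedPart_eq_sdPart η (h1 i j)]
    simp only [riem_antisymm_left g η e i j]
    fin_cases C <;> fin_cases E <;> simp [sdPart] <;> ring
  change primedPart η (fun i j => primedPart η (fun k l => (riem g η e i j k l x : ℂ)) C E) A B = _
  rw [primedPart_eq_sdPart η h2, smoothRing.sdPart_apply]
  congr 1
  ext i j
  rw [primedPart_eq_sdPart η (h1 i j), smoothRing.sdPart_apply]
  simp only [neutralRiem_of_mem hg hU he _ _ _ _ hx]
  fin_cases C <;> fin_cases E <;> simp [sdPart] <;> ring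

lemma curvSpinor_symm (hg : IsPseudoRiemannian g) (hU : IsOpen U) (he : IsFrame g η U e)
    (hx : x ∈ U) :
    (∀ A B C E, curvSpinor g η e x ![A, B, C, E] = curvSpinor g η e x ![B, A, C, E]) ∧
    (∀ A B C E, curvSpinor g η e x ![A, B, C, E] = curvSpinor g η e x ![A, B, E, C]) ∧
    ∀ A B C E, curvSpinor g η e x ![A, B, C, E] = curvSpinor g η e x ![C, E, A, B] := by
  have hs : ∀ (T : Fin 4 → Fin 4 → smoothRing U) A B, sdPart T A B = sdPart T B A := by
    intro T A B
    fin_cases A <;> fin_cases B <;> simp [sdPart]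
  refine ⟨fun A B C E => ?_, fun A B C E => ?_, fun A B C E => ?_⟩
  · rw [curvSpinor_eq hg hU he _ _ _ _ hx, curvSpinor_eq hg hU he _ _ _ _ hx, hs]
  · rw [curvSpinor_eq hg hU he _ _ _ _ hx, curvSpinor_eq hg hU he _ _ _ _ hx]
    simp only [hs _ C E]
  · have h := congrArg (fun f : smoothRing U => (f : M → ℂ) x)
      (sdPart_frameRiem_pair (neutralConn_antisymm hg hU he) (neutralConn_jacobi hg hU he) A B C E)
    rw [curvSpinor_eq hg hU he _ _ _ _ hx, curvSpinor_eq hg hU he _ _ _ _ hx]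
    have h2 : ∀ f : smoothRing U, ((2 * f : smoothRing U) : M → ℂ) x = 2 * (f : M → ℂ) x :=
      fun f => rfl
    simp only [h2] at h
    exact mul_left_cancel₀ two_ne_zero h

omit [IsManifold (𝓡 4) ∞ M] in
lemma curv_antisymm (e : Fin 4 → VField M) (𝒜 : CForm M) (i j : Fin 4) (x : M) :
    curv e 𝒜 x j i = -curv e 𝒜 x i j := by
  simp only [curv]
  rw [bracket_swap (e j) (e i), map_neg]
  ring

lemma apply_bracket (hg : IsPseudoRiemannian g) (he : IsFrame g η U e) (hx : x ∈ U)
    (𝒜 : CForm M) (i j : Fin 4) : 𝒜 x (bracket (e i) (e j) x) =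
      ∑ m, (η m : ℂ) * (conn g e i j m x - conn g e j i m x) * 𝒜 x (e m x) := by
  rw [he.bracket_expand hg hx]
  simp only [map_sum, map_smul, Complex.real_smul]
  push_cast
  rfl

/-- The Levi-Civita connection has no torsion, so the skew part of `∇𝒜` is `d𝒜`. -/
lemma nablaForm_sub (hg : IsPseudoRiemannian g) (he : IsFrame g η U e) (hx : x ∈ U)
    (𝒜 : CForm M) (i j : Fin 4) :
    nablaForm g η e 𝒜 i j x - nablaForm g η e 𝒜 j i x = curv e 𝒜 x i j := by
  simp only [nablaForm, curv, apply_bracket hg he hx, Fin.sum_univ_four]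
  push_cast
  ring

/-- The components of a 1-form along the neutral frame. -/
def neutralForm (η : Fin 4 → ℝ)
    (h𝒜 : ∀ i, ContMDiffOn (𝓡 4) 𝓘(ℝ, ℂ) ∞ (fun x => 𝒜 x (e i x)) U) (i : Fin 4) :
    smoothRing U :=
  smoothElt (contMDiffOn_mul (contMDiffOn_const (c := scale η i)) (h𝒜 i))

omit [IsManifold (𝓡 4) ∞ M] in
lemma neutralForm_of_mem
    (h𝒜 : ∀ i, ContMDiffOn (𝓡 4) 𝓘(ℝ, ℂ) ∞ (fun x => 𝒜 x (e i x)) U) (i : Fin 4) (hx : x ∈ U) :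
    (neutralForm η h𝒜 i : M → ℂ) x = scale η i * 𝒜 x (e i x) :=
  smoothElt_of_mem (contMDiffOn_mul (contMDiffOn_const (c := scale η i)) (h𝒜 i)) hx

lemma neutralCurv_of_mem (hg : IsPseudoRiemannian g) (hU : IsOpen U) (he : IsFrame g η U e)
    (h𝒜 : ∀ i, ContMDiffOn (𝓡 4) 𝓘(ℝ, ℂ) ∞ (fun x => 𝒜 x (e i x)) U) (i j : Fin 4) (hx : x ∈ U) :
    ((frameCurv (neutralDeriv hg hU he) (neutralConn hg hU he) (neutralForm η h𝒜) i j :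
      smoothRing U) : M → ℂ) x =
      scale η i * scale η j * curv e 𝒜 x i j := by
  have hs := theta_mul_scale_sq he.sign
  have hD : ∀ i j, (neutralDeriv hg hU he i (neutralForm η h𝒜 j) : M → ℂ) x =
      scale η i * scale η j * dirC (e i) (fun y => 𝒜 y (e j y)) x := by
    intro i j
    rw [neutralDeriv, neutralForm, frameDeriv_smoothElt hg hU he _ _ _ hx,
      dirC_mul mdifferentiableAt_const
        (((h𝒜 j).contMDiffAt (hU.mem_nhds hx)).mdifferentiableAt (by simp)), dirC_const]
    ring
  simp only [frameCurv, curv, apply_bracket hg he hx, Fin.sum_univ_four]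
  push_cast
  simp only [Pi.add_apply, Pi.mul_apply, Pi.sub_apply, hD,
    neutralConn_of_mem hg hU he _ _ _ hx, smoothRing.theta_apply, neutralForm_of_mem h𝒜 _ hx]
  let q (m : Fin 4) : ℂ := -(scale η i * scale η j) *
    (conn g e i j m x - conn g e j i m x) * 𝒜 x (e m x)
  linear_combination q 0 * hs 0 + q 1 * hs 1 + q 2 * hs 2 + q 3 * hs 3

lemma neutralNabla_of_notMem (hg : IsPseudoRiemannian g) (hU : IsOpen U) (he : IsFrame g η U e)
    (hα : SmoothSpinorOn α U) (i : Fin 4) (A : Fin 2) (hx : x ∉ U) :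
    (neutralNabla hg hU he hα i A : M → ℂ) x = 0 := by
  have hα' : ∀ A, (spinorElt hα A : M → ℂ) x = 0 := fun A => smoothElt_of_notMem (hα A) hx
  have hD : ∀ A, (neutralDeriv hg hU he i (spinorElt hα A) : M → ℂ) x = 0 := fun A =>
    frameDeriv_of_notMem hg hU he _ _ _ hx
  fin_cases A <;> simp [neutralNabla, frameNabla, hα', hD]

/-- The primed part of the curvature of a charged twistor that is annihilated by the Weyl spinor
vanishes. -/
theorem primedPart_curv_eq_zero (hg : IsPseudoRiemannian g) (hU : IsOpen U)
    (he : IsFrame g η U e) (hα : SmoothSpinorOn α U) (h0 : ∀ x ∈ U, ∃ A', α A' x ≠ 0)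
    (h𝒜 : ∀ i, ContMDiffOn (𝓡 4) 𝓘(ℝ, ℂ) ∞ (fun x => 𝒜 x (e i x)) U)
    (htw : IsChargedTwistor g η U e α 𝒜) (hx : x ∈ U)
    (hW : ∀ A' B' C', ∑ D', weylSD g η e A' B' C' D' x * raise α D' x = 0) (A B : Fin 2) :
    primedPart η (curv e 𝒜 x) A B = 0 := by
  -- `P` is the charged derivative `(∇ - 𝒜) α` along the neutral frame.
  obtain ⟨P, hP⟩ : ∃ P : Fin 4 → Fin 2 → smoothRing U, ∀ i A, P i A =
      neutralNabla hg hU he hα i A - neutralForm η h𝒜 i * spinorElt hα A := ⟨_, fun _ _ => rfl⟩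
  have hP0 : ∀ y ∉ U, ∀ i A, (P i A : M → ℂ) y = 0 := by
    intro y hy i A
    have hα' : (spinorElt hα A : M → ℂ) y = 0 := smoothElt_of_notMem (hα A) hy
    rw [hP]
    push_cast
    rw [Pi.sub_apply, Pi.mul_apply, hα', neutralNabla_of_notMem hg hU he hα i A hy]
    ring
  -- The charged twistor equation, as `P_{A(A'B')} = 0`.
  have hPE : ∀ y ∈ U, ∀ A A' B', (∑ i, rho i A A' * (P i B' : M → ℂ) y) +
      ∑ i, rho i A B' * (P i A' : M → ℂ) y = 0 := by
    intro y hy A A' B'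
    have hα' : ∀ A, (spinorElt hα A : M → ℂ) y = α A y := fun A => smoothElt_of_mem (hα A) hy
    have h := htw y hy A A' B'
    rw [nablaS_of_mem hg hU he hα _ _ _ hy, nablaS_of_mem hg hU he hα _ _ _ hy] at h
    have hf : ∀ A', formS η e 𝒜 A A' y = ∑ i, rho i A A' * (neutralForm η h𝒜 i : M → ℂ) y := by
      intro A'
      simp only [formS, solder_eq, neutralForm_of_mem h𝒜 _ hy]
      exact Finset.sum_congr rfl fun i _ => by ring
    rw [hf, hf] at h
    simp only [hP]
    push_cast
    simp only [Pi.sub_apply, Pi.mul_apply, hα', Fin.sum_univ_four] at h ⊢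
    linear_combination 2 * h
  have hPeq : ∀ f h : smoothRing U, (∀ y ∉ U, (f : M → ℂ) y = 0) → (∀ y ∉ U, (h : M → ℂ) y = 0) →
      (∀ y ∈ U, (f : M → ℂ) y = (h : M → ℂ) y) → f = h := fun f h hf hh hfh =>
    smoothRing.ext hfh fun y hy => by rw [hf y hy, hh y hy]
  have hn : ∀ i A, ∀ y ∉ U, ((-P i A : smoothRing U) : M → ℂ) y = 0 := fun i A y hy => by
    push_cast
    rw [Pi.neg_apply, hP0 y hy, neg_zero]
  -- Six independent equations for eight components: solved, they express `P` through `P 0 0` and `P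
  -- 0 1`.
  have hall : ∀ y ∈ U, (P 1 0 : M → ℂ) y = -(P 0 1 : M → ℂ) y ∧
      (P 1 1 : M → ℂ) y = -(P 0 0 : M → ℂ) y ∧ (P 2 0 : M → ℂ) y = -(P 0 1 : M → ℂ) y ∧
      (P 2 1 : M → ℂ) y = (P 0 0 : M → ℂ) y ∧ (P 3 0 : M → ℂ) y = -(P 0 0 : M → ℂ) y ∧
      (P 3 1 : M → ℂ) y = (P 0 1 : M → ℂ) y := by
    intro y hy
    have a1 := hPE y hy 0 0 0
    have a2 := hPE y hy 0 0 1
    have a3 := hPE y hy 0 1 1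
    have b1 := hPE y hy 1 0 0
    have b2 := hPE y hy 1 0 1
    have b3 := hPE y hy 1 1 1
    simp only [Fin.sum_univ_four] at a1 a2 a3 b1 b2 b3
    simp [rho] at a1 a2 a3 b1 b2 b3
    refine ⟨?_, ?_, ?_, ?_, ?_, ?_⟩
    · linear_combination (1 / 2) * (a2 + b1 + b3)
    · linear_combination (1 / 2) * (a3 + b2 + a1)
    · linear_combination (1 / 2) * (a2 - b1 + b3)
    · linear_combination (1 / 2) * (a3 - b2 - a1)
    · linear_combination a1
    · linear_combination -b3
  have key := charged_twistor_curvature (neutralConn_antisymm hg hU he)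
    (neutralConn_self hg hU he) (neutralDeriv_comm hg hU he) (α := spinorElt hα)
    (a := neutralForm η h𝒜) (P := P) hP
    (hPeq _ _ (hP0 · · _ _) (hn _ _) fun y hy => (hall y hy).1)
    (hPeq _ _ (hP0 · · _ _) (hn _ _) fun y hy => (hall y hy).2.1)
    (hPeq _ _ (hP0 · · _ _) (hn _ _) fun y hy => (hall y hy).2.2.1)
    (hPeq _ _ (hP0 · · _ _) (hP0 · · _ _) fun y hy => (hall y hy).2.2.2.1)
    (hPeq _ _ (hP0 · · _ _) (hn _ _) fun y hy => (hall y hy).2.2.2.2.1)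
    (hPeq _ _ (hP0 · · _ _) (hP0 · · _ _) fun y hy => (hall y hy).2.2.2.2.2)
  have hF : ∀ A B, primedPart η (curv e 𝒜 x) A B = ((sdPart (frameCurv (neutralDeriv hg hU he)
      (neutralConn hg hU he) (neutralForm η h𝒜)) A B : smoothRing U) : M → ℂ) x := by
    intro A B
    rw [primedPart_eq_sdPart η fun i j => curv_antisymm e 𝒜 i j x, smoothRing.sdPart_apply]
    simp only [neutralCurv_of_mem hg hU he h𝒜 _ _ hx]
  obtain ⟨s1, s2, s3⟩ := curvSpinor_symm hg hU he hx
  have hα' : ∀ A, (spinorElt hα A : M → ℂ) x = α A x := fun A => smoothElt_of_mem (hα A) hx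
  refine curvature_eq_zero_of_weyl (Y := curvSpinor g η e x) (α := fun A => α A x)
    (F := fun A B => primedPart η (curv e 𝒜 x) A B) s1 s2 s3
    (primedPart_symm η (fun i j => curv_antisymm e 𝒜 i j x) 1 0) (h0 x hx) (fun A B C => ?_)
    (fun A B C => ?_) A B
  · have h := congrArg (fun f : smoothRing U => (f : M → ℂ) x) (key A B C)
    simp only [] at h
    push_cast at h
    simp only [Pi.add_apply, Pi.sub_apply, Pi.mul_apply, Pi.zero_apply, ← hF, hα',
      ← curvSpinor_eq hg hU he _ _ _ _ hx] at h
    exact h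
  · have h := hW A B C
    simp only [Fin.sum_univ_two, raise, eps] at h
    simp at h
    simp only [weylSD] at h
    linear_combination h

end Curvature

/-! ### The Hodge star in an oriented orthonormal frame. -/

section Hodge

/-- The Vandermonde product is alternating, and at `(0, 1, 2, 3)` it equals 12. As a polynomial in
the indices it makes the sums in `hodge` computable. -/
lemma leviCivita_eq : ∀ i j k l : Fin 4, 12 * leviCivita i j k l =
    ((j : ℕ) - (i : ℕ) : ℤ) * ((k : ℕ) - (i : ℕ)) * ((l : ℕ) - (i : ℕ)) * ((k : ℕ) - (j : ℕ))
      * ((l : ℕ) - (j : ℕ)) * ((l : ℕ) - (k : ℕ)) := by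
  decide +kernel

lemma leviCivita_cast (i j k l : Fin 4) : (leviCivita i j k l : ℂ) = (1 / 12) *
    (((j : ℕ) - (i : ℕ)) * ((k : ℕ) - (i : ℕ)) * ((l : ℕ) - (i : ℕ)) * ((k : ℕ) - (j : ℕ))
      * ((l : ℕ) - (j : ℕ)) * ((l : ℕ) - (k : ℕ))) := by
  have h : ((12 * leviCivita i j k l : ℤ) : ℂ) = _ := congrArg _ (leviCivita_eq i j k l)
  push_cast at h
  linear_combination (1 / 12) * h

lemma hodge_apply {F : Fin 4 → Fin 4 → ℂ} (hF : ∀ i j, F j i = -F i j) :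
    hodge F = !![0, F 2 3, -F 1 3, F 1 2; -F 2 3, 0, F 0 3, -F 0 2;
      F 1 3, -F 0 3, 0, F 0 1; -F 1 2, F 0 2, -F 0 1, 0] := by
  have h0 : ∀ i, F i i = 0 := fun i => by
    have h := hF i i
    linear_combination (1 / 2) * h
  have h10 := hF 0 1
  have h20 := hF 0 2
  have h30 := hF 0 3
  have h21 := hF 1 2
  have h31 := hF 1 3
  have h32 := hF 2 3
  funext i j
  simp only [hodge, leviCivita_cast, Fin.sum_univ_four, h0, h10, h20, h30, h21, h31, h32]
  fin_cases i <;> fin_cases j <;> norm_num <;> ring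

/-- Only the combinations `T 0 1 + T 2 3`, `T 0 2 - T 1 3` and `T 0 3 + T 1 2` appear: these are the
components of the self-dual half of `T`. -/
lemma primedPart_euclid {T : Fin 4 → Fin 4 → ℂ} (hT : ∀ i j, T j i = -T i j) (A B : Fin 2) :
    primedPart euclid T A B =
      (!![1 / 2 * (Complex.I * (T 0 1 + T 2 3) - (T 0 2 - T 1 3)),
        -(1 / 2) * Complex.I * (T 0 3 + T 1 2);
        -(1 / 2) * Complex.I * (T 0 3 + T 1 2),
        1 / 2 * (-Complex.I * (T 0 1 + T 2 3) - (T 0 2 - T 1 3))] :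
        Matrix (Fin 2) (Fin 2) ℂ) A B := by
  have h := sqrt_two_inv_sq
  have hI := Complex.I_mul_I
  rw [primedPart_eq_sdPart _ hT]
  simp only [sdPart, scale, euclid]
  generalize ((Real.sqrt 2 : ℝ) : ℂ)⁻¹ = s at h
  fin_cases A <;> fin_cases B <;> simp
  · linear_combination (Complex.I * (T 0 1 + T 2 3) - T 0 2 + T 1 3) * h - s ^ 2 * T 1 3 * hI
  · linear_combination -(Complex.I * (T 0 3 + T 1 2)) * h
  · linear_combination -(Complex.I * (T 0 3 + T 1 2)) * h
  · linear_combination (-(Complex.I * (T 0 1 + T 2 3)) - T 0 2 + T 1 3) * h - s ^ 2 * T 1 3 * hI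

/-- A 2-form without primed part is anti-self-dual. -/
lemma hodge_eq_neg {F : Fin 4 → Fin 4 → ℂ} (hF : ∀ i j, F j i = -F i j)
    (h : ∀ A B, primedPart euclid F A B = 0) : hodge F = -F := by
  have h00 := h 0 0
  have h01 := h 0 1
  have h11 := h 1 1
  rw [primedPart_euclid hF] at h00 h01 h11
  simp at h00 h01 h11
  have hI := Complex.I_mul_I
  have e1 : F 2 3 = -F 0 1 := by
    linear_combination -(1 / 2) * Complex.I * (h00 - h11) + (F 0 1 + F 2 3) * hI
  have e2 : F 1 3 = F 0 2 := by linear_combination (1 / 2) * (h00 + h11)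
  have e3 : F 1 2 = -F 0 3 := by linear_combination h01
  have h0 : ∀ i, F i i = 0 := fun i => by
    have h := hF i i
    linear_combination (1 / 2) * h
  rw [hodge_apply hF]
  funext i j
  fin_cases i <;> fin_cases j <;>
    simp [h0, hF 0 1, hF 0 2, hF 0 3, hF 1 2, hF 1 3, hF 2 3, e1, e2, e3]

end Hodge

/-! ### Quaternionic conjugation in Riemannian signature, and anti-self-duality. -/

section Reality

/-- The signs of the Euclidean conjugation of primed spinors. -/
def conjSign (A : Fin 2) : ℂ := ![1, -1] A

/-- In Euclidean signature conjugation acts on primed indices by the quaternionic structure, which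
swaps the two basis spinors with a sign. -/
lemma conj_primedPart {T : Fin 4 → Fin 4 → ℂ} (hT : ∀ i j, T j i = -T i j) (A B : Fin 2) :
    (starRingEnd ℂ) (primedPart euclid T A B) = conjSign A * conjSign B *
      primedPart euclid (fun i j => (starRingEnd ℂ) (T i j)) A.rev B.rev := by
  rw [primedPart_euclid hT, primedPart_euclid fun i j => by rw [hT, map_neg]]
  have h2 : (starRingEnd ℂ) 2 = 2 := map_ofNat _ 2
  fin_cases A <;> fin_cases B <;> simp [conjSign, h2]

lemma primedPart_const_mul (η : Fin 4 → ℝ) (c : ℂ) (T : Fin 4 → Fin 4 → ℂ) (A B : Fin 2) :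
    primedPart η (fun i j => c * T i j) A B = c * primedPart η T A B := by
  simp only [primedPart, toSpinor₂, Finset.mul_sum]
  refine Finset.sum_congr rfl fun _ _ => Finset.sum_congr rfl fun _ _ => Finset.sum_congr rfl
    fun _ _ => Finset.sum_congr rfl fun _ _ => by ring

variable {M : Type*} [TopologicalSpace M] [ChartedSpace E4 M] [IsManifold (𝓡 4) ∞ M]
  {U : Set M} {g : BilinField M} {e : Fin 4 → VField M} {x : M}
  {α : SpinorField M} {𝒜 : CForm M}

lemma conj_curvSpinor (hg : IsPseudoRiemannian g) (hU : IsOpen U) (he : IsFrame g euclid U e)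
    (hx : x ∈ U) (I : Fin 4 → Fin 2) : (starRingEnd ℂ) (curvSpinor g euclid e x I) =
      (∏ k, conjSign (I k)) * curvSpinor g euclid e x (Fin.rev ∘ I) := by
  have h1 : ∀ i j k l, (riem g euclid e i j l k x : ℂ) = -(riem g euclid e i j k l x : ℂ) :=
    fun i j k l => by rw [riem_antisymm_right hg hU he i j k l hx]; push_cast; ring
  have h2 : ∀ i j, primedPart euclid (fun k l => (riem g euclid e j i k l x : ℂ)) (I 2) (I 3) =
      -primedPart euclid (fun k l => (riem g euclid e i j k l x : ℂ)) (I 2) (I 3) := by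
    intro i j
    have h3 : ∀ k l, (riem g euclid e j i k l x : ℂ) = -1 * (riem g euclid e i j k l x : ℂ) :=
      fun k l => by rw [riem_antisymm_left g euclid e i j]; push_cast; ring
    simp only [h3]
    rw [primedPart_const_mul]
    ring
  rw [curvSpinor, conj_primedPart h2]
  simp only [conj_primedPart (h1 _ _), Complex.conj_ofReal, primedPart_const_mul, curvSpinor,
    Fin.prod_univ_four, Function.comp_apply]
  ring

/-- The Riemann tensor is real, so its self-dual spinor is fixed by the quaternionic conjugation.
The product of signs is unaffected by permuting the indices and passes through the symmetrisation.
-/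
lemma conj_weylSD (hg : IsPseudoRiemannian g) (hU : IsOpen U) (he : IsFrame g euclid U e)
    (hx : x ∈ U) (A B C E : Fin 2) : (starRingEnd ℂ) (weylSD g euclid e A B C E x) =
      conjSign A * conjSign B * conjSign C * conjSign E *
        weylSD g euclid e A.rev B.rev C.rev E.rev x := by
  simp only [weylSD, map_mul, map_sum, conj_curvSpinor hg hU he hx]
  have h1 : ∀ p : Equiv.Perm (Fin 4), ∏ k, conjSign ((![A, B, C, E] ∘ p) k) =
      conjSign A * conjSign B * conjSign C * conjSign E := by
    intro p
    rw [← Equiv.prod_comp p.symm]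
    simp [Fin.prod_univ_four]
  have h2 : ∀ p : Equiv.Perm (Fin 4), Fin.rev ∘ ![A, B, C, E] ∘ p =
      ![A.rev, B.rev, C.rev, E.rev] ∘ p := by
    intro p
    rw [← Function.comp_assoc]
    congr 1
    funext k
    fin_cases k <;> rfl
  have h3 : (starRingEnd ℂ) 24 = 24 := map_ofNat _ 24
  simp only [h1, h2, ← Finset.mul_sum, map_div₀, map_one, h3]
  ring

/-- In Riemannian signature the self-dual Weyl spinor vanishes if it annihilates a nonzero
spinor. -/
lemma weylSD_eq_zero (hg : IsPseudoRiemannian g) (hU : IsOpen U) (he : IsFrame g euclid U e)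
    (hx : x ∈ U) (h0 : ∃ A', α A' x ≠ 0)
    (hW : ∀ A' B' C', ∑ D', weylSD g euclid e A' B' C' D' x * raise α D' x = 0)
    (A B C E : Fin 2) : weylSD g euclid e A B C E x = 0 := by
  have hN := spinor_norm_ne_zero (α := fun A => α A x) h0
  have h1 : ∀ A B C, weylSD g euclid e A B C 0 x * α 1 x - weylSD g euclid e A B C 1 x * α 0 x
      = 0 := by
    intro A B C
    have h := hW A B C
    simp [Fin.sum_univ_two, raise, eps] at h
    linear_combination h
  have hs : ∀ A, conjSign A * conjSign A = 1 := fun A => by fin_cases A <;> simp [conjSign]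
  -- The conjugate equation says that the Weyl spinor annihilates `α†`. Together with `h1` this is a
  -- linear system for its last index with determinant `|α|²`.
  have h2 : weylSD g euclid e A B C 1 x * (starRingEnd ℂ) (α 1 x) +
      weylSD g euclid e A B C 0 x * (starRingEnd ℂ) (α 0 x) = 0 := by
    have h := congrArg (starRingEnd ℂ) (h1 A.rev B.rev C.rev)
    simp only [map_sub, map_mul, map_zero, conj_weylSD hg hU he hx, Fin.rev_rev] at h
    have e0 : conjSign 0 = 1 := rfl
    have e1 : conjSign 1 = -1 := rfl
    have r0 : Fin.rev (0 : Fin 2) = 1 := rfl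
    have r1 : Fin.rev (1 : Fin 2) = 0 := rfl
    rw [e0, e1, r0, r1] at h
    let s := conjSign A.rev * conjSign B.rev * conjSign C.rev
    have hss : s * s = 1 := by
      linear_combination hs A.rev * (conjSign B.rev * conjSign C.rev) ^ 2
        + hs B.rev * conjSign C.rev ^ 2 + hs C.rev
    linear_combination s * h - (weylSD g euclid e A B C 1 x * (starRingEnd ℂ) (α 1 x) +
      weylSD g euclid e A B C 0 x * (starRingEnd ℂ) (α 0 x)) * hss
  have h3 := h1 A B C
  refine (mul_eq_zero.1 ?_).resolve_right hN
  fin_cases E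
  · simp only [Fin.zero_eta]
    linear_combination α 0 x * h2 + (starRingEnd ℂ) (α 1 x) * h3
  · simp only [Fin.mk_one]
    linear_combination α 1 x * h2 - (starRingEnd ℂ) (α 0 x) * h3

/-- The charged twistor connection of a spinor annihilated by the Weyl spinor is
anti-self-dual. -/
theorem isASD_of_weylSD {η : Fin 4 → ℝ} (hg : IsPseudoRiemannian g) (hU : IsOpen U)
    (he : IsFrame g η U e) (hα : SmoothSpinorOn α U) (h0 : ∀ x ∈ U, ∃ A', α A' x ≠ 0)
    (h𝒜 : IsTwistorConnection g η U e α 𝒜)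
    (hW : ∀ x ∈ U, ∀ A' B' C', ∑ D', weylSD g η e A' B' C' D' x * raise α D' x = 0) :
    IsASD g η U e 𝒜 := by
  intro x hx A' B'
  rw [primedPart_antisymm]
  simp only [nablaForm_sub hg he hx]
  exact primedPart_curv_eq_zero hg hU he hα h0 h𝒜.1 h𝒜.2.1 hx (hW x hx) A' B'

lemma hodge_curv_eq_neg (hg : IsPseudoRiemannian g) (he : IsFrame g euclid U e)
    (h : IsASD g euclid U e 𝒜) (hx : x ∈ U) : hodge (curv e 𝒜 x) = -curv e 𝒜 x := by
  refine hodge_eq_neg (fun i j => curv_antisymm e 𝒜 i j x) fun A B => ?_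
  have h1 := h x hx A B
  rw [primedPart_antisymm] at h1
  simp only [nablaForm_sub hg he hx] at h1
  exact h1

end Reality

/-! ### Compatible complex structures and the Nijenhuis tensor. -/

section ComplexStructure

variable {M : Type*} [TopologicalSpace M] [ChartedSpace E4 M] [IsManifold (𝓡 4) ∞ M]
  {U : Set M} {g : BilinField M} {η : Fin 4 → ℝ} {e : Fin 4 → VField M} {x : M}
  {J : EndField M} {Ω : M → ℝ}

lemma Metric.isPseudoRiemannian (g : Metric M) : IsPseudoRiemannian g.inner where
  symm := g.symm
  nondegenerate x v h := by
    by_contra hv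
    exact (g.pos x v hv).ne' (h v)
  smooth := g.contMDiff

/-- The components of the Lie bracket of vector fields given in a frame. -/
lemma IsFrame.bracket_components (hU : IsOpen U)
    (he : IsFrame g euclid U e) {X Y : VField M} {f h : Fin 4 → M → ℝ}
    (hf : ∀ m, ContMDiffOn (𝓡 4) 𝓘(ℝ, ℝ) ∞ (f m) U)
    (hh : ∀ m, ContMDiffOn (𝓡 4) 𝓘(ℝ, ℝ) ∞ (h m) U)
    (hX : ∀ y ∈ U, X y = ∑ m, f m y • e m y) (hY : ∀ y ∈ U, Y y = ∑ m, h m y • e m y)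
    (hx : x ∈ U) (k : Fin 4) : g x (bracket X Y x) (e k x) =
      ∑ m, (f m x * dirR (e m) (h k) x - h m x * dirR (e m) (f k) x
        + ∑ n, f m x * h n x * (conn g e m n k x - conn g e n m k x)) := by
  have key : ∀ (Z : VField M) {W : VField M} {f : Fin 4 → M → ℝ},
      (∀ m, ContMDiffOn (𝓡 4) 𝓘(ℝ, ℝ) ∞ (f m) U) → (∀ y ∈ U, W y = ∑ m, f m y • e m y) →
      bracket Z W x = ∑ m, (dirR Z (f m) x • e m x + f m x • bracket Z (e m) x) := by
    intro Z W f hf hW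
    have hs : ∀ m, SmoothFieldOn (f m • e m) U := fun m => (he.smooth m).smul (hf m)
    have h1 : W =ᶠ[nhds x] ((f 0 • e 0 + f 1 • e 1) + f 2 • e 2) + f 3 • e 3 :=
      Filter.eventuallyEq_of_mem (hU.mem_nhds hx) fun y hy => by
        rw [hW y hy, Fin.sum_univ_four]
        rfl
    have h2 : bracket Z W x = bracket Z _ x :=
      Filter.EventuallyEq.mlieBracket_vectorField_eq (Filter.EventuallyEq.refl _ _) h1
    have h3 : ∀ m, bracket Z (f m • e m) x = dirR Z (f m) x • e m x + f m x • bracket Z (e m) x :=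
      fun m => bracket_smul_right (((hf m).contMDiffAt (hU.mem_nhds hx)).mdifferentiableAt
        (by simp)) ((he.smooth m).at hU hx)
    rw [h2, bracket_add_right ((((hs 0).add (hs 1)).add (hs 2)).at hU hx) ((hs 3).at hU hx),
      bracket_add_right (((hs 0).add (hs 1)).at hU hx) ((hs 2).at hU hx),
      bracket_add_right ((hs 0).at hU hx) ((hs 1).at hU hx), h3, h3, h3, h3, Fin.sum_univ_four]
  have hd : ∀ q : M → ℝ, dirR X q x = ∑ m, f m x * dirR (e m) q x := by
    intro q
    change mvfderiv (𝓡 4) q x (X x) = _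
    rw [hX x hx]
    simp only [map_sum, map_smul, smul_eq_mul]
    rfl
  have hb : ∀ n, bracket X (e n) x =
      ∑ m, (f m x • bracket (e m) (e n) x - dirR (e n) (f m) x • e m x) := by
    intro n
    rw [bracket_swap, key (e n) hf hX, ← Finset.sum_neg_distrib]
    refine Finset.sum_congr rfl fun m _ => ?_
    rw [bracket_swap (e n) (e m)]
    module
  have ho : ∀ m n, g x (e m x) (e n x) = if m = n then 1 else 0 := he.orthonormal x hx
  rw [key X hh hY]
  simp only [hd, hb, map_add, map_sub, map_smul, add_apply, sub_apply,
    smul_apply, smul_eq_mul, ho, ← conn_torsion, Fin.sum_univ_four]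
  fin_cases k <;> simp <;> ring

/-- `J` is an almost complex structure compatible with `g`. -/
structure IsCompatible (g : BilinField M) (J : EndField M) : Prop where
  smooth : ContMDiff (𝓡 4) ((𝓡 4).prod 𝓘(ℝ, E4 →L[ℝ] E4)) ∞
    (fun x => TotalSpace.mk' (E4 →L[ℝ] E4)
      (E := fun x : M => TangentSpace (𝓡 4) x →L[ℝ] TangentSpace (𝓡 4) x) x (J x))
  sq : ∀ x v, J x (J x v) = -v
  compatible : ∀ x v w, g x (J x v) (J x w) = g x v w

lemma IsConformallyKahler.isCompatible (h : IsConformallyKahler g J Ω) : IsCompatible g J where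
  smooth := h.kahler.smooth
  sq := h.kahler.sq
  compatible x v w := by
    have h1 := h.kahler.compatible x v w
    simp only [smul_apply, smul_eq_mul] at h1
    exact mul_left_cancel₀ (pow_ne_zero 2 (h.ne_zero x)) h1

lemma IsCompatible.smoothFieldOn (hJ : IsCompatible g J) {X : VField M} (hX : SmoothFieldOn X U) :
    SmoothFieldOn (fun y => J y (X y)) U := by
  intro x hx
  exact ContMDiffWithinAt.clm_bundle_apply (b := fun x : M => x)
    (hJ.smooth.contMDiffAt.contMDiffWithinAt) (hX x hx)

/-- The components of the fundamental form, as real functions. -/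
def kappaR (g : BilinField M) (J : EndField M) (e : Fin 4 → VField M) (i j : Fin 4) (x : M) : ℝ :=
  g x (J x (e i x)) (e j x)

lemma IsCompatible.smooth_kappaR (hg : IsPseudoRiemannian g) (hJ : IsCompatible g J)
    (he : IsFrame g η U e) (i j : Fin 4) : ContMDiffOn (𝓡 4) 𝓘(ℝ, ℝ) ∞ (kappaR g J e i j) U :=
  smooth_bilin hg (hJ.smoothFieldOn (he.smooth i)) (he.smooth j)

/-- An isometry of square `-1` is skew. -/
lemma IsCompatible.apply_left (hJ : IsCompatible g J) (x : M) (v w : TangentSpace (𝓡 4) x) :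
    g x (J x v) w = -g x v (J x w) := by
  rw [← hJ.compatible x v, hJ.sq, map_neg, neg_neg]

lemma IsCompatible.kappaR_antisymm (hg : IsPseudoRiemannian g) (hJ : IsCompatible g J)
    (e : Fin 4 → VField M) (i j : Fin 4) (x : M) : kappaR g J e j i x = -kappaR g J e i j x := by
  rw [kappaR, kappaR, hJ.apply_left, hg.symm]

lemma IsFrame.expand_apply (hg : IsPseudoRiemannian g) (he : IsFrame g euclid U e)
    (J : EndField M) (i : Fin 4) (hx : x ∈ U) :
    J x (e i x) = ∑ m, kappaR g J e i m x • e m x := by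
  simpa [euclid, kappaR] using he.expand hg hx (J x (e i x))

lemma IsCompatible.kappaR_sq (hg : IsPseudoRiemannian g) (hJ : IsCompatible g J)
    (he : IsFrame g euclid U e) (i j : Fin 4) (hx : x ∈ U) :
    ∑ m, kappaR g J e i m x * kappaR g J e m j x = -if i = j then 1 else 0 := by
  have h1 : g x (J x (J x (e i x))) (e j x) = -if i = j then 1 else 0 := by
    rw [hJ.sq, map_neg, neg_apply, he.orthonormal x hx]
    rfl
  rw [← h1, he.expand_apply hg J i hx]
  simp only [map_sum, map_smul, sum_apply, smul_apply, smul_eq_mul, kappaR]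

/-- `(∇_{e_i} κ)(e_j, e_k)` for the fundamental form `κ`. -/
def nablaKappa (g : BilinField M) (J : EndField M) (e : Fin 4 → VField M) (i j k : Fin 4) (x : M) :
    ℝ :=
  dirR (e i) (kappaR g J e j k) x
    + ∑ m, (conn g e i j m x * kappaR g J e k m x + conn g e i m k x * kappaR g J e j m x)

/-- The Nijenhuis tensor of an integrable complex structure vanishes. -/
lemma nijenhuis_components (hg : IsPseudoRiemannian g) (hU : IsOpen U)
    (he : IsFrame g euclid U e) {h : BilinField M} (hk : IsKahler h J) (hJ : IsCompatible g J)
    (hx : x ∈ U) (i j k : Fin 4) :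
    ∑ m, (kappaR g J e i m x * nablaKappa g J e m j k x
      - kappaR g J e j m x * nablaKappa g J e m i k x
      + kappaR g J e k m x * (nablaKappa g J e i j m x - nablaKappa g J e j i m x)) = 0 := by
  have hκ := fun i j => hJ.smooth_kappaR hg he i j
  have hJe : ∀ i, ∀ y ∈ U, J y (e i y) = ∑ m, kappaR g J e i m y • e m y := fun i y hy =>
    he.expand_apply hg J i hy
  have hc : ∀ i m : Fin 4, ContMDiffOn (𝓡 4) 𝓘(ℝ, ℝ) ∞ (fun _ => if i = m then (1 : ℝ) else 0) U :=
    fun i m => contMDiffOn_const (c := if i = m then (1 : ℝ) else 0)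
  have hce : ∀ i, ∀ y ∈ U, e i y = ∑ m, (if i = m then (1 : ℝ) else 0) • e m y := by simp
  have hb : ∀ i j p, g x (bracket (fun y => J y (e i y)) (e j) x) (e p x) =
      -dirR (e j) (kappaR g J e i p) x
        + ∑ m, kappaR g J e i m x * (conn g e m j p x - conn g e j m p x) := by
    intro i j p
    rw [he.bracket_components hU (hκ i) (hc j) (hJe i) (hce j) hx]
    simp [dirR_const, Finset.sum_add_distrib]
  -- Integrability involves `J` alone, so it may be evaluated with `g` although the Kähler metric is
  -- `h`.
  have hN := congrArg (fun v => g x v (e k x)) (hk.integrable x (e i) (e j)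
    ((he.smooth i).at hU hx) ((he.smooth j).at hU hx))
  rw [bracket_swap (e i) (fun y => J y (e j y))] at hN
  simp only [map_sub, sub_apply, map_zero, zero_apply, map_neg, neg_apply] at hN
  rw [hJ.apply_left, hJ.apply_left, he.expand_apply hg J k hx] at hN
  simp only [map_sum, map_smul, smul_eq_mul, hb, ← conn_torsion,
    he.bracket_components hU (hκ i) (hκ j) (hJe i) (hJe j) hx] at hN
  -- By `J² = -1` the bracket `[e_i, e_j]` is rewritten as a term quadratic in `κ`. It then combines
  -- with the other brackets into covariant derivatives of `κ`.
  have hsq : ∑ p, (conn g e i j p x - conn g e j i p x) *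
      ∑ m, kappaR g J e k m x * kappaR g J e m p x = -(conn g e i j k x - conn g e j i k x) := by
    simp [hJ.kappaR_sq hg he _ _ hx]
  simp only [nablaKappa, Fin.sum_univ_four] at hN hsq ⊢
  linear_combination hN + hsq

end ComplexStructure

/-! ### The derivative of the fundamental form. -/

section KahlerAlgebra

/-- The self-dual 2-form with given components. -/
def sdForm (a b c : ℝ) : Matrix (Fin 4) (Fin 4) ℝ :=
  !![0, a, b, c; -a, 0, c, -b; -b, -c, 0, a; -c, b, -a, 0]

variable {a b c : ℝ} {ta tb tc w : Fin 4 → ℝ}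

set_option maxHeartbeats 2000000 in
/-- The covariant derivative of the fundamental form of a conformally Kähler metric, in terms of
the logarithmic derivative `w` of the conformal factor. -/
lemma nabla_of_conformallyKahler (hn : a * a + b * b + c * c = 1)
    (hs : ∀ i, a * ta i + b * tb i + c * tc i = 0)
    (hC : ∀ i j k, sdForm (ta i) (tb i) (tc i) j k + sdForm (ta j) (tb j) (tc j) k i
      + sdForm (ta k) (tb k) (tc k) i j = -2 * (w i * sdForm a b c j k + w j * sdForm a b c k i
        + w k * sdForm a b c i j))
    (hN : ∀ i j k, ∑ m, (sdForm a b c i m * sdForm (ta m) (tb m) (tc m) j k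
      - sdForm a b c j m * sdForm (ta m) (tb m) (tc m) i k
      + sdForm a b c k m * (sdForm (ta i) (tb i) (tc i) j m - sdForm (ta j) (tb j) (tc j) i m)) = 0)
    (i k : Fin 4) : sdForm (ta i) (tb i) (tc i) 0 k =
      -(w 0 * sdForm a b c k i + w k * sdForm a b c i 0
        + (∑ m, sdForm a b c 0 m * w m) * (if k = i then 1 else 0)
        - (∑ m, sdForm a b c k m * w m) * (if i = 0 then 1 else 0)) := by
  -- The classical formula for an almost Hermitian structure: `∇_X κ (Y, Z)` is half a signed sum of
  -- `dκ(X, Y, Z)`, `dκ(X, JY, JZ)` and `g(JX, N(Y, Z))`. These are `h1`, `h2` and `h3` for `X =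
  -- e_i`, `Y = e_0`, `Z = e_k`. A self-dual form is determined by its `0 k` components, so this
  -- choice of `Y` suffices.
  have h1 := hC i 0 k
  have h2 : ∑ p, ∑ q, sdForm a b c 0 p * sdForm a b c k q * (sdForm (ta i) (tb i) (tc i) p q
      + sdForm (ta p) (tb p) (tc p) q i + sdForm (ta q) (tb q) (tc q) i p) =
      ∑ p, ∑ q, sdForm a b c 0 p * sdForm a b c k q * (-2 * (w i * sdForm a b c p q
      + w p * sdForm a b c q i + w q * sdForm a b c i p)) := by
    simp only [hC]
  have h3 : ∑ p, sdForm a b c i p * (∑ m, (sdForm a b c 0 m * sdForm (ta m) (tb m) (tc m) k p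
      - sdForm a b c k m * sdForm (ta m) (tb m) (tc m) 0 p
      + sdForm a b c p m * (sdForm (ta 0) (tb 0) (tc 0) k m
        - sdForm (ta k) (tb k) (tc k) 0 m))) = 0 := by
    simp only [hN, mul_zero, Finset.sum_const_zero]
  have hs0 := hs 0
  have hs1 := hs 1
  have hs2 := hs 2
  have hs3 := hs 3
  have hsi := hs i
  obtain ⟨K, hK⟩ : ∃ K, K = sdForm a b c := ⟨_, rfl⟩
  obtain ⟨T, hT⟩ : ∃ T : Fin 4 → Matrix (Fin 4) (Fin 4) ℝ,
    ∀ i, T i = sdForm (ta i) (tb i) (tc i) := ⟨_, fun _ => rfl⟩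
  obtain ⟨d, hd⟩ : ∃ d : Fin 4 → Fin 4 → ℝ, ∀ i j, d i j = if i = j then 1 else 0 :=
    ⟨_, fun _ _ => rfl⟩
  simp only [← hd, ← hK, ← hT, Fin.sum_univ_four] at h1 h2 h3 ⊢
  -- The formula holds only modulo `|κ|² = 1` and `⟨κ, ∇κ⟩ = 0`. The right side collects the
  -- multiples of these relations that occur, so that it vanishes.
  have key : ∀ E : ℝ, E = -(1 / 2) * (T i 0 k - T 0 k i - T k i 0 - 2 * w i * K 0 k
      + 2 * (K 0 0 * w 0 + K 0 1 * w 1 + K 0 2 * w 2 + K 0 3 * w 3) * d k i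
      - 2 * (K k 0 * w 0 + K k 1 * w 1 + K k 2 * w 2 + K k 3 * w 3) * d i 0) *
        (a * a + b * b + c * c - 1)
      + K 0 k * (a * ta i + b * tb i + c * tc i)
      - d k i * (K 0 0 * (a * ta 0 + b * tb 0 + c * tc 0) + K 0 1 * (a * ta 1 + b * tb 1 + c * tc 1)
        + K 0 2 * (a * ta 2 + b * tb 2 + c * tc 2) + K 0 3 * (a * ta 3 + b * tb 3 + c * tc 3))
      + d i 0 * (K k 0 * (a * ta 0 + b * tb 0 + c * tc 0) + K k 1 * (a * ta 1 + b * tb 1 + c * tc 1)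
        + K k 2 * (a * ta 2 + b * tb 2 + c * tc 2) + K k 3 * (a * ta 3 + b * tb 3 + c * tc 3)) →
      E = 0 := by
    intro E hE
    rw [hE, hn, hsi, hs0, hs1, hs2, hs3]
    ring
  refine sub_eq_zero.1 (key _ ?_)
  simp only [hd, hK, hT] at h1 h2 h3 ⊢
  fin_cases i <;> fin_cases k <;> simp [sdForm] at h1 h2 h3 ⊢ <;>
    linear_combination (1 / 2) * (h1 - h2 + h3)

end KahlerAlgebra

/-! ### The Killing spinor equation in components. -/

section KillingAlgebra

variable {a b c : ℝ} {ta tb tc w : Fin 4 → ℝ}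

/-- The symmetric spinor of a self-dual 2-form. -/
def sdSpinor (a b c : ℝ) : Matrix (Fin 2) (Fin 2) ℂ :=
  !![Complex.I * a - b, -Complex.I * c; -Complex.I * c, -Complex.I * a - b]

lemma primedPart_sdForm (a b c : ℝ) (A B : Fin 2) :
    primedPart euclid (fun i j => (sdForm a b c i j : ℂ)) A B = sdSpinor a b c A B := by
  rw [primedPart_euclid fun i j => by fin_cases i <;> fin_cases j <;> simp [sdForm]]
  fin_cases A <;> fin_cases B <;> simp [sdForm, sdSpinor] <;> ring

set_option maxHeartbeats 2000000 in
/-- The Killing spinor equation of a conformally Kähler metric. -/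
lemma killing_of_conformallyKahler (hn : a * a + b * b + c * c = 1)
    (hs : ∀ i, a * ta i + b * tb i + c * tc i = 0)
    (hC : ∀ i j k, sdForm (ta i) (tb i) (tc i) j k + sdForm (ta j) (tb j) (tc j) k i
      + sdForm (ta k) (tb k) (tc k) i j = -2 * (w i * sdForm a b c j k + w j * sdForm a b c k i
        + w k * sdForm a b c i j))
    (hN : ∀ i j k, ∑ m, (sdForm a b c i m * sdForm (ta m) (tb m) (tc m) j k
      - sdForm a b c j m * sdForm (ta m) (tb m) (tc m) i k
      + sdForm a b c k m * (sdForm (ta i) (tb i) (tc i) j m - sdForm (ta j) (tb j) (tc j) i m)) = 0)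
    (A A' B' C' : Fin 2) :
    ∑ i, (quat i A A' * sdSpinor (ta i - w i * a) (tb i - w i * b) (tc i - w i * c) B' C'
      + quat i A B' * sdSpinor (ta i - w i * a) (tb i - w i * b) (tc i - w i * c) C' A'
      + quat i A C' * sdSpinor (ta i - w i * a) (tb i - w i * b) (tc i - w i * c) A' B') = 0 := by
  have key := nabla_of_conformallyKahler hn hs hC hN
  -- Once `∇κ` is substituted, each component becomes an identity bilinear in `w` and `(a, b, c)`.
  -- The differences `ta i - w i * a` and so on are the components of `Ω ∇(Ω⁻¹ κ)`, with `w = d log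
  -- Ω`.
  have ha : ∀ i, ta i = _ := fun i => key i 1
  have hb : ∀ i, tb i = _ := fun i => key i 2
  have hc : ∀ i, tc i = _ := fun i => key i 3
  simp only [ha, hb, hc, Fin.sum_univ_four]
  clear ha hb hc key hn hs hC hN
  fin_cases A <;> fin_cases A' <;> fin_cases B' <;> fin_cases C' <;>
    simp [quat, sdSpinor, sdForm] <;> apply Complex.ext <;> simp <;> ring

end KillingAlgebra

/-! ### Fundamental forms of conformally Kähler metrics. -/

section Killing

variable {M : Type*} [TopologicalSpace M] [ChartedSpace E4 M] [IsManifold (𝓡 4) ∞ M]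
  {U : Set M} {g : BilinField M} {e : Fin 4 → VField M} {x : M}
  {J : EndField M} {Ω : M → ℝ} {α β : SpinorField M}

/-- The fundamental form is self-dual in the frame `e`. -/
lemma kappaR_eq_sdForm (hg : IsPseudoRiemannian g) (hJ : IsCompatible g J)
    (h : hodge (kappa g J e x) = kappa g J e x) (i j : Fin 4) : kappaR g J e i j x =
      sdForm (kappaR g J e 0 1 x) (kappaR g J e 0 2 x) (kappaR g J e 0 3 x) i j := by
  have hk : ∀ i j, kappa g J e x i j = (kappaR g J e i j x : ℂ) := fun _ _ => rfl
  have ha := hJ.kappaR_antisymm hg e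
  have h0 : ∀ i, kappaR g J e i i x = 0 := fun i => by linarith [ha i i x]
  rw [hodge_apply fun i j => by rw [hk, hk, ha]; push_cast; rfl] at h
  have h1 := congrFun (congrFun h 0) 1
  have h2 := congrFun (congrFun h 0) 2
  have h3 := congrFun (congrFun h 0) 3
  simp [hk] at h1 h2 h3
  norm_cast at h1 h2 h3
  have h2' : kappaR g J e 1 3 x = -kappaR g J e 0 2 x := by linarith
  fin_cases i <;> fin_cases j <;>
    simp [sdForm, h0, ha 0 1, ha 0 2, ha 0 3, ha 1 2, ha 1 3, ha 2 3, h1, h2', h3]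

/-- A metric connection preserves the splitting of 2-forms, so `∇κ` is self-dual when `κ` is
self-dual throughout `U`. -/
lemma nablaKappa_eq_sdForm (hg : IsPseudoRiemannian g) (hU : IsOpen U) (hJ : IsCompatible g J)
    (he : IsFrame g euclid U e)
    (h : ∀ x ∈ U, hodge (kappa g J e x) = kappa g J e x) (hx : x ∈ U) (i j k : Fin 4) :
    nablaKappa g J e i j k x =
      sdForm (nablaKappa g J e i 0 1 x) (nablaKappa g J e i 0 2 x) (nablaKappa g J e i 0 3 x) j k := by
  have hneg : ∀ j k j' k', (∀ y ∈ U, kappaR g J e j k y = -kappaR g J e j' k' y) →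
      dirR (e i) (kappaR g J e j k) x = -dirR (e i) (kappaR g J e j' k') x := by
    intro j k j' k' hjk
    rw [dirR_congr (h := fun y => -1 * kappaR g J e j' k' y) hU hx fun y hy => by
      rw [hjk y hy]; ring, dirR_mul mdifferentiableAt_const
      (((hJ.smooth_kappaR hg he j' k').contMDiffAt (hU.mem_nhds hx)).mdifferentiableAt (by simp)),
      dirR_const]
    ring
  have hk := fun y hy => kappaR_eq_sdForm hg hJ (h y hy)
  have ha := hJ.kappaR_antisymm hg e
  have d : ∀ j k, dirR (e i) (kappaR g J e k j) x = -dirR (e i) (kappaR g J e j k) x :=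
    fun j k => hneg _ _ _ _ fun y _ => ha j k y
  have d0 : ∀ j, dirR (e i) (kappaR g J e j j) x = 0 := fun j => by linarith [d j j]
  have d23 : dirR (e i) (kappaR g J e 2 3) x = dirR (e i) (kappaR g J e 0 1) x :=
    dirR_congr hU hx fun y hy => hk y hy 2 3
  have d12 : dirR (e i) (kappaR g J e 1 2) x = dirR (e i) (kappaR g J e 0 3) x :=
    dirR_congr hU hx fun y hy => hk y hy 1 2
  have d13 : dirR (e i) (kappaR g J e 1 3) x = -dirR (e i) (kappaR g J e 0 2) x :=
    hneg _ _ _ _ fun y hy => hk y hy 1 3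
  have hc := conn_antisymm g e i
  have c0 : ∀ j, conn g e i j j x = 0 := fun j => by linarith [hc j j x]
  obtain ⟨p, q, r, hpqr⟩ : ∃ p q r, ∀ j k, kappaR g J e j k x = sdForm p q r j k :=
    ⟨_, _, _, hk x hx⟩
  simp only [nablaKappa, Fin.sum_univ_four, hpqr]
  fin_cases j <;> fin_cases k <;>
    simp [sdForm, d 0 1, d 0 2, d 0 3, d 1 2, d 1 3, d 2 3, d0, d23, d12, d13,
      hc 0 1, hc 0 2, hc 0 3, hc 1 2, hc 1 3, hc 2 3, c0] <;> ring

/-- The fundamental form of a conformally Kähler metric is conformally closed. -/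
lemma closed_components (hg : IsPseudoRiemannian g) (hU : IsOpen U) (he : IsFrame g euclid U e)
    (h : IsConformallyKahler g J Ω) (hx : x ∈ U) (i j k : Fin 4) :
    nablaKappa g J e i j k x + nablaKappa g J e j k i x + nablaKappa g J e k i j x =
      -2 * ((Ω x)⁻¹ * dirR (e i) Ω x * kappaR g J e j k x
        + (Ω x)⁻¹ * dirR (e j) Ω x * kappaR g J e k i x
        + (Ω x)⁻¹ * dirR (e k) Ω x * kappaR g J e i j x) := by
  have hJ := h.isCompatible
  have ha := hJ.kappaR_antisymm hg e
  have hΩ := h.ne_zero x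
  have hΩd : MDifferentiableAt (𝓡 4) 𝓘(ℝ, ℝ) Ω x := h.smooth.contMDiffAt.mdifferentiableAt (by simp)
  have hκd : ∀ i j, MDifferentiableAt (𝓡 4) 𝓘(ℝ, ℝ) (kappaR g J e i j) x := fun i j =>
    ((hJ.smooth_kappaR hg he i j).contMDiffAt (hU.mem_nhds hx)).mdifferentiableAt (by simp)
  have hd : ∀ i j k, dirR (e i) (fun y => fundamental (fun x => (Ω x ^ 2) • g x) J y (e j y)
      (e k y)) x = Ω x * Ω x * dirR (e i) (kappaR g J e j k) x
        + 2 * Ω x * dirR (e i) Ω x * kappaR g J e j k x := by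
    intro i j k
    have h1 : (fun y => fundamental (fun x => (Ω x ^ 2) • g x) J y (e j y) (e k y)) =
        fun y => (Ω y * Ω y) * kappaR g J e j k y := by
      funext y
      simp [fundamental, kappaR, sq]
    rw [h1, dirR_mul (f := fun y => Ω y * Ω y) (hΩd.mul hΩd) (hκd j k), dirR_mul hΩd hΩd]
    ring
  have hb : ∀ i j k, fundamental (fun x => (Ω x ^ 2) • g x) J x (bracket (e i) (e j) x) (e k x) =
      -(Ω x * Ω x * ∑ m, (conn g e i j m x - conn g e j i m x) * kappaR g J e k m x) := by
    intro i j k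
    simp only [fundamental, he.bracket_expand hg hx, map_sum, map_smul, sum_apply,
      smul_apply, smul_eq_mul, euclid, one_mul, sq, Finset.mul_sum, ← Finset.sum_neg_distrib]
    refine Finset.sum_congr rfl fun m _ => ?_
    rw [ha m k, kappaR]
    ring
  -- The closed form is `Ω² κ`, so `dκ = -2 d log Ω ∧ κ` after division by `Ω²`. The bracket terms
  -- supply the connection terms of `∇κ`.
  have hcl := h.kahler.closed x (e i) (e j) (e k) ((he.smooth i).at hU hx)
    ((he.smooth j).at hU hx) ((he.smooth k).at hU hx)
  have hdk : ∀ i j k, dirR (e i) (kappaR g J e k j) x = -dirR (e i) (kappaR g J e j k) x := by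
    intro i j k
    rw [dirR_congr (h := fun y => -1 * kappaR g J e j k y) hU hx fun y _ => by rw [ha]; ring,
      dirR_mul mdifferentiableAt_const (hκd j k), dirR_const]
    ring
  simp only [hd, hb] at hcl
  have hΩ2 : Ω x * Ω x ≠ 0 := mul_ne_zero hΩ hΩ
  refine mul_left_cancel₀ hΩ2 ?_
  have hΩi : Ω x * (Ω x)⁻¹ = 1 := mul_inv_cancel₀ hΩ
  have hc := fun i k m => conn_antisymm g e i k m x
  simp only [nablaKappa, Fin.sum_univ_four, hc i k, hc j i, hc k j, hdk j i k, ha i k] at hcl ⊢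
  linear_combination hcl + 2 * Ω x * (dirR (e i) Ω x * kappaR g J e j k x
    - dirR (e j) Ω x * kappaR g J e i k x + dirR (e k) Ω x * kappaR g J e i j x) * hΩi

end Killing

/-! ### Differentiating the factors of the Killing spinor. -/

section KillingSpinor

variable {M : Type*} [TopologicalSpace M] [ChartedSpace E4 M] [IsManifold (𝓡 4) ∞ M]
  {U : Set M} {g : BilinField M} {e : Fin 4 → VField M} {x : M}
  {J : EndField M} {Ω : M → ℝ} {α β : SpinorField M} {𝒜 : CForm M}

lemma sdSpinor_eq (a b c : ℝ) (B C : Fin 2) : sdSpinor a b c B C =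
    (a * sdSpinor 1 0 0 B C + b * sdSpinor 0 1 0 B C) + c * sdSpinor 0 0 1 B C := by
  fin_cases B <;> fin_cases C <;> simp [sdSpinor] <;> ring

omit [IsManifold (𝓡 4) ∞ M] in
lemma dirC_sdSpinor {X : VField M} {a b c : M → ℝ} (ha : MDifferentiableAt (𝓡 4) 𝓘(ℝ, ℝ) a x)
    (hb : MDifferentiableAt (𝓡 4) 𝓘(ℝ, ℝ) b x) (hc : MDifferentiableAt (𝓡 4) 𝓘(ℝ, ℝ) c x)
    (B C : Fin 2) : dirC X (fun y => sdSpinor (a y) (b y) (c y) B C) x =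
      sdSpinor (dirR X a x) (dirR X b x) (dirR X c x) B C := by
  have hof : ∀ {f : M → ℝ}, MDifferentiableAt (𝓡 4) 𝓘(ℝ, ℝ) f x →
      MDifferentiableAt (𝓡 4) 𝓘(ℝ, ℂ) (fun y => (f y : ℂ)) x := fun hf =>
    Complex.ofRealCLM.mdifferentiableAt.comp x hf
  have hmul : ∀ {f : M → ℝ} (r : ℂ), MDifferentiableAt (𝓡 4) 𝓘(ℝ, ℝ) f x →
      MDifferentiableAt (𝓡 4) 𝓘(ℝ, ℂ) (fun y => (f y : ℂ) * r) x := fun r hf =>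
    ((hof hf).hasMFDerivAt.mul (mdifferentiableAt_const (c := r)).hasMFDerivAt).mdifferentiableAt
  have hd : ∀ {f : M → ℝ} (r : ℂ), MDifferentiableAt (𝓡 4) 𝓘(ℝ, ℝ) f x →
      dirC X (fun y => (f y : ℂ) * r) x = dirR X f x * r := fun r hf => by
    rw [dirC_mul (hof hf) mdifferentiableAt_const, dirC_const, dirC_ofReal hf]
    ring
  have h1 : (fun y => sdSpinor (a y) (b y) (c y) B C) = fun y => ((a y : ℂ) * sdSpinor 1 0 0 B C
      + (b y : ℂ) * sdSpinor 0 1 0 B C) + (c y : ℂ) * sdSpinor 0 0 1 B C := by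
    funext y
    exact sdSpinor_eq _ _ _ _ _
  rw [h1, dirC_add (f := fun y => (a y : ℂ) * sdSpinor 1 0 0 B C + (b y : ℂ) * sdSpinor 0 1 0 B C)
    ((hmul _ ha).add (hmul _ hb)) (hmul _ hc), dirC_add (hmul _ ha) (hmul _ hb),
    hd _ ha, hd _ hb, hd _ hc, ← sdSpinor_eq]

lemma primedPart_kappa (hg : IsPseudoRiemannian g) (hJ : IsCompatible g J)
    (h : hodge (kappa g J e x) = kappa g J e x) (A B : Fin 2) :
    primedPart euclid (kappa g J e x) A B =
      sdSpinor (kappaR g J e 0 1 x) (kappaR g J e 0 2 x) (kappaR g J e 0 3 x) A B := by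
  rw [← primedPart_sdForm]
  congr 1
  funext i j
  rw [← kappaR_eq_sdForm hg hJ h]
  rfl

/-- Clears `Ω⁻¹`, so that differentiation needs only the product rule. -/
lemma factors_eq_sdSpinor (hg : IsPseudoRiemannian g) (h : IsConformallyKahler g J Ω)
    (hsd : hodge (kappa g J e x) = kappa g J e x) {B C : Fin 2}
    (hK : killingSpinor g J Ω e B C x = (1 / 2) * (α B x * β C x + α C x * β B x)) :
    (1 / 2) * Ω x * (α B x * β C x + α C x * β B x) =
      sdSpinor (kappaR g J e 0 1 x) (kappaR g J e 0 2 x) (kappaR g J e 0 3 x) B C := by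
  have h2 : (Ω x : ℂ) ≠ 0 := by exact_mod_cast h.ne_zero x
  rw [killingSpinor, primedPart_kappa hg h.isCompatible hsd] at hK
  push_cast at hK
  field_simp at hK
  linear_combination -(1 / 2) * hK

/-- The covariant derivative of the Killing spinor. -/
lemma nabla_killingSpinor (hg : IsPseudoRiemannian g) (hU : IsOpen U) (he : IsFrame g euclid U e)
    (h : IsConformallyKahler g J Ω) (hsd : ∀ x ∈ U, hodge (kappa g J e x) = kappa g J e x)
    (hα : SmoothSpinorOn α U) (hβ : SmoothSpinorOn β U)
    (hK : ∀ x ∈ U, ∀ A' B', killingSpinor g J Ω e A' B' x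
      = (1 / 2) * (α A' x * β B' x + α B' x * β A' x)) (hx : x ∈ U) (i : Fin 4) (B C : Fin 2) :
    (1 / 2) * Ω x * (nablaSpinor g euclid e α i B x * β C x + α B x * nablaSpinor g euclid e β i C x
      + nablaSpinor g euclid e α i C x * β B x + α C x * nablaSpinor g euclid e β i B x) =
    sdSpinor (nablaKappa g J e i 0 1 x - (Ω x)⁻¹ * dirR (e i) Ω x * kappaR g J e 0 1 x)
      (nablaKappa g J e i 0 2 x - (Ω x)⁻¹ * dirR (e i) Ω x * kappaR g J e 0 2 x)
      (nablaKappa g J e i 0 3 x - (Ω x)⁻¹ * dirR (e i) Ω x * kappaR g J e 0 3 x) B C := by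
  have hJ := h.isCompatible
  have hΩ := h.ne_zero x
  have hΩd : MDifferentiableAt (𝓡 4) 𝓘(ℝ, ℝ) Ω x := h.smooth.contMDiffAt.mdifferentiableAt (by simp)
  have hκd : ∀ i j, MDifferentiableAt (𝓡 4) 𝓘(ℝ, ℝ) (kappaR g J e i j) x := fun i j =>
    ((hJ.smooth_kappaR hg he i j).contMDiffAt (hU.mem_nhds hx)).mdifferentiableAt (by simp)
  have hαd : ∀ A, MDifferentiableAt (𝓡 4) 𝓘(ℝ, ℂ) (α A) x := fun A =>
    ((hα A).contMDiffAt (hU.mem_nhds hx)).mdifferentiableAt (by simp)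
  have hβd : ∀ A, MDifferentiableAt (𝓡 4) 𝓘(ℝ, ℂ) (β A) x := fun A =>
    ((hβ A).contMDiffAt (hU.mem_nhds hx)).mdifferentiableAt (by simp)
  have hmul : ∀ {p q : M → ℂ}, MDifferentiableAt (𝓡 4) 𝓘(ℝ, ℂ) p x →
      MDifferentiableAt (𝓡 4) 𝓘(ℝ, ℂ) q x → MDifferentiableAt (𝓡 4) 𝓘(ℝ, ℂ) (fun y => p y * q y) x :=
    fun hp hq => (hp.hasMFDerivAt.mul hq.hasMFDerivAt).mdifferentiableAt
  have hφ : ∀ B C, ∀ y ∈ U, (1 / 2) * Ω y * (α B y * β C y + α C y * β B y) =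
      sdSpinor (kappaR g J e 0 1 y) (kappaR g J e 0 2 y) (kappaR g J e 0 3 y) B C :=
    fun B C y hy => factors_eq_sdSpinor hg h (hsd y hy) (hK y hy B C)
  have hd : ∀ B C, (1 / 2) * Ω x * (dirC (e i) (α B) x * β C x + α B x * dirC (e i) (β C) x
      + dirC (e i) (α C) x * β B x + α C x * dirC (e i) (β B) x) +
      (1 / 2) * dirR (e i) Ω x * (α B x * β C x + α C x * β B x) =
      sdSpinor (dirR (e i) (kappaR g J e 0 1) x) (dirR (e i) (kappaR g J e 0 2) x)
        (dirR (e i) (kappaR g J e 0 3) x) B C := by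
    intro B C
    have hΩc : MDifferentiableAt (𝓡 4) 𝓘(ℝ, ℂ) (fun y => (Ω y : ℂ)) x :=
      Complex.ofRealCLM.mdifferentiableAt.comp x hΩd
    rw [← dirC_sdSpinor (hκd 0 1) (hκd 0 2) (hκd 0 3) B C,
      ← dirC_congr hU hx (hφ B C),
      dirC_mul (f := fun y => (1 / 2) * (Ω y : ℂ))
        (h := fun y => α B y * β C y + α C y * β B y)
        (hmul mdifferentiableAt_const hΩc) ((hmul (hαd B) (hβd C)).add (hmul (hαd C) (hβd B))),
      dirC_add (hmul (hαd B) (hβd C)) (hmul (hαd C) (hβd B)), dirC_mul (hαd B) (hβd C),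
      dirC_mul (hαd C) (hβd B), dirC_mul mdifferentiableAt_const hΩc, dirC_const, dirC_ofReal hΩd]
    ring
  have hφx := fun B C => hφ B C x hx
  have hγ : ∀ j k, (conn g e i k j x : ℂ) = -(conn g e i j k x : ℂ) := fun j k => by
    rw [conn_antisymm]
    push_cast
    ring
  have hγR := conn_antisymm g e i
  have hγ0 : ∀ j, conn g e i j j x = 0 := fun j => by linarith [hγR j j x]
  obtain ⟨p, hp⟩ : ∃ p, p = kappaR g J e 0 1 x := ⟨_, rfl⟩
  obtain ⟨q, hq⟩ : ∃ p, p = kappaR g J e 0 2 x := ⟨_, rfl⟩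
  obtain ⟨r, hr⟩ : ∃ p, p = kappaR g J e 0 3 x := ⟨_, rfl⟩
  have hpqr : ∀ j k, kappaR g J e j k x = sdForm p q r j k := by
    intro j k
    rw [kappaR_eq_sdForm hg hJ (hsd x hx), hp, hq, hr]
  -- On self-dual forms the connection acts by the cross product of `(u, v, w)` with `(p, q, r)`,
  -- where `u, v, w` are the self-dual components `γ_{01} + γ_{23}`, `γ_{02} - γ_{13}`, `γ_{03} +
  -- γ_{12}`. The same three numbers make up the spin connection acting on `α` and `β`.
  have hta : nablaKappa g J e i 0 1 x = dirR (e i) (kappaR g J e 0 1) x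
      + r * (conn g e i 0 2 x - conn g e i 1 3 x) - q * (conn g e i 0 3 x + conn g e i 1 2 x) := by
    simp only [nablaKappa, Fin.sum_univ_four, hpqr]
    simp [sdForm, hγ0, hγR 1 2, hγR 1 3]
    ring
  have htb : nablaKappa g J e i 0 2 x = dirR (e i) (kappaR g J e 0 2) x
      + p * (conn g e i 0 3 x + conn g e i 1 2 x) - r * (conn g e i 0 1 x + conn g e i 2 3 x) := by
    simp only [nablaKappa, Fin.sum_univ_four, hpqr]
    simp [sdForm, hγ0, hγR 2 3]
    ring
  have htc : nablaKappa g J e i 0 3 x = dirR (e i) (kappaR g J e 0 3) x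
      + q * (conn g e i 0 1 x + conn g e i 2 3 x) - p * (conn g e i 0 2 x - conn g e i 1 3 x) := by
    simp only [nablaKappa, Fin.sum_univ_four, hpqr]
    simp [sdForm, hγ0]
    ring
  have hS : ∀ a b c t s r w B C, sdSpinor (a - w * t) (b - w * s) (c - w * r) B C =
      sdSpinor a b c B C - w * sdSpinor t s r B C := by
    intro a b c t s r w B C
    fin_cases B <;> fin_cases C <;> simp [sdSpinor] <;> ring
  have hS' : ∀ u v w B C, sdSpinor (dirR (e i) (kappaR g J e 0 1) x + r * v - q * w)
      (dirR (e i) (kappaR g J e 0 2) x + p * w - r * u)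
      (dirR (e i) (kappaR g J e 0 3) x + q * u - p * v) B C =
      sdSpinor (dirR (e i) (kappaR g J e 0 1) x) (dirR (e i) (kappaR g J e 0 2) x)
        (dirR (e i) (kappaR g J e 0 3) x) B C + sdSpinor (r * v - q * w) (p * w - r * u)
        (q * u - p * v) B C := by
    intro u v w B C
    fin_cases B <;> fin_cases C <;> simp [sdSpinor] <;> ring
  have hw : (Ω x : ℂ)⁻¹ * Ω x = 1 := inv_mul_cancel₀ (by exact_mod_cast hΩ)
  rw [hS, hta, htb, htc, hS', ← hd B C, ← hφx B C]
  have hφ00 := hφx 0 0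
  have hφ01 := hφx 0 1
  have hφ11 := hφx 1 1
  rw [← hp, ← hq, ← hr] at hφ00 hφ01 hφ11
  have hI := Complex.I_mul_I
  simp only [nablaSpinor, primedPart_euclid hγ, Fin.sum_univ_two, eps]
  generalize hu : conn g e i 0 1 x + conn g e i 2 3 x = u
  generalize hv : conn g e i 0 2 x - conn g e i 1 3 x = v
  generalize hw' : conn g e i 0 3 x + conn g e i 1 2 x = w
  have hu' : (conn g e i 0 1 x : ℂ) + conn g e i 2 3 x = u := by rw [← hu]; push_cast; rfl
  have hv' : (conn g e i 0 2 x : ℂ) - conn g e i 1 3 x = v := by rw [← hv]; push_cast; rfl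
  have hw'' : (conn g e i 0 3 x : ℂ) + conn g e i 1 2 x = w := by rw [← hw']; push_cast; rfl
  simp only [hu', hv', hw'']
  fin_cases B <;> fin_cases C <;> simp [sdSpinor] at hφ00 hφ01 hφ11 ⊢
  · linear_combination Complex.I * w * hφ00 + (Complex.I * u - v) * hφ01
      + 1 / 2 * dirR (e i) Ω x * (2 * α 0 x * β 0 x) * hw + (w * p - u * r) * hI
  · linear_combination (1 / 2) * (Complex.I * u - v) * hφ11
      + (1 / 2) * (Complex.I * u + v) * hφ00
      + 1 / 2 * dirR (e i) Ω x * (α 0 x * β 1 x + α 1 x * β 0 x) * hw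
  · linear_combination (1 / 2) * (Complex.I * u - v) * hφ11
      + (1 / 2) * (Complex.I * u + v) * hφ00
      + 1 / 2 * dirR (e i) Ω x * (α 0 x * β 1 x + α 1 x * β 0 x) * hw
  · linear_combination (Complex.I * u + v) * hφ01 - Complex.I * w * hφ11
      + 1 / 2 * dirR (e i) Ω x * (2 * α 1 x * β 1 x) * hw + (w * p - u * r) * hI

end KillingSpinor

/-! ### Algebra of the two factors of a Killing spinor. -/

section TwistorPair

variable {n m : Fin 2 → Fin 2 → ℂ} {α β a : Fin 2 → ℂ}

/-- The symmetrised equation `α_(A m_BC) + β_(A n_BC) = 0`. -/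
def IsKillingPair (n m : Fin 2 → Fin 2 → ℂ) (α β : Fin 2 → ℂ) : Prop :=
  ∀ A B C, n A B * β C + α B * m A C + n A C * β B + α C * m A B
    + (n B C * β A + α C * m B A + n B A * β C + α A * m B C)
    + (n C A * β B + α A * m C B + n C B * β A + α B * m C A) = 0

/-- Contracting the equation with `α^A α^B α^C` kills every term containing an undifferentiated `α`.
The rest is the shear of `α` times `α^C β_C`, with factor 6. -/
lemma IsKillingPair.shearFree (h : IsKillingPair n m α β) (hαβ : α 1 * β 0 - α 0 * β 1 ≠ 0) :
    α 1 * α 1 * n 0 0 - α 0 * α 1 * (n 0 1 + n 1 0) + α 0 * α 0 * n 1 1 = 0 := by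
  refine (mul_eq_zero.1 ?_).resolve_left hαβ
  linear_combination (1 / 6) * (α 1 ^ 3 * h 0 0 0 - 3 * α 1 ^ 2 * α 0 * h 0 0 1
    + 3 * α 1 * α 0 ^ 2 * h 0 1 1 - α 0 ^ 3 * h 1 1 1)

/-- A symmetric spinor whose symmetrised product with a nonzero spinor vanishes is zero. -/
lemma eq_zero_of_symmetrised {s : Fin 2 → Fin 2 → ℂ} (hs : ∀ A B, s A B = s B A)
    (hα : ∃ A, α A ≠ 0) (h : ∀ A B C, s A B * α C + s B C * α A + s C A * α B = 0)
    (A B : Fin 2) : s A B = 0 := by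
  have h000 := h 0 0 0
  have h001 := h 0 0 1
  have h011 := h 0 1 1
  have h111 := h 1 1 1
  have hs10 := hs 1 0
  have hall : s 0 0 = 0 ∧ s 0 1 = 0 ∧ s 1 1 = 0 := by
    by_cases h0 : α 0 = 0
    · have h1 : α 1 ≠ 0 := by
        obtain ⟨B, hB⟩ := hα
        fin_cases B
        exacts [absurd h0 hB, hB]
      have b1 : s 1 1 = 0 := (mul_eq_zero.1 (by linear_combination (1 / 3) * h111 :
        s 1 1 * α 1 = 0)).resolve_right h1
      have b2 : s 0 1 = 0 := (mul_eq_zero.1 (by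
        linear_combination (1 / 2) * h011 - (1 / 2) * s 1 1 * h0 - (1 / 2) * α 1 * hs10 :
        s 0 1 * α 1 = 0)).resolve_right h1
      have b3 : s 0 0 = 0 := (mul_eq_zero.1 (by
        linear_combination h001 - (s 0 1 + s 1 0) * h0 : s 0 0 * α 1 = 0)).resolve_right h1
      exact ⟨b3, b2, b1⟩
    · have b1 : s 0 0 = 0 := (mul_eq_zero.1 (by linear_combination (1 / 3) * h000 :
        s 0 0 * α 0 = 0)).resolve_right h0
      have b2 : s 0 1 = 0 := (mul_eq_zero.1 (by
        linear_combination (1 / 2) * h001 - (1 / 2) * α 1 * b1 - (1 / 2) * α 0 * hs10 :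
        s 0 1 * α 0 = 0)).resolve_right h0
      have b3 : s 1 1 = 0 := (mul_eq_zero.1 (by
        linear_combination h011 - 2 * α 1 * b2 - α 1 * hs10 : s 1 1 * α 0 = 0)).resolve_right h0
      exact ⟨b1, b2, b3⟩
  obtain ⟨b1, b2, b3⟩ := hall
  fin_cases A <;> fin_cases B <;> simp [b1, b2, b3, hs10]

/-- The two factors of a Killing spinor have opposite charges. -/
lemma IsKillingPair.charge_neg (h : IsKillingPair n m α β) (hα : ∃ A, α A ≠ 0)
    (hn : ∀ A B, n A B + n B A = a A * α B + a B * α A) (A B : Fin 2) :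
    m A B + m B A = -(a A * β B + a B * β A) := by
  -- Substituting the charge of `α` makes `α` a factor of the whole symmetrised equation. The other
  -- factor is the charged twistor equation of `β` with charge `-a`.
  refine eq_neg_of_add_eq_zero_left (eq_zero_of_symmetrised
    (s := fun A B => m A B + m B A + (a A * β B + a B * β A)) (fun A B => by ring) hα
    (fun A B C => ?_) A B)
  linear_combination h A B C - β C * hn A B - β A * hn B C - β B * hn C A

end TwistorPair

/-! ### Shear-freeness and the imaginary charge. -/

section ConformallyKahler

variable {M : Type*} [TopologicalSpace M] [ChartedSpace E4 M] [IsManifold (𝓡 4) ∞ M]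
  {U : Set M} {g : BilinField M} {e : Fin 4 → VField M} {x : M}
  {J : EndField M} {Ω : M → ℝ} {α β : SpinorField M} {𝒜 : CForm M}

omit [IsManifold (𝓡 4) ∞ M] in
lemma dirR_add {X : VField M} {f h : M → ℝ} (hf : MDifferentiableAt (𝓡 4) 𝓘(ℝ, ℝ) f x)
    (hh : MDifferentiableAt (𝓡 4) 𝓘(ℝ, ℝ) h x) :
    dirR X (fun y => f y + h y) x = dirR X f x + dirR X h x := by
  change mvfderiv (𝓡 4) (f + h) x (X x) = _
  rw [mvfderiv_add hf hh]
  rfl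

/-- The `00` entry of `J² = -1`. -/
lemma kappaR_norm (hg : IsPseudoRiemannian g) (hJ : IsCompatible g J) (he : IsFrame g euclid U e)
    (h : hodge (kappa g J e x) = kappa g J e x) (hx : x ∈ U) :
    kappaR g J e 0 1 x * kappaR g J e 0 1 x + kappaR g J e 0 2 x * kappaR g J e 0 2 x
      + kappaR g J e 0 3 x * kappaR g J e 0 3 x = 1 := by
  have h1 := hJ.kappaR_sq hg he 0 0 hx
  obtain ⟨p, q, r, hp, hq, hr⟩ : ∃ p q r, p = kappaR g J e 0 1 x ∧ q = kappaR g J e 0 2 x ∧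
    r = kappaR g J e 0 3 x := ⟨_, _, _, rfl, rfl, rfl⟩
  have hk := kappaR_eq_sdForm hg hJ h
  rw [← hp, ← hq, ← hr] at hk ⊢
  simp only [hk, Fin.sum_univ_four] at h1
  simp [sdForm] at h1
  linear_combination -h1

/-- Differentiates `|κ|² = 1`. The connection acts on `κ` by a cross product, so it contributes
nothing along `κ`. -/
lemma kappaR_mul_nablaKappa (hg : IsPseudoRiemannian g) (hU : IsOpen U) (hJ : IsCompatible g J)
    (he : IsFrame g euclid U e) (h : ∀ x ∈ U, hodge (kappa g J e x) = kappa g J e x) (hx : x ∈ U)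
    (i : Fin 4) : kappaR g J e 0 1 x * nablaKappa g J e i 0 1 x
      + kappaR g J e 0 2 x * nablaKappa g J e i 0 2 x
      + kappaR g J e 0 3 x * nablaKappa g J e i 0 3 x = 0 := by
  have hd : ∀ i j, MDifferentiableAt (𝓡 4) 𝓘(ℝ, ℝ) (kappaR g J e i j) x := fun i j =>
    ((hJ.smooth_kappaR hg he i j).contMDiffAt (hU.mem_nhds hx)).mdifferentiableAt (by simp)
  have h1 := dirR_congr (X := e i) hU hx fun y hy => kappaR_norm hg hJ he (h y hy) hy
  have hm : ∀ j, MDifferentiableAt (𝓡 4) 𝓘(ℝ, ℝ)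
      (fun y => kappaR g J e 0 j y * kappaR g J e 0 j y) x := fun j => (hd 0 j).mul (hd 0 j)
  rw [dirR_const, dirR_add (f := fun y => kappaR g J e 0 1 y * kappaR g J e 0 1 y
      + kappaR g J e 0 2 y * kappaR g J e 0 2 y) ((hm 1).add (hm 2)) (hm 3),
    dirR_add (hm 1) (hm 2), dirR_mul (hd 0 1) (hd 0 1),
    dirR_mul (hd 0 2) (hd 0 2), dirR_mul (hd 0 3) (hd 0 3)] at h1
  have hγ := conn_antisymm g e i
  have hγ0 : ∀ j, conn g e i j j x = 0 := fun j => by linarith [hγ j j x]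
  obtain ⟨p, q, r, hp, hq, hr⟩ : ∃ p q r, p = kappaR g J e 0 1 x ∧ q = kappaR g J e 0 2 x ∧
    r = kappaR g J e 0 3 x := ⟨_, _, _, rfl, rfl, rfl⟩
  have hk := kappaR_eq_sdForm hg hJ (h x hx)
  rw [← hp, ← hq, ← hr] at hk h1 ⊢
  simp only [nablaKappa, hk, Fin.sum_univ_four]
  simp [sdForm, hγ0, hγ 1 2, hγ 1 3, hγ 2 3]
  linear_combination (1 / 2) * h1

/-- The equation `∇_{A(A'} K_{B'C')} = 0`, with the product rule applied to `K = α β` and the factor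
`Ω` cancelled. -/
lemma killing_pair (hg : IsPseudoRiemannian g) (hU : IsOpen U) (he : IsFrame g euclid U e)
    (h : IsConformallyKahler g J Ω) (hsd : ∀ x ∈ U, hodge (kappa g J e x) = kappa g J e x)
    (hα : SmoothSpinorOn α U) (hβ : SmoothSpinorOn β U)
    (hK : ∀ x ∈ U, ∀ A' B', killingSpinor g J Ω e A' B' x
      = (1 / 2) * (α A' x * β B' x + α B' x * β A' x)) (hx : x ∈ U) (A : Fin 2) :
    IsKillingPair (fun A' B' => nablaS g euclid e α A A' B' x)
      (fun A' B' => nablaS g euclid e β A A' B' x) (fun A => α A x) (fun A => β A x) := by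
  have hJ := h.isCompatible
  have hk := kappaR_eq_sdForm hg hJ (hsd x hx)
  have hT := nablaKappa_eq_sdForm hg hU hJ he hsd hx
  have hn := kappaR_norm hg hJ he (hsd x hx) hx
  have hs := kappaR_mul_nablaKappa hg hU hJ he hsd hx
  have key := killing_of_conformallyKahler (w := fun i => (Ω x)⁻¹ * dirR (e i) Ω x) hn hs
    (fun i j k => by simpa only [← hk, ← hT] using closed_components hg hU he h hx i j k)
    (fun i j k => by simpa only [← hk, ← hT] using
      nijenhuis_components hg hU he h.kahler hJ hx i j k)
  simp only [← nabla_killingSpinor hg hU he h hsd hα hβ hK hx] at key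
  intro A' B' C'
  have hΩ : (Ω x : ℂ) ≠ 0 := by exact_mod_cast h.ne_zero x
  refine (mul_eq_zero.1 ?_).resolve_left hΩ
  have hσ : ∀ i A A', solder euclid i A A' = ((Real.sqrt 2 : ℝ) : ℂ)⁻¹ * quat i A A' := by
    simp [solder, euclid]
  have h1 := key A A' B' C'
  simp only [nablaS, hσ, Fin.sum_univ_four] at h1 ⊢
  linear_combination 2 * ((Real.sqrt 2 : ℝ) : ℂ)⁻¹ * h1

lemma conj_solder (i : Fin 4) (A A' : Fin 2) : (starRingEnd ℂ) (solder euclid i A A') =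
    conjSign A * conjSign A' * solder euclid i A.rev A'.rev := by
  fin_cases i <;> fin_cases A <;> fin_cases A' <;> simp [solder, euclid, quat, conjSign]

omit [IsManifold (𝓡 4) ∞ M] in
-- The connection coefficients are real, so the spin connection commutes with the quaternionic
-- conjugation, which takes `α` to `β` up to the factor `i`.
lemma conj_nablaSpinor (hU : IsOpen U) (hα : SmoothSpinorOn α U)
    (hαβ : ∀ x ∈ U, ∀ A', β A' x = Complex.I * dagger α A' x) (hx : x ∈ U) (i : Fin 4)
    (A : Fin 2) : (starRingEnd ℂ) (nablaSpinor g euclid e α i A x) =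
      -Complex.I * conjSign A * nablaSpinor g euclid e β i A.rev x := by
  have hγ : ∀ j k, (conn g e i k j x : ℂ) = -(conn g e i j k x : ℂ) := fun j k => by
    rw [conn_antisymm]
    push_cast
    ring
  have hd : ∀ A, MDifferentiableAt (𝓡 4) 𝓘(ℝ, ℂ) (fun y => (starRingEnd ℂ) (α A y)) x := fun A =>
    ((contMDiffOn_conj (hα A)).contMDiffAt (hU.mem_nhds hx)).mdifferentiableAt (by simp)
  have hd' : ∀ A, MDifferentiableAt (𝓡 4) 𝓘(ℝ, ℂ) (α A) x := fun A =>
    ((hα A).contMDiffAt (hU.mem_nhds hx)).mdifferentiableAt (by simp)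
  have hβ0 : ∀ y ∈ U, β 0 y = -Complex.I * (starRingEnd ℂ) (α 1 y) := fun y hy => by
    rw [hαβ y hy]
    simp [dagger]
  have hβ1 : ∀ y ∈ U, β 1 y = Complex.I * (starRingEnd ℂ) (α 0 y) := fun y hy => by
    rw [hαβ y hy]
    simp [dagger]
  have hD0 : dirC (e i) (β 0) x = -Complex.I * (starRingEnd ℂ) (dirC (e i) (α 1) x) := by
    rw [dirC_congr hU hx hβ0, dirC_mul mdifferentiableAt_const (hd 1), dirC_const,
      dirC_conj (hd' 1)]
    ring
  have hD1 : dirC (e i) (β 1) x = Complex.I * (starRingEnd ℂ) (dirC (e i) (α 0) x) := by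
    rw [dirC_congr hU hx hβ1, dirC_mul mdifferentiableAt_const (hd 0), dirC_const,
      dirC_conj (hd' 0)]
    ring
  have hG := conj_primedPart hγ
  have hs := primedPart_symm euclid hγ 1 0
  simp only [Complex.conj_ofReal] at hG
  fin_cases A <;>
    simp [nablaSpinor, eps, Fin.sum_univ_two, hG, conjSign, hD0, hD1, hβ0 x hx, hβ1 x hx, hs]
  all_goals
    ring_nf
    simp only [Complex.I_sq]
    ring

omit [IsManifold (𝓡 4) ∞ M] in
lemma conj_nablaS (hU : IsOpen U) (hα : SmoothSpinorOn α U)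
    (hαβ : ∀ x ∈ U, ∀ A', β A' x = Complex.I * dagger α A' x) (hx : x ∈ U)
    (A A' B' : Fin 2) : (starRingEnd ℂ) (nablaS g euclid e α A A' B' x) =
      -Complex.I * conjSign A * conjSign A' * conjSign B' *
        nablaS g euclid e β A.rev A'.rev B'.rev x := by
  simp only [nablaS, map_sum, map_mul, conj_solder, conj_nablaSpinor hU hα hαβ hx,
    Finset.mul_sum]
  exact Finset.sum_congr rfl fun i _ => by ring

/-- The spinor of `κ` has determinant `|κ|² = 1`. Computed from the factors, the determinant is
`-(Ω² / 4) (α_{1'} β_{0'} - α_{0'} β_{1'})²`. -/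
lemma killing_factors_ne_zero (hg : IsPseudoRiemannian g) (he : IsFrame g euclid U e)
    (h : IsConformallyKahler g J Ω) (hsd : hodge (kappa g J e x) = kappa g J e x)
    (hK : ∀ A' B', killingSpinor g J Ω e A' B' x
      = (1 / 2) * (α A' x * β B' x + α B' x * β A' x)) (hx : x ∈ U) :
    α 1 x * β 0 x - α 0 x * β 1 x ≠ 0 := by
  intro h0
  have hn := kappaR_norm hg h.isCompatible he hsd hx
  have hφ := fun B C => factors_eq_sdSpinor hg h hsd (hK B C)
  have h00 := hφ 0 0
  have h01 := hφ 0 1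
  have h11 := hφ 1 1
  have hn' : (kappaR g J e 0 1 x : ℂ) * kappaR g J e 0 1 x + (kappaR g J e 0 2 x : ℂ) *
      kappaR g J e 0 2 x + (kappaR g J e 0 3 x : ℂ) * kappaR g J e 0 3 x = 1 := by
    exact_mod_cast hn
  simp only [sdSpinor, Matrix.of_apply, Matrix.cons_val', Matrix.cons_val_zero,
    Matrix.cons_val_one] at h00 h01 h11
  have hdet := congrArg₂ (· * ·) h00 h11
  have hdet' := congrArg₂ (· * ·) h01 h01
  beta_reduce at hdet hdet'
  have hI := Complex.I_mul_I
  refine one_ne_zero (α := ℂ) ?_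
  linear_combination -hn' - hdet + hdet' - (1 / 4) * (Ω x : ℂ) ^ 2 *
    (α 1 x * β 0 x - α 0 x * β 1 x) * h0 +
      ((kappaR g J e 0 1 x : ℂ) ^ 2 + (kappaR g J e 0 3 x : ℂ) ^ 2) * hI

/-- The charge of the factor `α` of the Killing spinor is imaginary if the other factor is
`i α†`. -/
lemma re_charge_eq_zero (hg : IsPseudoRiemannian g) (hU : IsOpen U) (he : IsFrame g euclid U e)
    (h : IsConformallyKahler g J Ω) (hsd : ∀ x ∈ U, hodge (kappa g J e x) = kappa g J e x)
    (hα : SmoothSpinorOn α U) (hβ : SmoothSpinorOn β U)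
    (hK : ∀ x ∈ U, ∀ A' B', killingSpinor g J Ω e A' B' x
      = (1 / 2) * (α A' x * β B' x + α B' x * β A' x))
    (h𝒜 : IsChargedTwistor g euclid U e α 𝒜)
    (hαβ : ∀ x ∈ U, ∀ A', β A' x = Complex.I * dagger α A' x) (hx : x ∈ U)
    (v : TangentSpace (𝓡 4) x) : (𝒜 x v).re = 0 := by
  have hne := killing_factors_ne_zero hg he h (hsd x hx) (hK x hx) hx
  have hα0 : ∃ A, α A x ≠ 0 := by
    by_contra! hc
    exact hne (by rw [hc 0, hc 1]; ring)
  have hβ0 : ∃ A, β A x ≠ 0 := by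
    by_contra! hc
    exact hne (by rw [hc 0, hc 1]; ring)
  have htw : ∀ A A' B', nablaS g euclid e α A A' B' x + nablaS g euclid e α A B' A' x =
      formS euclid e 𝒜 A A' x * α B' x + formS euclid e 𝒜 A B' x * α A' x := fun A A' B' => by
    linear_combination 2 * h𝒜 x hx A A' B'
  -- By the Killing spinor equation, `β` has charge `-𝒜`.
  have hneg : ∀ A A' B', nablaS g euclid e β A A' B' x + nablaS g euclid e β A B' A' x =
      -(formS euclid e 𝒜 A A' x * β B' x + formS euclid e 𝒜 A B' x * β A' x) := fun A =>
    (killing_pair hg hU he h hsd hα hβ hK hx A).charge_neg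
      (a := fun A' => formS euclid e 𝒜 A A' x) hα0 (htw A)
  have hconj : ∀ A A', (starRingEnd ℂ) (formS euclid e 𝒜 A A' x) = conjSign A * conjSign A' *
      ∑ i, solder euclid i A.rev A'.rev * (starRingEnd ℂ) (𝒜 x (e i x)) := by
    intro A A'
    simp only [formS, map_sum, map_mul, conj_solder, Finset.mul_sum]
    exact Finset.sum_congr rfl fun i _ => by ring
  have hs : ∀ A, conjSign A * conjSign A = 1 := fun A => by fin_cases A <;> simp [conjSign]
  have hαc : ∀ A, (starRingEnd ℂ) (α A x) = -Complex.I * conjSign A * β A.rev x := by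
    intro A
    rw [hαβ x hx]
    fin_cases A <;> simp [dagger, conjSign, ← mul_assoc]
  -- Conjugating the equation of `α` gives `β` the charge `conj 𝒜`.
  have hpos : ∀ A A' B', nablaS g euclid e β A A' B' x + nablaS g euclid e β A B' A' x =
      (∑ i, solder euclid i A A' * (starRingEnd ℂ) (𝒜 x (e i x))) * β B' x +
        (∑ i, solder euclid i A B' * (starRingEnd ℂ) (𝒜 x (e i x))) * β A' x := by
    intro A A' B'
    have h1 := congrArg (starRingEnd ℂ) (htw A.rev A'.rev B'.rev)
    simp only [map_add, map_mul, conj_nablaS hU hα hαβ hx, hconj, hαc, Fin.rev_rev] at h1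
    have hσ : -Complex.I * conjSign A.rev * conjSign A'.rev * conjSign B'.rev ≠ 0 := by
      have : ∀ A, conjSign A ≠ 0 := fun A h => by simpa [h] using hs A
      simp [this]
    refine mul_left_cancel₀ hσ ?_
    linear_combination h1
  -- The charge of the nonzero spinor `β` is unique, so the two charges agree.
  have hzero : ∀ i, 𝒜 x (e i x) + (starRingEnd ℂ) (𝒜 x (e i x)) = 0 := by
    refine eq_zero_of_sum_solder (η := euclid) fun A A' => ?_
    have h1 : formS euclid e 𝒜 A A' x +
        ∑ i, solder euclid i A A' * (starRingEnd ℂ) (𝒜 x (e i x)) = 0 :=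
      eq_zero_of_symmetric_mul_spinor (d := fun A' => formS euclid e 𝒜 A A' x +
        ∑ i, solder euclid i A A' * (starRingEnd ℂ) (𝒜 x (e i x))) (α := fun A => β A x) hβ0
        (fun A' B' => by linear_combination hneg A A' B' - hpos A A' B') A'
    rw [← h1, formS, ← Finset.sum_add_distrib]
    exact Finset.sum_congr rfl fun i _ => by ring
  have hre : ∀ i, (𝒜 x (e i x)).re = 0 := fun i => by
    have h1 := congrArg Complex.re (hzero i)
    simp at h1
    linarith
  rw [he.expand hg hx v]
  simp [hre]

/-- A factor of the Killing spinor of a conformally Kähler metric is shear-free. -/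
lemma isShearFree_of_killing (hg : IsPseudoRiemannian g) (hU : IsOpen U)
    (he : IsFrame g euclid U e) (h : IsConformallyKahler g J Ω)
    (hsd : ∀ x ∈ U, hodge (kappa g J e x) = kappa g J e x)
    (hα : SmoothSpinorOn α U) (hβ : SmoothSpinorOn β U)
    (hK : ∀ x ∈ U, ∀ A' B', killingSpinor g J Ω e A' B' x
      = (1 / 2) * (α A' x * β B' x + α B' x * β A' x)) : IsShearFree g euclid U e α :=
  isShearFree_iff.2 fun x hx A => (killing_pair hg hU he h hsd hα hβ hK hx A).shearFree
    (killing_factors_ne_zero hg he h (hsd x hx) (hK x hx) hx)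

end ConformallyKahler

end SpinGeometry

end

/-! ### Assembly of the two statements. -/

theorem proposition2 {M : Type*} [TopologicalSpace M] [ChartedSpace E4 M]
    [IsManifold (𝓡 4) ∞ M] :
    -- hyper-Kähler and conformally Kähler with the same orientation
    (∀ (g : Metric M) (o : Orient M) (J : EndField M) (Ω : M → ℝ),
      IsHyperkahler g.inner o → IsConformallyKahler g.inner J Ω → IsSelfDual g.inner o J →
      ∀ (U : Set M) (e : Fin 4 → VField M), IsOpen U → IsOrientedFrame g.inner o U e →
      ∀ α β : SpinorField M, SmoothSpinorOn α U → SmoothSpinorOn β U →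
      (∀ x ∈ U, ∀ A' B', killingSpinor g.inner J Ω e A' B' x
        = (1 / 2) * (α A' x * β B' x + α B' x * β A' x)) →
      ∃ 𝒜 : CForm M, IsTwistorConnection g.inner euclid U e α 𝒜 ∧
        -- for `β = i α†`, the connection has structure group `U(1)`
        ((∀ x ∈ U, ∀ A', β A' x = Complex.I * dagger α A' x) →
          ∀ x ∈ U, ∀ v, (𝒜 x v).re = 0) ∧
        -- the connection is anti-self-dual
        IsASD g.inner euclid U e 𝒜 ∧
        ∀ x ∈ U, hodge (curv e 𝒜 x) = -curv e 𝒜 x) ∧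
    -- the general case, in any signature
    (∀ (g : BilinField M) (η : Fin 4 → ℝ) (U : Set M) (e : Fin 4 → VField M),
      IsPseudoRiemannian g → IsOpen U → IsFrame g η U e →
      ∀ α : SpinorField M, SmoothSpinorOn α U → (∀ x ∈ U, ∃ A', α A' x ≠ 0) →
      IsShearFree g η U e α →
      ∃ 𝒜 : CForm M, IsTwistorConnection g η U e α 𝒜 ∧
        ((∀ x ∈ U, ∀ A' B' C', ∑ D', weylSD g η e A' B' C' D' x * raise α D' x = 0) →
          IsASD g η U e 𝒜 ∧
          -- for a Riemannian metric the condition forces the self-dual Weyl spinor to vanish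
          (η = euclid → (∀ x ∈ U, ∀ A' B' C' D', weylSD g η e A' B' C' D' x = 0) ∧
            ∀ x ∈ U, hodge (curv e 𝒜 x) = -curv e 𝒜 x))) := by
  refine ⟨fun g o J Ω hHK hCK hSD U e hU he α β hα hβ hK => ?_,
    fun g η U e hg hU he α hα h0 hs => ?_⟩
  · have hg := Metric.isPseudoRiemannian g
    have hsd := hSD U e hU he
    have he' := he.toIsFrame
    -- Nondegeneracy of the Killing spinor keeps its factor `α` away from zero.
    have h0 : ∀ x ∈ U, ∃ A', α A' x ≠ 0 := by
      intro x hx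
      have hne := killing_factors_ne_zero hg he' hCK (hsd x hx) (hK x hx) hx
      by_contra! hc
      exact hne (by rw [hc 0, hc 1]; ring)
    obtain ⟨𝒜, h𝒜⟩ := exists_twistorConnection hg hU he' hα h0
      (isShearFree_of_killing hg hU he' hCK hsd hα hβ hK)
    -- Here `Ψ̃ = 0`, so it annihilates `α` trivially.
    have hASD := isASD_of_weylSD hg hU he' hα h0 h𝒜 fun x hx A' B' C' => by
      simp [(hHK U e hU he x hx).2]
    exact ⟨𝒜, h𝒜, fun hαβ x hx v =>
      re_charge_eq_zero hg hU he' hCK hsd hα hβ hK h𝒜.2.1 hαβ hx v, hASD,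
      fun x hx => hodge_curv_eq_neg hg he' hASD hx⟩
  · obtain ⟨𝒜, h𝒜⟩ := exists_twistorConnection hg hU he hα h0 hs
    refine ⟨𝒜, h𝒜, fun hW => ?_⟩
    have hASD := isASD_of_weylSD hg hU he hα h0 h𝒜 hW
    refine ⟨hASD, ?_⟩
    rintro rfl
    exact ⟨fun x hx => weylSD_eq_zero hg hU he hx (h0 x hx) (hW x hx),
      fun x hx => hodge_curv_eq_neg hg he hASD hx⟩
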